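/- Let $\mathcal{T}$ be a (finite) triangulation of a polygonal region $\Omega\subset\mathbb{R}^2$, with sets of vertices $\mathcal{V}$, edges $\mathcal{E}$ and triangles $\mathcal{F}$. The Powell-Sabin 12-split of a triangle is its subdivision into 12 triangles by its three medians and by the three segments joining its edge midpoints; let $\mathcal{T}_{12}$ be the triangulation obtained from $\mathcal{T}$ by replacing every triangle by its 12-split. Let $\mathcal{S}^{2,3}_5(\mathcal{T}_{12})$ be the real vector space of all functions $s:\Omega\to\mathbb{R}$ such that - $s\in C^2(\Omega)$, and $s$ restricted to each triangle of $\mathcal{T}_{12}$ is a bivariate polynomial of total degree at most $5$; - $s$ is of class $C^3$ on every (closed) triangle of $\mathcal{F}$; - for every $\boldsymbol{v}\in\mathcal{V}$, the polynomials $s|_{\tau}$, with $\tau$ ranging over the triangles of $\mathcal{T}_{12}$ having a vertex at $\boldsymbol{v}$, have common derivatives up to order three at $\boldsymbol{v}$. For every $\boldsymbol{v}\in\mathcal{V}$ let $\boldsymbol{x}_{\boldsymbol{v}},\boldsymbol{y}_{\boldsymbol{v}}\in\mathbb{R}^2$ be any linearly independent vectors, and for every edge $e=[\boldsymbol{a},\boldsymbol{b}]\in\mathcal{E}$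 let $\boldsymbol{u}_e\in\mathbb{R}^2$ be any vector not parallel to $e$ (in particular nonzero), and let $\boldsymbol{m}_e=\frac{\boldsymbol{a}+\boldsymbol{b}}{2}$, $\boldsymbol{q}_{1,e}=\frac{3\boldsymbol{a}+\boldsymbol{b}}{4}$, $\boldsymbol{q}_{2,e}=\frac{\boldsymbol{a}+3\boldsymbol{b}}{4}$. Write $\varepsilon_{\boldsymbol{p}}$ for evaluation at $\boldsymbol{p}$ and $D_{\boldsymbol{u}}$ for the directional derivative in the direction $\boldsymbol{u}$ (taken within $\Omega$). Then the functionals \[ \Lambda=\bigcup_{\boldsymbol{v}\in\mathcal{V}}\ \bigcup_{\substack{i+j\le 3\\ i,j\ge 0}}\{\varepsilon_{\boldsymbol{v}}D^i_{\boldsymbol{x}_{\boldsymbol{v}}}D^j_{\boldsymbol{y}_{\boldsymbol{v}}}\}\ \cup\ \bigcup_{e\in\mathcal{E}}\{\varepsilon_{\boldsymbol{q}_{1,e}}D^2_{\boldsymbol{u}_e},\ \varepsilon_{\boldsymbol{m}_e}D_{\boldsymbol{u}_e},\ \varepsilon_{\boldsymbol{q}_{2,e}}D^2_{\boldsymbol{u}_e}\}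 \] form a basis of the dual space of $\mathcal{S}^{2,3}_5(\mathcal{T}_{12})$. In particular, $\mathcal{S}^{2,3}_5(\mathcal{T}_{12})$ is finite-dimensional and \[ \dim \mathcal{S}^{2,3}_5(\mathcal{T}_{12}) = 10|\mathcal{V}|+3|\mathcal{E}|. \] -/

import Mathlib

noncomputable section

namespace PSSpline

/-- The Euclidean plane. -/
abbrev Plane : Type := EuclideanSpace ℝ (Fin 2)

/-! ### Polynomials and spline spaces -/

/-- The function on the plane given by a bivariate polynomial. -/
def polyFun (p : MvPolynomial (Fin 2) ℝ) (x : Plane) : ℝ :=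
  MvPolynomial.eval (fun i => x i) p

lemma polyFun_zero : polyFun 0 = 0 := by
  funext x
  simp [polyFun]

lemma polyFun_add (p q : MvPolynomial (Fin 2) ℝ) : polyFun (p + q) = polyFun p + polyFun q := by
  funext x
  simp [polyFun]

lemma polyFun_smul (c : ℝ) (p : MvPolynomial (Fin 2) ℝ) : polyFun (c • p) = c • polyFun p := by
  funext x
  simp [polyFun, MvPolynomial.smul_eval]

lemma contDiff_polyFun (p : MvPolynomial (Fin 2) ℝ) (n : WithTop ℕ∞) :
    ContDiff ℝ n (polyFun p) := by
  have h : polyFun p = fun x : Plane => MvPolynomial.eval (fun i => x i) p := rfl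
  rw [h]
  induction p using MvPolynomial.induction_on with
  | C a => simpa using contDiff_const
  | add p q hp hq => simpa using (hp rfl).add (hq rfl)
  | mul_X p i hp => simpa using (hp rfl).mul (by fun_prop)

/-- `s` agrees on the closed triangle with vertex set `τ` with the polynomial `p`. -/
def IsPiece (s : Plane → ℝ) (τ : Set Plane) (p : MvPolynomial (Fin 2) ℝ) : Prop :=
  Set.EqOn s (polyFun p) (convexHull ℝ τ)

/-- `𝒮_d^r`: the functions on `Ω` that are of class `C^r` on `Ω` and coincide with a polynomial
of total degree at most `d` on every triangle of `Δ` (triangles are given by their vertex sets).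
A function on `Ω` is represented by its extension by zero to the plane. -/
def splineSpace (Ω : Set Plane) (Δ : Set (Set Plane)) (r d : ℕ) : Submodule ℝ (Plane → ℝ) where
  carrier := {s | (∀ x ∉ Ω, s x = 0) ∧ ContDiffOn ℝ r s Ω ∧
    ∀ τ ∈ Δ, ∃ p : MvPolynomial (Fin 2) ℝ, p.totalDegree ≤ d ∧ IsPiece s τ p}
  zero_mem' := ⟨fun _ _ => rfl, contDiffOn_const, fun _ _ =>
    ⟨0, by simp, fun x _ => by simp [polyFun_zero]⟩⟩
  add_mem' := by
    rintro s s' ⟨h0, h1, h2⟩ ⟨h0', h1', h2'⟩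
    refine ⟨fun x hx => by simp [h0 x hx, h0' x hx], h1.add h1', fun τ hτ => ?_⟩
    obtain ⟨p, hp, hsp⟩ := h2 τ hτ
    obtain ⟨q, hq, hsq⟩ := h2' τ hτ
    exact ⟨p + q, (MvPolynomial.totalDegree_add p q).trans (max_le hp hq),
      fun x hx => by simp [polyFun_add, hsp hx, hsq hx]⟩
  smul_mem' := by
    rintro c s ⟨h0, h1, h2⟩
    refine ⟨fun x hx => by simp [h0 x hx], contDiffOn_const.smul h1, fun τ hτ => ?_⟩
    obtain ⟨p, hp, hsp⟩ := h2 τ hτ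
    exact ⟨c • p, (MvPolynomial.totalDegree_smul_le c p).trans hp,
      fun x hx => by simp [polyFun_smul, hsp hx]⟩

/-- `s ∈ C^k(v)`: the polynomials representing `s` on the triangles of `Δ` that have a vertex at
`v` have common derivatives up to order `k` at `v`. -/
def SmoothAtVertex (Δ : Set (Set Plane)) (k : ℕ) (v : Plane) (s : Plane → ℝ) : Prop :=
  ∀ τ ∈ Δ, ∀ τ' ∈ Δ, v ∈ τ → v ∈ τ' → ∃ p q : MvPolynomial (Fin 2) ℝ,
    IsPiece s τ p ∧ IsPiece s τ' q ∧
      ∀ m ≤ k, iteratedFDeriv ℝ m (polyFun p) v = iteratedFDeriv ℝ m (polyFun q) v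

/-! ### Triangulations -/

/-- A triangulation of a polygonal region: a geometric simplicial complex in the plane with
finitely many simplices, each of which is a face of a triangle. The region is `K.space`. -/
structure IsTriangulation (K : Geometry.SimplicialComplex ℝ Plane) : Prop where
  finite : K.faces.Finite
  pure : ∀ s ∈ K.faces, ∃ t ∈ K.faces, s ⊆ t ∧ t.card = 3

/-- The edges of a triangulation, as two-point vertex sets. -/
def edges (K : Geometry.SimplicialComplex ℝ Plane) : Set (Finset Plane) :=
  {e ∈ K.faces | e.card = 2}

/-- The triangles of a triangulation, as three-point vertex sets. -/
def triangles (K : Geometry.SimplicialComplex ℝ Plane) : Set (Finset Plane) :=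
  {t ∈ K.faces | t.card = 3}

/-- The twelve triangles of the Powell-Sabin 12-split of the triangle with vertex set `t`, which is
cut by its three medians and by the three segments joining its edge midpoints. Each labelling
`a, b, c` of the vertices gives one triangle at the corner `a` and one triangle at the centroid; they
share the edge from `(a+b)/2` to `(2a+b+c)/4`, the crossing of the median from `a` with the segment
joining the midpoints of the edges at `a`. -/
def split12 (t : Set Plane) : Set (Set Plane) :=
  {τ | ∃ a b c : Plane, t = {a, b, c} ∧
    (τ = {a, (1 / 2 : ℝ) • (a + b), (1 / 4 : ℝ) • ((2 : ℝ) • a + b + c)} ∨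
     τ = {(1 / 2 : ℝ) • (a + b), (1 / 4 : ℝ) • ((2 : ℝ) • a + b + c),
       (1 / 3 : ℝ) • (a + b + c)})}

/-- The triangles of the 12-split refinement `𝒯₁₂`. -/
def refine12 (K : Geometry.SimplicialComplex ℝ Plane) : Set (Set Plane) :=
  ⋃ t ∈ triangles K, split12 (t : Set Plane)

/-- `𝒮_5^{2,3}(𝒯₁₂)`: the `C^2` quintic splines on `𝒯₁₂` that are `C^3` on every macrotriangle and
at every vertex of `𝒯`. -/
def superSplineSpace (K : Geometry.SimplicialComplex ℝ Plane) : Submodule ℝ (Plane → ℝ) where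
  carrier := {s | s ∈ splineSpace K.space (refine12 K) 2 5 ∧
    (∀ t ∈ triangles K, ContDiffOn ℝ 3 s (convexHull ℝ (t : Set Plane))) ∧
    ∀ v ∈ K.vertices, SmoothAtVertex (refine12 K) 3 v s}
  zero_mem' := ⟨Submodule.zero_mem _, fun _ _ => contDiffOn_const, fun _ _ _ _ _ _ _ _ =>
    ⟨0, 0, fun x _ => by simp [polyFun_zero], fun x _ => by simp [polyFun_zero], fun _ _ => rfl⟩⟩
  add_mem' := by
    rintro s s' ⟨h0, h1, h2⟩ ⟨h0', h1', h2'⟩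
    refine ⟨Submodule.add_mem _ h0 h0', fun t ht => (h1 t ht).add (h1' t ht), ?_⟩
    intro v hv τ hτ τ' hτ' hvτ hvτ'
    obtain ⟨p, q, hp, hq, hpq⟩ := h2 v hv τ hτ τ' hτ' hvτ hvτ'
    obtain ⟨p', q', hp', hq', hpq'⟩ := h2' v hv τ hτ τ' hτ' hvτ hvτ'
    refine ⟨p + p', q + q', fun x hx => by simp [polyFun_add, hp hx, hp' hx],
      fun x hx => by simp [polyFun_add, hq hx, hq' hx], fun m hm => ?_⟩
    rw [polyFun_add, polyFun_add,
      iteratedFDeriv_add_apply (contDiff_polyFun p m).contDiffAt (contDiff_polyFun p' m).contDiffAt,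
      iteratedFDeriv_add_apply (contDiff_polyFun q m).contDiffAt (contDiff_polyFun q' m).contDiffAt,
      hpq m hm, hpq' m hm]
  smul_mem' := by
    rintro c s ⟨h0, h1, h2⟩
    refine ⟨Submodule.smul_mem _ c h0, fun t ht => contDiffOn_const.smul (h1 t ht), ?_⟩
    intro v hv τ hτ τ' hτ' hvτ hvτ'
    obtain ⟨p, q, hp, hq, hpq⟩ := h2 v hv τ hτ τ' hτ' hvτ hvτ'
    refine ⟨c • p, c • q, fun x hx => by simp [polyFun_smul, hp hx],
      fun x hx => by simp [polyFun_smul, hq hx], fun m hm => ?_⟩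
    rw [polyFun_smul, polyFun_smul,
      iteratedFDeriv_const_smul_apply (contDiff_polyFun p m).contDiffAt,
      iteratedFDeriv_const_smul_apply (contDiff_polyFun q m).contDiffAt, hpq m hm]

/-! ### The functionals -/

/-- The index set of the functionals: for every vertex `v` the pairs `(i, j)` with `i + j ≤ 3`,
for every edge `e` one index for its midpoint, and one index for each of its two quarterpoints,
which are labelled by the nearest endpoint `a` of `e`. -/
inductive HermiteIndex (K : Geometry.SimplicialComplex ℝ Plane) : Type
  | vertex (v : K.vertices) (i j : ℕ) (hij : i + j ≤ 3) : HermiteIndex K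
  | midpoint (e : edges K) : HermiteIndex K
  | quarter (e : edges K) (a : Plane) (ha : a ∈ e.1) : HermiteIndex K

/-- The midpoint `(a + b) / 2` of the edge `e = {a, b}`. -/
def edgeMidpoint (e : Finset Plane) : Plane := (1 / 2 : ℝ) • ∑ w ∈ e, w

/-- The quarterpoint `(3 a + b) / 4` of the edge `e = {a, b}`. -/
def edgeQuarter (e : Finset Plane) (a : Plane) : Plane :=
  (1 / 4 : ℝ) • ((2 : ℝ) • a + ∑ w ∈ e, w)

/-- The values of the functionals `ε_v D_{x_v}^i D_{y_v}^j`, `ε_{m_e} D_{u_e}` and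
`ε_{q_e} D_{u_e}^2` at a function `s` on the region `K.space`; derivatives are taken within
`K.space`. -/
def hermiteValue (K : Geometry.SimplicialComplex ℝ Plane) (x y : Plane → Plane)
    (u : Finset Plane → Plane) (s : Plane → ℝ) : HermiteIndex K → ℝ
  | .vertex v i j _ => iteratedFDerivWithin ℝ (i + j) s K.space v
      (Fin.append (fun _ : Fin i => x v) (fun _ : Fin j => y v))
  | .midpoint e => iteratedFDerivWithin ℝ 1 s K.space (edgeMidpoint e) (fun _ => u e)
  | .quarter e a _ => iteratedFDerivWithin ℝ 2 s K.space (edgeQuarter e a) (fun _ => u e)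

end PSSpline

end

/-! The proof combines unisolvence on a single triangle with gluing along edges.

On one macrotriangle there are 3·10 + 3·3 = 39 functionals. A `C³` quintic on the 12-split on which
all of them vanish is zero (`eq_zero_of_hermite`). On the other hand, quintic polynomials together
with affine multiples of `max (line) 0 ^ 4`, one multiple for each of the six lines of the split,
form a space of `C³` splines of dimension 21 + 6·3 = 39 (`splitMap`, `splitMap_eq_zero`). The
Hermite map on this space is therefore injective between spaces of equal dimension, so arbitrary
data can be interpolated (`exists_hermite_interpolant`). It is never needed in advance that the
truncated powers exhaust the `C³` splines.

The vanishing statement has two stages. Along an edge, the function and its first and second cross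
derivatives are splines with one breakpoint, of degrees 5, 4 and 3, and the data on the edge
determine all three (`edge_coeffs`). Hence every corner piece is divisible by the cube of the linear
form of its edge. Inside the triangle, quintics with contact of order three along a segment differ
by the fourth power of its linear form times an affine factor (`sub_of_contact`). Comparing these
factors at a corner (`corner_elimination`), around the centroid (`centroid_elimination`) and finally
across two medians (`split_elimination`) leaves only the zero spline.

Globally, injectivity follows triangle by triangle. For surjectivity, local interpolants of the same
data agree to second order along common edges, by the edge argument applied to their difference, and
to third order at common vertices (`IsLocalInterpolant.agree_edge`,
`IsLocalInterpolant.agree_vertex`), so they glue to an element of the space (`contDiffOn_glue`).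
Derivatives within the region are identified with derivatives of polynomial pieces by
`iteratedFDerivWithin_eq_of_eqOn` and, for order three at vertices, by
`iteratedFDerivWithin_vertex`. The Hermite map is thus an isomorphism onto the functions on the
index set, which gives both the basis of the dual and the dimension. -/

noncomputable section

namespace PSSpline

/-! ### Plane frames -/

/-- The determinant of two plane vectors. -/
def cr (u v : Plane) : ℝ := u 0 * v 1 - u 1 * v 0

/-- The point with coordinates `(x, y)` in the affine frame `(o; w₁, w₂)`. -/
def fr (o w₁ w₂ : Plane) (x y : ℝ) : Plane := o + x • w₁ + y • w₂

lemma fr_apply (o w₁ w₂ : Plane) (x y : ℝ) (i : Fin 2) :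
    fr o w₁ w₂ x y i = o i + x * w₁ i + y * w₂ i := by simp [fr]

lemma plane_ext {p q : Plane} (h0 : p 0 = q 0) (h1 : p 1 = q 1) : p = q := by
  ext i; fin_cases i <;> assumption

lemma exists_smul_of_cr {w₁ w₂ : Plane} (h : cr w₁ w₂ ≠ 0) (v : Plane) :
    v = (cr v w₂ / cr w₁ w₂) • w₁ + (cr w₁ v / cr w₁ w₂) • w₂ := by
  apply plane_ext <;> simp only [PiLp.add_apply, PiLp.smul_apply, smul_eq_mul] <;> field_simp <;>
    simp only [cr] <;> ring

lemma exists_fr {w₁ w₂ : Plane} (h : cr w₁ w₂ ≠ 0) (o z : Plane) :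
    ∃ x y, z = fr o w₁ w₂ x y := by
  refine ⟨cr (z - o) w₂ / cr w₁ w₂, cr w₁ (z - o) / cr w₁ w₂, ?_⟩
  rw [fr, add_assoc, ← exists_smul_of_cr h (z - o)]; abel

lemma linearIndependent_iff_cr (w₁ w₂ : Plane) : LinearIndependent ℝ ![w₁, w₂] ↔ cr w₁ w₂ ≠ 0 := by
  rw [LinearIndependent.pair_iff]
  constructor
  · intro h h0
    have h1 := h (w₂ 0) (-w₁ 0) (by
      apply plane_ext <;> simp <;> simp only [cr] at h0 <;> linarith)
    have h2 := h (w₂ 1) (-w₁ 1) (by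
      apply plane_ext <;> simp <;> simp only [cr] at h0 <;> linarith)
    have h3 := h 1 0 (by
      apply plane_ext <;> simp <;> linarith [h1.2, h2.2])
    exact one_ne_zero h3.1
  · intro h s t hst
    have h0 : s * w₁ 0 + t * w₂ 0 = 0 := by simpa using congrArg (fun z : Plane => z 0) hst
    have h1 : s * w₁ 1 + t * w₂ 1 = 0 := by simpa using congrArg (fun z : Plane => z 1) hst
    constructor
    · apply (mul_eq_zero.1 (_ : s * cr w₁ w₂ = 0)).resolve_right h
      simp only [cr]; linear_combination w₂ 1 * h0 - w₂ 0 * h1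
    · apply (mul_eq_zero.1 (_ : t * cr w₁ w₂ = 0)).resolve_right h
      simp only [cr]; linear_combination w₁ 0 * h1 - w₁ 1 * h0

/-! ### Quintics in coordinates -/

/-- The polynomial function with coefficients `c i j`, `i, j ≤ 5`. -/
def quint (c : ℕ → ℕ → ℝ) (x y : ℝ) : ℝ :=
  ∑ i ∈ Finset.range 6, ∑ j ∈ Finset.range 6, c i j * x ^ i * y ^ j

/-- The coefficients vanish above total degree five. -/
def Deg5 (c : ℕ → ℕ → ℝ) : Prop := ∀ i j, 5 < i + j → c i j = 0

/-- Coefficients of the partial derivative in the first variable. -/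
def dX (c : ℕ → ℕ → ℝ) (i j : ℕ) : ℝ := (i + 1) * c (i + 1) j

/-- Coefficients of the partial derivative in the second variable. -/
def dY (c : ℕ → ℕ → ℝ) (i j : ℕ) : ℝ := (j + 1) * c i (j + 1)

lemma Deg5.dX {c : ℕ → ℕ → ℝ} (h : Deg5 c) : Deg5 (dX c) := fun i j hij => by
  simp [PSSpline.dX, h (i + 1) j (by omega)]

lemma Deg5.dY {c : ℕ → ℕ → ℝ} (h : Deg5 c) : Deg5 (dY c) := fun i j hij => by
  simp [PSSpline.dY, h i (j + 1) (by omega)]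

lemma dX_dY_comm : Function.Commute dX dY := by
  intro c; funext i j; simp only [dX, dY]; ring

lemma hasDerivAt_quint_fst {c : ℕ → ℕ → ℝ} (h : Deg5 c) (x y : ℝ) :
    HasDerivAt (fun x => quint c x y) (quint (dX c) x y) x := by
  have key : HasDerivAt (fun x => quint c x y)
      (∑ i ∈ Finset.range 6, ∑ j ∈ Finset.range 6, c i j * (i * x ^ (i - 1)) * y ^ j) x := by
    unfold quint
    refine HasDerivAt.fun_sum fun i _ => HasDerivAt.fun_sum fun j _ => ?_
    exact ((hasDerivAt_pow i x).const_mul (c i j)).mul_const _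
  convert key using 1
  -- The last row of `dX c` involves only entries of degree at least six, so the sum can be cut to
  -- five rows and matched with the shifted derivative sum.
  have h6 : ∀ j, c 6 j = 0 := fun j => h 6 j (by omega)
  have e1 : quint (dX c) x y =
      ∑ i ∈ Finset.range 5, ∑ j ∈ Finset.range 6, dX c i j * x ^ i * y ^ j := by
    rw [quint, Finset.sum_range_succ, add_eq_left]
    exact Finset.sum_eq_zero fun j _ => by simp [dX, h6]
  rw [e1, Finset.sum_range_succ' (n := 5)]
  simp only [Nat.cast_zero, zero_mul, mul_zero, Finset.sum_const_zero, add_zero, dX]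
  refine Finset.sum_congr rfl fun i _ => Finset.sum_congr rfl fun j _ => ?_
  push_cast [Nat.add_sub_cancel]
  ring

lemma quint_swap (c : ℕ → ℕ → ℝ) (x y : ℝ) : quint c x y = quint (fun i j => c j i) y x := by
  unfold quint
  rw [Finset.sum_comm]
  refine Finset.sum_congr rfl fun i _ => Finset.sum_congr rfl fun j _ => ?_
  ring

lemma hasDerivAt_quint_snd {c : ℕ → ℕ → ℝ} (h : Deg5 c) (x y : ℝ) :
    HasDerivAt (fun y => quint c x y) (quint (dY c) x y) y := by
  have h' : Deg5 (fun i j => c j i) := fun i j hij => h j i (by omega)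
  have := hasDerivAt_quint_fst h' y x
  rw [quint_swap (dY c)]
  simp only [quint_swap c x]
  exact this

lemma quint_sub (c d : ℕ → ℕ → ℝ) (x y : ℝ) : quint (c - d) x y = quint c x y - quint d x y := by
  simp [quint, sub_mul, Finset.sum_sub_distrib]

lemma dX_sub (c d : ℕ → ℕ → ℝ) : dX (c - d) = dX c - dX d := by
  funext i j; simp [dX, mul_sub]

lemma dY_sub (c d : ℕ → ℕ → ℝ) : dY (c - d) = dY c - dY d := by
  funext i j; simp [dY, mul_sub]

lemma Deg5.sub {c d : ℕ → ℕ → ℝ} (hc : Deg5 c) (hd : Deg5 d) : Deg5 (c - d) :=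
  fun i j hij => by simp [hc i j hij, hd i j hij]

lemma totalDegree_aeval_le (f : Fin 2 → MvPolynomial (Fin 2) ℝ) (hf : ∀ i, (f i).totalDegree ≤ 1)
    (p : MvPolynomial (Fin 2) ℝ) : (MvPolynomial.aeval f p).totalDegree ≤ p.totalDegree := by
  rw [MvPolynomial.aeval_def, MvPolynomial.eval₂_eq']
  refine MvPolynomial.totalDegree_finsetSum_le fun d hd => ?_
  refine (MvPolynomial.totalDegree_mul _ _).trans ?_
  rw [MvPolynomial.algebraMap_eq, MvPolynomial.totalDegree_C, zero_add]
  refine (MvPolynomial.totalDegree_finsetProd _ _).trans ?_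
  refine le_trans ?_ (MvPolynomial.le_totalDegree hd)
  rw [Finsupp.sum_fintype _ _ (fun _ => rfl)]
  refine Finset.sum_le_sum fun i _ => (MvPolynomial.totalDegree_pow _ _).trans ?_
  simpa using Nat.mul_le_mul_left (d i) (hf i)

lemma polyFun_aeval (f : Fin 2 → MvPolynomial (Fin 2) ℝ) (p : MvPolynomial (Fin 2) ℝ) (z : Plane) :
    polyFun (MvPolynomial.aeval f p) z = polyFun p (WithLp.toLp 2 fun i => polyFun (f i) z) := by
  simp only [polyFun]
  rw [MvPolynomial.aeval_def, ← MvPolynomial.coe_eval₂Hom, ← RingHom.comp_apply,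
    MvPolynomial.comp_eval₂Hom]
  have : (MvPolynomial.eval fun i => z i).comp (algebraMap ℝ (MvPolynomial (Fin 2) ℝ)) =
      RingHom.id ℝ := by ext; simp [MvPolynomial.algebraMap_eq]
  rw [this]
  rfl

lemma polyFun_eq_quint (p : MvPolynomial (Fin 2) ℝ) (hp : p.totalDegree ≤ 5) :
    ∃ c, Deg5 c ∧ ∀ x y, polyFun p !₂[x, y] = quint c x y := by
  let e : ℕ → ℕ → (Fin 2 →₀ ℕ) := fun i j => Finsupp.equivFunOnFinite.symm ![i, j]
  have he : ∀ d : Fin 2 →₀ ℕ, e (d 0) (d 1) = d := by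
    intro d; ext i; fin_cases i <;> simp [e]
  refine ⟨fun i j => p.coeff (e i j), fun i j hij => ?_, fun x y => ?_⟩
  · apply MvPolynomial.coeff_eq_zero_of_totalDegree_lt
    rw [← Finsupp.degree_apply, Finsupp.degree_eq_sum]
    simp [e]; omega
  · simp only [polyFun, MvPolynomial.eval_eq', quint]
    rw [← Finset.sum_product' (f := fun i j => p.coeff (e i j) * x ^ i * y ^ j)]
    refine Finset.sum_of_injOn (fun d => (d 0, d 1)) ?_ ?_ ?_ ?_
    · intro d _ d' _ h
      simp only [Prod.mk.injEq] at h
      rw [← he d, ← he d', h.1, h.2]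
    · intro d hd
      have := MvPolynomial.le_totalDegree hd
      rw [Finsupp.sum_fintype _ _ (fun _ => rfl)] at this
      simp at this ⊢
      omega
    · rintro ⟨i, j⟩ _ h
      have : e i j ∉ p.support := fun h' => h ⟨e i j, h', by simp [e]⟩
      simp [MvPolynomial.notMem_support_iff.1 this]
    · intro d _
      simp [he, mul_assoc]

/-- A polynomial of degree at most five is a quintic in every affine frame. -/
lemma exists_quint {p : MvPolynomial (Fin 2) ℝ} (hp : p.totalDegree ≤ 5) (o w₁ w₂ : Plane) :
    ∃ c, Deg5 c ∧ ∀ x y, polyFun p (fr o w₁ w₂ x y) = quint c x y := by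
  let f : Fin 2 → MvPolynomial (Fin 2) ℝ := fun i => .C (o i) + (w₁ i) • .X 0 + (w₂ i) • .X 1
  have hf : ∀ i, (f i).totalDegree ≤ 1 := by
    intro i
    refine (MvPolynomial.totalDegree_add _ _).trans (max_le ((MvPolynomial.totalDegree_add _ _).trans
      (max_le ?_ ?_)) ?_)
    · simp
    · exact (MvPolynomial.totalDegree_smul_le _ _).trans (by simp)
    · exact (MvPolynomial.totalDegree_smul_le _ _).trans (by simp)
  obtain ⟨c, hc, h⟩ := polyFun_eq_quint _ ((totalDegree_aeval_le f hf p).trans hp)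
  refine ⟨c, hc, fun x y => ?_⟩
  rw [← h, polyFun_aeval]
  congr 1
  ext i
  simp [fr_apply, f, polyFun, MvPolynomial.smul_eval]
  ring

/-! ### Jets of polynomials -/

/-- The number of entries of the tuple `m` equal to `k`. -/
def cnt {n : ℕ} (m : Fin n → Fin 2) (k : Fin 2) : ℕ := ∑ l, if m l = k then 1 else 0

lemma cnt_add {n : ℕ} (m : Fin n → Fin 2) : cnt m 0 + cnt m 1 = n := by
  rw [cnt, cnt, ← Finset.sum_add_distrib]
  have : ∀ l, ((if m l = 0 then 1 else 0) + if m l = 1 then 1 else 0) = 1 := by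
    intro l
    generalize m l = k
    fin_cases k <;> simp
  simp [this]

/-- Induction peels off the first argument of the multilinear derivative and differentiates along
the corresponding frame line. The order of the arguments does not matter because `dX` and `dY`
commute, so no symmetry of higher derivatives is invoked; the frame may even be degenerate. -/
lemma iteratedFDeriv_fr {f : Plane → ℝ} (hf : ContDiff ℝ (⊤ : ℕ∞) f) {o w₁ w₂ : Plane}
    {c : ℕ → ℕ → ℝ} (hc : Deg5 c) (h : ∀ x y, f (fr o w₁ w₂ x y) = quint c x y) :
    ∀ {n : ℕ} (m : Fin n → Fin 2),
    Deg5 (dX^[cnt m 0] (dY^[cnt m 1] c)) ∧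
    ∀ x y, iteratedFDeriv ℝ n f (fr o w₁ w₂ x y) (fun k => ![w₁, w₂] (m k)) =
      quint (dX^[cnt m 0] (dY^[cnt m 1] c)) x y := by
  intro n
  induction n with
  | zero => intro m; simpa [cnt, h] using hc
  | succ n ih =>
    intro m
    obtain ⟨hd, hx⟩ := ih (Fin.tail m)
    set d := dX^[cnt (Fin.tail m) 0] (dY^[cnt (Fin.tail m) 1] c) with hd_def
    set g : Plane → ℝ := fun z => iteratedFDeriv ℝ n f z (fun k => ![w₁, w₂] (Fin.tail m k))
    have hdiff : Differentiable ℝ (iteratedFDeriv ℝ n f) :=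
      hf.differentiable_iteratedFDeriv (by exact_mod_cast WithTop.coe_lt_top n)
    have hg : ∀ z, HasFDerivAt g ((ContinuousMultilinearMap.apply ℝ (fun _ : Fin n => Plane) ℝ
        (fun k => ![w₁, w₂] (Fin.tail m k))).comp (fderiv ℝ (iteratedFDeriv ℝ n f) z)) z := fun z =>
      (ContinuousMultilinearMap.apply ℝ (fun _ : Fin n => Plane) ℝ
        (fun k => ![w₁, w₂] (Fin.tail m k))).hasFDerivAt.comp z (hdiff z).hasFDerivAt
    have hval : ∀ z, iteratedFDeriv ℝ (n + 1) f z (fun k => ![w₁, w₂] (m k)) =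
        ((ContinuousMultilinearMap.apply ℝ (fun _ : Fin n => Plane) ℝ
        (fun k => ![w₁, w₂] (Fin.tail m k))).comp (fderiv ℝ (iteratedFDeriv ℝ n f) z))
          (![w₁, w₂] (m 0)) := by
      intro z
      rw [iteratedFDeriv_succ_apply_left]
      rfl
    have hcnt : ∀ k, cnt m k = cnt (Fin.tail m) k + if m 0 = k then 1 else 0 := by
      intro k
      rw [cnt, Fin.sum_univ_succ, add_comm]
      rfl
    rcases (by generalize m 0 = k; fin_cases k <;> simp : m 0 = 0 ∨ m 0 = 1) with h0 | h0
    · have e : dX^[cnt m 0] (dY^[cnt m 1] c) = dX d := by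
        rw [hcnt, hcnt, h0]
        simp [Function.iterate_succ_apply', hd_def]
      rw [e]
      refine ⟨hd.dX, fun x y => ?_⟩
      rw [hval, h0]
      have hl : HasDerivAt (fun x => fr o w₁ w₂ x y) w₁ x := by
        unfold fr
        simpa using (((hasDerivAt_id x).smul_const w₁).const_add o).add_const (y • w₂)
      have h1 := (hg (fr o w₁ w₂ x y)).comp_hasDerivAt x hl
      have h2 := hasDerivAt_quint_fst hd x y
      have : g ∘ (fun x => fr o w₁ w₂ x y) = fun x => quint d x y := by
        funext x; exact hx x y
      rw [this] at h1
      exact h1.unique h2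
    · have e : dX^[cnt m 0] (dY^[cnt m 1] c) = dY d := by
        rw [hcnt, hcnt, h0, hd_def]
        simp only [one_ne_zero, if_true, if_false, add_zero,
          Function.iterate_succ_apply']
        exact ((dX_dY_comm.iterate_left _) _)
      rw [e]
      refine ⟨hd.dY, fun x y => ?_⟩
      rw [hval, h0]
      have hl : HasDerivAt (fun y => fr o w₁ w₂ x y) w₂ y := by
        unfold fr
        simpa using ((hasDerivAt_id y).smul_const w₂).const_add (o + x • w₁)
      have h1 := (hg (fr o w₁ w₂ x y)).comp_hasDerivAt y hl
      have h2 := hasDerivAt_quint_snd hd x y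
      have : g ∘ (fun y => fr o w₁ w₂ x y) = fun y => quint d x y := by
        funext y; exact hx x y
      rw [this] at h1
      exact h1.unique h2

lemma iteratedFDeriv_append {f : Plane → ℝ} (hf : ContDiff ℝ (⊤ : ℕ∞) f) {o w₁ w₂ : Plane}
    {c : ℕ → ℕ → ℝ} (hc : Deg5 c) (h : ∀ x y, f (fr o w₁ w₂ x y) = quint c x y) (i j : ℕ) (x y : ℝ) :
    iteratedFDeriv ℝ (i + j) f (fr o w₁ w₂ x y)
      (Fin.append (fun _ : Fin i => w₁) (fun _ : Fin j => w₂)) =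
      quint (dX^[i] (dY^[j] c)) x y := by
  have := (iteratedFDeriv_fr hf hc h (Fin.append (fun _ : Fin i => 0) (fun _ : Fin j => 1))).2 x y
  simp only [cnt, Fin.sum_univ_add, Fin.append_left, Fin.append_right] at this
  simp only [if_true, zero_ne_one, one_ne_zero, if_false, Finset.sum_const, Finset.card_univ,
    Fintype.card_fin, smul_eq_mul, mul_one, mul_zero, add_zero, zero_add] at this
  rw [← this]
  congr 1
  funext k
  refine Fin.addCases (fun l => ?_) (fun l => ?_) k <;> simp

/-- Two polynomials have the same derivatives up to order `k` at `z`. -/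
def JetEq (k : ℕ) (p q : MvPolynomial (Fin 2) ℝ) (z : Plane) : Prop :=
  ∀ m ≤ k, iteratedFDeriv ℝ m (polyFun p) z = iteratedFDeriv ℝ m (polyFun q) z

lemma JetEq.quint {k : ℕ} {p q : MvPolynomial (Fin 2) ℝ} {o w₁ w₂ : Plane} {c d : ℕ → ℕ → ℝ}
    {x y : ℝ} (h : JetEq k p q (fr o w₁ w₂ x y)) (hc : Deg5 c) (hd : Deg5 d)
    (hp : ∀ x y, polyFun p (fr o w₁ w₂ x y) = PSSpline.quint c x y)
    (hq : ∀ x y, polyFun q (fr o w₁ w₂ x y) = PSSpline.quint d x y) (i j : ℕ) (hij : i + j ≤ k) :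
    PSSpline.quint (dX^[i] (dY^[j] c)) x y = PSSpline.quint (dX^[i] (dY^[j] d)) x y := by
  rw [← iteratedFDeriv_append (contDiff_polyFun p _) hc hp,
    ← iteratedFDeriv_append (contDiff_polyFun q _) hd hq, h _ hij]

lemma basis_of_cr {w₁ w₂ : Plane} (h : cr w₁ w₂ ≠ 0) :
    ∃ b : Module.Basis (Fin 2) ℝ Plane, ⇑b = ![w₁, w₂] :=
  ⟨basisOfLinearIndependentOfCardEqFinrank ((linearIndependent_iff_cr _ _).2 h) (by simp), by simp⟩

/-- A multilinear map is determined by its values on tuples of basis vectors, and on such tuples the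
derivative depends only on how often each frame vector occurs. -/
lemma jetEq_of_quint {k : ℕ} {p q : MvPolynomial (Fin 2) ℝ} {o w₁ w₂ : Plane} {c d : ℕ → ℕ → ℝ}
    {x y : ℝ} (hw : cr w₁ w₂ ≠ 0) (hc : Deg5 c) (hd : Deg5 d)
    (hp : ∀ x y, polyFun p (fr o w₁ w₂ x y) = quint c x y)
    (hq : ∀ x y, polyFun q (fr o w₁ w₂ x y) = quint d x y)
    (h : ∀ i j, i + j ≤ k → quint (dX^[i] (dY^[j] c)) x y = quint (dX^[i] (dY^[j] d)) x y) :
    JetEq k p q (fr o w₁ w₂ x y) := by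
  intro m hm
  obtain ⟨b, hb⟩ := basis_of_cr hw
  apply ContinuousMultilinearMap.toMultilinearMap_injective
  refine Module.Basis.ext_multilinear (fun _ => b) fun v => ?_
  have e1 := (iteratedFDeriv_fr (contDiff_polyFun p _) hc hp v).2 x y
  have e2 := (iteratedFDeriv_fr (contDiff_polyFun q _) hd hq v).2 x y
  simp only [hb, ContinuousMultilinearMap.coe_coe]
  rw [e1, e2, h _ _ (by rw [cnt_add]; exact hm)]

/-- The jets of quintics are determined by the mixed derivatives in two independent directions. -/
lemma jetEq_of_append {k : ℕ} {p q : MvPolynomial (Fin 2) ℝ} (hp : p.totalDegree ≤ 5)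
    (hq : q.totalDegree ≤ 5) {z w₁ w₂ : Plane} (hw : cr w₁ w₂ ≠ 0)
    (h : ∀ i j, i + j ≤ k →
      iteratedFDeriv ℝ (i + j) (polyFun p) z (Fin.append (fun _ : Fin i => w₁) fun _ : Fin j => w₂) =
      iteratedFDeriv ℝ (i + j) (polyFun q) z (Fin.append (fun _ : Fin i => w₁) fun _ : Fin j => w₂)) :
    JetEq k p q z := by
  obtain ⟨c, hc, hpc⟩ := exists_quint hp z w₁ w₂
  obtain ⟨d, hd, hqd⟩ := exists_quint hq z w₁ w₂
  have hz : z = fr z w₁ w₂ 0 0 := by simp [fr]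
  rw [hz]
  refine jetEq_of_quint hw hc hd hpc hqd fun i j hij => ?_
  rw [← iteratedFDeriv_append (contDiff_polyFun p _) hc hpc,
    ← iteratedFDeriv_append (contDiff_polyFun q _) hd hqd, ← hz, h i j hij]

/-! ### Restriction to a line -/

/-- On the line `y = 0` only the row `j = 0` survives. After `dY^[j]` this isolates the coefficients
of `y ^ j`, so conditions along an edge decouple into univariate problems, one for each `j`. -/
lemma quint_snd_zero (c : ℕ → ℕ → ℝ) (x : ℝ) :
    quint c x 0 = c 0 0 + c 1 0 * x + c 2 0 * x ^ 2 + c 3 0 * x ^ 3 + c 4 0 * x ^ 4 +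
      c 5 0 * x ^ 5 := by
  simp [quint, Finset.sum_range_succ]

/-- The values along the edge: two quintics have 12 coefficients, against four conditions at each
endpoint and four at the breakpoint. Conditions at 1 are divided by factorials. -/
lemma edge_quintic {c d : ℕ → ℝ} (a0 : c 0 = 0) (a1 : c 1 = 0) (a2 : c 2 = 0) (a3 : c 3 = 0)
    (b0 : d 0 + d 1 + d 2 + d 3 + d 4 + d 5 = 0) (b1 : d 1 + 2 * d 2 + 3 * d 3 + 4 * d 4 + 5 * d 5 = 0)
    (b2 : d 2 + 3 * d 3 + 6 * d 4 + 10 * d 5 = 0) (b3 : d 3 + 4 * d 4 + 10 * d 5 = 0)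
    (m0 : c 4 / 16 + c 5 / 32 = d 0 + d 1 / 2 + d 2 / 4 + d 3 / 8 + d 4 / 16 + d 5 / 32)
    (m1 : c 4 / 2 + c 5 * 5 / 16 = d 1 + d 2 + d 3 * 3 / 4 + d 4 / 2 + d 5 * 5 / 16)
    (m2 : c 4 * 3 / 2 + c 5 * 5 / 4 = d 2 + d 3 * 3 / 2 + d 4 * 3 / 2 + d 5 * 5 / 4)
    (m3 : c 4 * 2 + c 5 * 5 / 2 = d 3 + d 4 * 2 + d 5 * 5 / 2) :
    ∀ i ≤ 5, c i = 0 ∧ d i = 0 := by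
  have x3 : d 3 = -4 * d 4 - 10 * d 5 := by linarith
  have x2 : d 2 = 6 * d 4 + 20 * d 5 := by linarith
  have x1 : d 1 = -4 * d 4 - 15 * d 5 := by linarith
  have x0 : d 0 = d 4 + 4 * d 5 := by linarith
  rw [x0, x1, x2, x3] at m0
  rw [x1, x2, x3] at m1
  rw [x2, x3] at m2
  rw [x3] at m3
  have y4 : c 4 = 0 := by linarith only [m0, m1, m2, m3]
  have y5 : c 5 = 0 := by linarith only [m0, m1, m2, m3]
  have z4 : d 4 = 0 := by linarith only [m0, m1, y4, y5]
  have z5 : d 5 = 0 := by linarith only [m0, m1, y4, y5]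
  rw [z4, z5] at x0 x1 x2 x3
  intro i hi
  interval_cases i <;> constructor <;> linarith

/-- The first cross derivative along the edge: two quartics have 10 coefficients, against three
conditions at each endpoint, three at the breakpoint, and the prescribed value `n` at the midpoint.
-/
lemma edge_quartic {c d : ℕ → ℝ} (a0 : c 0 = 0) (a1 : c 1 = 0) (a2 : c 2 = 0)
    (b0 : d 0 + d 1 + d 2 + d 3 + d 4 = 0) (b1 : d 1 + 2 * d 2 + 3 * d 3 + 4 * d 4 = 0)
    (b2 : d 2 + 3 * d 3 + 6 * d 4 = 0)
    (m0 : c 3 / 8 + c 4 / 16 = d 0 + d 1 / 2 + d 2 / 4 + d 3 / 8 + d 4 / 16)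
    (m1 : c 3 * 3 / 4 + c 4 / 2 = d 1 + d 2 + d 3 * 3 / 4 + d 4 / 2)
    (m2 : c 3 * 3 / 2 + c 4 * 3 / 2 = d 2 + d 3 * 3 / 2 + d 4 * 3 / 2)
    (n : c 3 / 8 + c 4 / 16 = 0) :
    ∀ i ≤ 4, c i = 0 ∧ d i = 0 := by
  have x2 : d 2 = -3 * d 3 - 6 * d 4 := by linarith
  have x1 : d 1 = 3 * d 3 + 8 * d 4 := by linarith
  have x0 : d 0 = - d 3 - 3 * d 4 := by linarith
  rw [x0, x1, x2] at m0
  rw [x1, x2] at m1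
  rw [x2] at m2
  have y3 : c 3 = 0 := by linarith only [m0, m1, m2, n]
  have y4 : c 4 = 0 := by linarith only [n, y3]
  have z3 : d 3 = 0 := by linarith only [m0, m1, y3, y4]
  have z4 : d 4 = 0 := by linarith only [m0, m1, y3, y4]
  rw [z3, z4] at x0 x1 x2
  intro i hi
  interval_cases i <;> constructor <;> linarith

/-- The second cross derivative along the edge: two cubics have 8 coefficients, against two
conditions at each endpoint, two at the breakpoint, and the values `n`, `n'` at the two
quarterpoints. -/
lemma edge_cubic {c d : ℕ → ℝ} (a0 : c 0 = 0) (a1 : c 1 = 0)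
    (b0 : d 0 + d 1 + d 2 + d 3 = 0) (b1 : d 1 + 2 * d 2 + 3 * d 3 = 0)
    (m0 : c 2 / 4 + c 3 / 8 = d 0 + d 1 / 2 + d 2 / 4 + d 3 / 8)
    (m1 : c 2 + c 3 * 3 / 4 = d 1 + d 2 + d 3 * 3 / 4)
    (n : c 2 / 16 + c 3 / 64 = 0)
    (n' : d 0 + d 1 * 3 / 4 + d 2 * 9 / 16 + d 3 * 27 / 64 = 0) :
    ∀ i ≤ 3, c i = 0 ∧ d i = 0 := by
  have x1 : d 1 = -2 * d 2 - 3 * d 3 := by linarith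
  have x0 : d 0 = d 2 + 2 * d 3 := by linarith
  rw [x0, x1] at m0 n'
  rw [x1] at m1
  have y2 : c 2 = 0 := by linarith only [m0, m1, n', n]
  have y3 : c 3 = 0 := by linarith only [n, y2]
  have z2 : d 2 = 0 := by linarith only [m0, m1, y2, y3]
  have z3 : d 3 = 0 := by linarith only [m0, m1, y2, y3]
  rw [z2, z3] at x0 x1
  intro i hi
  interval_cases i <;> constructor <;> linarith

/-- On an edge with a breakpoint at its midpoint, a quintic which is `C³` at the breakpoint and has
vanishing Hermite data vanishes to second order. -/
lemma edge_coeffs {c d : ℕ → ℕ → ℝ} (hc : Deg5 c) (hd : Deg5 d)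
    (hA : ∀ i j, i + j ≤ 3 → quint (dX^[i] (dY^[j] c)) 0 0 = 0)
    (hB : ∀ i j, i + j ≤ 3 → quint (dX^[i] (dY^[j] d)) 1 0 = 0)
    (hM : ∀ i j, i + j ≤ 3 →
      quint (dX^[i] (dY^[j] c)) (1 / 2) 0 = quint (dX^[i] (dY^[j] d)) (1 / 2) 0)
    (h1 : quint (dY c) (1 / 2) 0 = 0) (h2 : quint (dY (dY c)) (1 / 4) 0 = 0)
    (h3 : quint (dY (dY d)) (3 / 4) 0 = 0) :
    ∀ i j, j ≤ 2 → c i j = 0 ∧ d i j = 0 := by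
  -- These are the entries of degree above five that appear when the derivatives are expanded
  -- formally.
  have zc : c 5 1 = 0 ∧ c 4 2 = 0 ∧ c 5 2 = 0 ∧ c 6 0 = 0 ∧ c 7 0 = 0 ∧ c 8 0 = 0 ∧ c 6 1 = 0 ∧
    c 7 1 = 0 ∧ c 6 2 = 0 := by
    refine ⟨?_, ?_, ?_, ?_, ?_, ?_, ?_, ?_, ?_⟩ <;> exact hc _ _ (by norm_num)
  have zd : d 5 1 = 0 ∧ d 4 2 = 0 ∧ d 5 2 = 0 ∧ d 6 0 = 0 ∧ d 7 0 = 0 ∧ d 8 0 = 0 ∧ d 6 1 = 0 ∧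
    d 7 1 = 0 ∧ d 6 2 = 0 := by
    refine ⟨?_, ?_, ?_, ?_, ?_, ?_, ?_, ?_, ?_⟩ <;> exact hd _ _ (by norm_num)
  obtain ⟨c1, c2, c3, c4, c5, c6, c7, c8, c9⟩ := zc
  obtain ⟨d1, d2, d3, d4, d5, d6, d7, d8, d9⟩ := zd
  have z0 : ∀ i, i ≤ 5 → c i 0 = 0 ∧ d i 0 = 0 := by
    have a0 := hA 0 0 (by norm_num)
    have a1 := hA 1 0 (by norm_num)
    have a2 := hA 2 0 (by norm_num)
    have a3 := hA 3 0 (by norm_num)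
    have b0 := hB 0 0 (by norm_num)
    have b1 := hB 1 0 (by norm_num)
    have b2 := hB 2 0 (by norm_num)
    have b3 := hB 3 0 (by norm_num)
    have m0 := hM 0 0 (by norm_num)
    have m1 := hM 1 0 (by norm_num)
    have m2 := hM 2 0 (by norm_num)
    have m3 := hM 3 0 (by norm_num)
    simp only [quint_snd_zero, dX, Function.iterate_succ, Function.iterate_zero, id,
      Function.comp, c4, c5, c6, d4, d5, d6] at a0 a1 a2 a3 b0 b1 b2 b3 m0 m1 m2 m3
    norm_num at a0 a1 a2 a3 b0 b1 b2 b3 m0 m1 m2 m3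
    simp only [a0, a1, a2, a3] at m0 m1 m2 m3
    clear c1 c2 c3 c4 c5 c6 c7 c8 c9 d1 d2 d3 d4 d5 d6 d7 d8 d9
    exact edge_quintic (c := fun i => c i 0) (d := fun i => d i 0) a0 a1 a2 a3 (by linarith only [b0])
      (by linarith only [b1]) (by linarith only [b2]) (by linarith only [b3]) (by linarith only [m0])
      (by linarith only [m1]) (by linarith only [m2]) (by linarith only [m3])
  have z1 : ∀ i, i ≤ 4 → c i 1 = 0 ∧ d i 1 = 0 := by
    have a0 := hA 0 1 (by norm_num)
    have a1 := hA 1 1 (by norm_num)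
    have a2 := hA 2 1 (by norm_num)
    have b0 := hB 0 1 (by norm_num)
    have b1 := hB 1 1 (by norm_num)
    have b2 := hB 2 1 (by norm_num)
    have m0 := hM 0 1 (by norm_num)
    have m1 := hM 1 1 (by norm_num)
    have m2 := hM 2 1 (by norm_num)
    have n := h1
    simp only [quint_snd_zero, dX, dY, Function.iterate_succ, Function.iterate_zero, id,
      Function.comp, c1, c7, c8, d1, d7, d8] at a0 a1 a2 b0 b1 b2 m0 m1 m2 n
    norm_num at a0 a1 a2 b0 b1 b2 m0 m1 m2 n
    simp only [a0, a1, a2] at m0 m1 m2 n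
    exact edge_quartic (c := fun i => c i 1) (d := fun i => d i 1) a0 a1 a2 (by linarith only [b0])
      (by linarith only [b1]) (by linarith only [b2]) (by linarith only [m0])
      (by linarith only [m1]) (by linarith only [m2]) (by linarith only [n])
  have z2 : ∀ i, i ≤ 3 → c i 2 = 0 ∧ d i 2 = 0 := by
    have a0 := hA 0 2 (by norm_num)
    have a1 := hA 1 2 (by norm_num)
    have b0 := hB 0 2 (by norm_num)
    have b1 := hB 1 2 (by norm_num)
    have m0 := hM 0 2 (by norm_num)
    have m1 := hM 1 2 (by norm_num)
    have n := h2
    have n' := h3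
    simp only [quint_snd_zero, dX, dY, Function.iterate_succ, Function.iterate_zero, id,
      Function.comp, c2, c3, c9, d2, d3, d9] at a0 a1 b0 b1 m0 m1 n n'
    norm_num at a0 a1 b0 b1 m0 m1 n n'
    simp only [a0, a1] at m0 m1 n
    exact edge_cubic (c := fun i => c i 2) (d := fun i => d i 2) a0 a1 (by linarith only [b0])
      (by linarith only [b1]) (by linarith only [m0])
      (by linarith only [m1]) (by linarith only [n]) (by linarith only [n'])
  intro i j hj
  by_cases hij : 5 < i + j
  · exact ⟨hc i j hij, hd i j hij⟩
  · interval_cases j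
    · exact z0 i (by omega)
    · exact z1 i (by omega)
    · exact z2 i (by omega)

lemma quint_of_le_two {c : ℕ → ℕ → ℝ} (hc : Deg5 c) (h : ∀ i j, j ≤ 2 → c i j = 0) (x y : ℝ) :
    quint c x y = y ^ 3 * (c 0 3 + c 1 3 * x + c 0 4 * y + c 2 3 * x ^ 2 + c 1 4 * x * y +
      c 0 5 * y ^ 2) := by
  have hc' : ∀ i j, 5 < i + j → c i j = 0 := hc
  simp [quint, Finset.sum_range_succ, h, hc']
  ring

/-- Contact of order three along a line makes a quintic divisible by the fourth power. -/
lemma quint_of_contact {c : ℕ → ℕ → ℝ} (hc : Deg5 c)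
    (h0 : ∀ i j, i + j ≤ 3 → quint (dX^[i] (dY^[j] c)) 0 0 = 0)
    (h1 : ∀ i j, i + j ≤ 3 → quint (dX^[i] (dY^[j] c)) 1 0 = 0)
    (h2 : ∀ i j, i + j ≤ 3 → quint (dX^[i] (dY^[j] c)) (1 / 2) 0 = 0) (x y : ℝ) :
    quint c x y = y ^ 4 * (c 0 4 + c 1 4 * x + c 0 5 * y) := by
  have zc : c 5 1 = 0 ∧ c 4 2 = 0 ∧ c 5 2 = 0 ∧ c 6 0 = 0 ∧ c 7 0 = 0 ∧ c 8 0 = 0 ∧ c 6 1 = 0 ∧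
    c 7 1 = 0 ∧ c 6 2 = 0 ∧ c 3 3 = 0 ∧ c 4 3 = 0 ∧ c 5 3 = 0 := by
    refine ⟨?_, ?_, ?_, ?_, ?_, ?_, ?_, ?_, ?_, ?_, ?_, ?_⟩ <;> exact hc _ _ (by norm_num)
  obtain ⟨c1, c2, c3, c4, c5, c6, c7, c8, c9, c10, c11, c12⟩ := zc
  have z : c 0 0 = 0 ∧ c 1 0 = 0 ∧ c 2 0 = 0 ∧ c 3 0 = 0 ∧ c 4 0 = 0 ∧ c 5 0 = 0 ∧
      c 0 1 = 0 ∧ c 1 1 = 0 ∧ c 2 1 = 0 ∧ c 3 1 = 0 ∧ c 4 1 = 0 ∧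
      c 0 2 = 0 ∧ c 1 2 = 0 ∧ c 2 2 = 0 ∧ c 3 2 = 0 ∧
      c 0 3 = 0 ∧ c 1 3 = 0 ∧ c 2 3 = 0 := by
    have a0 := h0 0 0 (by norm_num)
    have a1 := h0 1 0 (by norm_num)
    have a2 := h0 2 0 (by norm_num)
    have a3 := h0 3 0 (by norm_num)
    have a4 := h0 0 1 (by norm_num)
    have a5 := h0 1 1 (by norm_num)
    have a6 := h0 2 1 (by norm_num)
    have a7 := h0 0 2 (by norm_num)
    have a8 := h0 1 2 (by norm_num)
    have a9 := h0 0 3 (by norm_num)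
    have b0 := h1 0 0 (by norm_num)
    have b1 := h1 1 0 (by norm_num)
    have b2 := h1 0 1 (by norm_num)
    have b3 := h1 1 1 (by norm_num)
    have b4 := h1 0 2 (by norm_num)
    have b5 := h1 1 2 (by norm_num)
    have b6 := h1 0 3 (by norm_num)
    -- The rows `j = 0, 1, 2` have degrees 5, 4, 3 and are determined by contact at the two
    -- endpoints alone. The row `j = 3` is a quadratic with only one condition at each endpoint, and
    -- the midpoint supplies the third.
    have m := h2 0 3 (by norm_num)
    simp only [quint_snd_zero, dX, dY, Function.iterate_succ, Function.iterate_zero, id,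
      Function.comp, c1, c2, c3, c4, c5, c6, c7, c8, c9, c10, c11, c12] at a0 a1 a2 a3 a4 a5 a6 a7 a8 a9 b0 b1 b2 b3 b4 b5 b6 m
    norm_num at a0 a1 a2 a3 a4 a5 a6 a7 a8 a9 b0 b1 b2 b3 b4 b5 b6 m
    simp only [a0, a1, a2, a3, a4, a5, a6, a7, a8, a9] at b0 b1 b2 b3 b4 b5 b6 m ⊢
    simp only [true_and]
    refine ⟨?_, ?_, ?_, ?_, ?_, ?_, ?_, ?_⟩ <;> linarith only [b0, b1, b2, b3, b4, b5, b6, m]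
  obtain ⟨e1, e2, e3, e4, e5, e6, e7, e8, e9, e10, e11, e12, e13, e14, e15, e16, e17, e18⟩ := z
  have hc' : ∀ i j, 5 < i + j → c i j = 0 := hc
  simp [quint, Finset.sum_range_succ, hc', e1, e2, e3, e4, e5, e6, e7, e8, e9, e10, e11, e12, e13,
    e14, e15, e16, e17, e18]
  ring

lemma dX_dY_iterate_sub (c d : ℕ → ℕ → ℝ) (i j : ℕ) :
    dX^[i] (dY^[j] (c - d)) = dX^[i] (dY^[j] c) - dX^[i] (dY^[j] d) := by
  have h1 : ∀ j (c d : ℕ → ℕ → ℝ), dY^[j] (c - d) = dY^[j] c - dY^[j] d := by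
    intro j
    induction j with
    | zero => simp
    | succ j ih => intro c d; simp [Function.iterate_succ_apply, dY_sub, ih]
  have h2 : ∀ j (c d : ℕ → ℕ → ℝ), dX^[j] (c - d) = dX^[j] c - dX^[j] d := by
    intro j
    induction j with
    | zero => simp
    | succ j ih => intro c d; simp [Function.iterate_succ_apply, dX_sub, ih]
  rw [h1, h2]

/-- If two quintics have contact of order three along a line, their difference is the fourth power
of the linear form of this line times a polynomial of degree one. -/
lemma sub_of_contact {p q : MvPolynomial (Fin 2) ℝ} (hp : p.totalDegree ≤ 5)
    (hq : q.totalDegree ≤ 5) {o w₁ w₂ : Plane} (h0 : JetEq 3 p q (fr o w₁ w₂ 0 0))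
    (h1 : JetEq 3 p q (fr o w₁ w₂ 1 0)) (h2 : JetEq 3 p q (fr o w₁ w₂ (1 / 2) 0)) :
    ∃ α β γ : ℝ, ∀ x y, polyFun p (fr o w₁ w₂ x y) - polyFun q (fr o w₁ w₂ x y) =
      y ^ 4 * (α + β * x + γ * y) := by
  obtain ⟨c, hc, hpc⟩ := exists_quint hp o w₁ w₂
  obtain ⟨d, hd, hqd⟩ := exists_quint hq o w₁ w₂
  refine ⟨(c - d) 0 4, (c - d) 1 4, (c - d) 0 5, fun x y => ?_⟩
  rw [hpc, hqd, ← quint_sub]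
  refine quint_of_contact (hc.sub hd) ?_ ?_ ?_ x y <;> intro i j hij <;>
    rw [dX_dY_iterate_sub, quint_sub, sub_eq_zero]
  · exact h0.quint hc hd hpc hqd i j hij
  · exact h1.quint hc hd hpc hqd i j hij
  · exact h2.quint hc hd hpc hqd i j hij

lemma iteratedFDeriv_const_snd {f : Plane → ℝ} (hf : ContDiff ℝ (⊤ : ℕ∞) f) {o w₁ w₂ : Plane}
    {c : ℕ → ℕ → ℝ} (hc : Deg5 c) (h : ∀ x y, f (fr o w₁ w₂ x y) = quint c x y) (n : ℕ) (x y : ℝ) :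
    iteratedFDeriv ℝ n f (fr o w₁ w₂ x y) (fun _ => w₂) = quint (dY^[n] c) x y := by
  have := (iteratedFDeriv_fr hf hc h (fun _ : Fin n => 1)).2 x y
  simpa [cnt] using this

lemma quint_zero (x y : ℝ) : quint 0 x y = 0 := by simp [quint]

lemma dX_dY_iterate_zero (i j : ℕ) : dX^[i] (dY^[j] 0) = 0 := by
  simpa using dX_dY_iterate_sub 0 0 i j

lemma deg5_zero : Deg5 0 := fun _ _ _ => rfl

lemma JetEq.quint_eq_zero {k : ℕ} {p : MvPolynomial (Fin 2) ℝ} {o w₁ w₂ : Plane} {c : ℕ → ℕ → ℝ}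
    {x y : ℝ} (h : JetEq k p 0 (fr o w₁ w₂ x y)) (hc : Deg5 c)
    (hp : ∀ x y, polyFun p (fr o w₁ w₂ x y) = PSSpline.quint c x y) (i j : ℕ) (hij : i + j ≤ k) :
    PSSpline.quint (dX^[i] (dY^[j] c)) x y = 0 := by
  rw [h.quint hc deg5_zero hp (fun x y => by simp [polyFun_zero, quint_zero]) i j hij,
    dX_dY_iterate_zero, quint_zero]

/-- Vanishing Hermite data along an edge, for the polynomials on the two halves of the edge. -/
structure EdgeZero (p q : MvPolynomial (Fin 2) ℝ) (a b u : Plane) : Prop where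
  left : JetEq 3 p 0 a
  right : JetEq 3 q 0 b
  mid : JetEq 3 p q ((1 / 2 : ℝ) • (a + b))
  cross : iteratedFDeriv ℝ 1 (polyFun p) ((1 / 2 : ℝ) • (a + b)) (fun _ => u) = 0
  quarter_left : iteratedFDeriv ℝ 2 (polyFun p) ((1 / 4 : ℝ) • ((2 : ℝ) • a + (a + b)))
    (fun _ => u) = 0
  quarter_right : iteratedFDeriv ℝ 2 (polyFun q) ((1 / 4 : ℝ) • ((2 : ℝ) • b + (a + b)))
    (fun _ => u) = 0

/-- In the frame `(a; b - a, u)` the edge is the unit interval of the first axis, the breakpoint and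
quarterpoints sit at 1/2, 1/4 and 3/4, and differentiation along `u` is `dY`. The data therefore
become exactly the hypotheses of `edge_coeffs`. -/
lemma EdgeZero.exists_coeffs {p q : MvPolynomial (Fin 2) ℝ} {a b u : Plane}
    (h : EdgeZero p q a b u) (hp : p.totalDegree ≤ 5) (hq : q.totalDegree ≤ 5) :
    ∃ c d, Deg5 c ∧ Deg5 d ∧ (∀ x y, polyFun p (fr a (b - a) u x y) = quint c x y) ∧
      (∀ x y, polyFun q (fr a (b - a) u x y) = quint d x y) ∧
      ∀ i j, j ≤ 2 → c i j = 0 ∧ d i j = 0 := by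
  obtain ⟨c, hc, hpc⟩ := exists_quint hp a (b - a) u
  obtain ⟨d, hd, hqd⟩ := exists_quint hq a (b - a) u
  have e0 : a = fr a (b - a) u 0 0 := by simp [fr]
  have e1 : b = fr a (b - a) u 1 0 := by simp [fr]
  have e2 : (1 / 2 : ℝ) • (a + b) = fr a (b - a) u (1 / 2) 0 := by
    apply plane_ext <;> simp [fr] <;> ring
  have e3 : (1 / 4 : ℝ) • ((2 : ℝ) • a + (a + b)) = fr a (b - a) u (1 / 4) 0 := by
    apply plane_ext <;> simp [fr] <;> ring
  have e4 : (1 / 4 : ℝ) • ((2 : ℝ) • b + (a + b)) = fr a (b - a) u (3 / 4) 0 := by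
    apply plane_ext <;> simp [fr] <;> ring
  refine ⟨c, d, hc, hd, hpc, hqd, edge_coeffs hc hd ?_ ?_ ?_ ?_ ?_ ?_⟩
  · exact (e0 ▸ h.left : JetEq 3 p 0 (fr a (b - a) u 0 0)).quint_eq_zero hc hpc
  · exact (e1 ▸ h.right : JetEq 3 q 0 (fr a (b - a) u 1 0)).quint_eq_zero hd hqd
  · exact (e2 ▸ h.mid).quint hc hd hpc hqd
  · have := h.cross
    rw [e2, iteratedFDeriv_const_snd (contDiff_polyFun p _) hc hpc] at this
    exact this
  · have := h.quarter_left
    rw [e3, iteratedFDeriv_const_snd (contDiff_polyFun p _) hc hpc] at this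
    exact this
  · have := h.quarter_right
    rw [e4, iteratedFDeriv_const_snd (contDiff_polyFun q _) hd hqd] at this
    exact this

lemma dX_dY_iterate_apply (c : ℕ → ℕ → ℝ) (i j k l : ℕ) (h : c (k + i) (l + j) = 0) :
    (dX^[i] (dY^[j] c)) k l = 0 := by
  induction i generalizing k with
  | zero =>
    induction j generalizing l with
    | zero => simpa using h
    | succ j ih =>
      have := ih (l + 1) (by rw [← h]; congr 1; omega)
      simp only [Function.iterate_zero, id, Function.iterate_succ_apply', dY] at this ⊢
      rw [this, mul_zero]
  | succ i ih =>
    have := ih (k + 1) (by rw [← h]; congr 1; omega)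
    rw [Function.iterate_succ_apply', dX, this, mul_zero]

/-- Vanishing Hermite data along an edge force contact of order two with zero along the edge. -/
lemma EdgeZero.jetEq {p q : MvPolynomial (Fin 2) ℝ} {a b u : Plane}
    (h : EdgeZero p q a b u) (hp : p.totalDegree ≤ 5) (hq : q.totalDegree ≤ 5)
    (hu : cr (b - a) u ≠ 0) (x : ℝ) :
    JetEq 2 p 0 (fr a (b - a) u x 0) ∧ JetEq 2 q 0 (fr a (b - a) u x 0) := by
  obtain ⟨c, d, hc, hd, hpc, hqd, hz⟩ := h.exists_coeffs hp hq
  have h0 : ∀ x y, polyFun 0 (fr a (b - a) u x y) = quint 0 x y := fun x y => by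
    simp [polyFun_zero, quint_zero]
  have key : ∀ c : ℕ → ℕ → ℝ, (∀ i j, j ≤ 2 → c i j = 0) → ∀ i j, i + j ≤ 2 →
      quint (dX^[i] (dY^[j] c)) x 0 = quint (dX^[i] (dY^[j] 0)) x 0 := by
    intro c hc i j hij
    rw [dX_dY_iterate_zero, quint_zero, quint_snd_zero]
    simp [dX_dY_iterate_apply c i j _ _ (hc _ (0 + j) (by omega))]
  exact ⟨jetEq_of_quint hu hc deg5_zero hpc h0 (key c fun i j hj => (hz i j hj).1),
    jetEq_of_quint hu hd deg5_zero hqd h0 (key d fun i j hj => (hz i j hj).2)⟩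

/-- Vanishing to second order along the edge makes the piece divisible by the cube of the linear
form of the edge, and this form changes only by a scalar when `u` is replaced by `c - a`. The
cofactor has no constant term because the third derivatives vanish at `a`. -/
lemma EdgeZero.eq_cube {p q : MvPolynomial (Fin 2) ℝ} {a b c u : Plane}
    (h : EdgeZero p q a b u) (hp : p.totalDegree ≤ 5) (hq : q.totalDegree ≤ 5)
    (hu : cr (b - a) u ≠ 0) :
    ∃ k₁ k₂ k₃ k₄ k₅ : ℝ, ∀ x y, polyFun p (fr a (b - a) (c - a) x y) =
      y ^ 3 * (k₁ * x + k₂ * y + k₃ * x ^ 2 + k₄ * x * y + k₅ * y ^ 2) := by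
  obtain ⟨e, d, he, hd, hpe, hqd, hz⟩ := h.exists_coeffs hp hq
  have h03 : e 0 3 = 0 := by
    have hl := h.left
    rw [show a = fr a (b - a) u 0 0 by simp [fr]] at hl
    have := hl.quint_eq_zero he hpe 0 3 le_rfl
    simp only [quint_snd_zero, dY, Function.iterate_succ, Function.iterate_zero, id,
      Function.comp] at this
    norm_num at this
    exact this
  obtain ⟨r₁, r₂, hr⟩ : ∃ r₁ r₂ : ℝ, c - a = r₁ • (b - a) + r₂ • u :=
    ⟨_, _, exists_smul_of_cr hu _⟩
  have hfr : ∀ x y, fr a (b - a) (c - a) x y = fr a (b - a) u (x + r₁ * y) (r₂ * y) := by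
    intro x y
    rw [fr, fr, hr]
    module
  refine ⟨r₂ ^ 3 * e 1 3, r₂ ^ 3 * (e 1 3 * r₁ + e 0 4 * r₂), r₂ ^ 3 * e 2 3,
    r₂ ^ 3 * (2 * e 2 3 * r₁ + e 1 4 * r₂), r₂ ^ 3 * (e 2 3 * r₁ ^ 2 + e 1 4 * r₁ * r₂ +
      e 0 5 * r₂ ^ 2), fun x y => ?_⟩
  rw [hfr, hpe, quint_of_le_two he (fun i j hj => (hz i j hj).1), h03]
  ring

/-! ### Elimination on the 12-split -/

/-- A polynomial of degree at most five with the six zeros 0, ±1, ±2, 3 vanishes. -/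
lemma six_coeffs {c₀ c₁ c₂ c₃ c₄ c₅ : ℝ}
    (h : ∀ x : ℝ, c₀ + c₁ * x + c₂ * x ^ 2 + c₃ * x ^ 3 + c₄ * x ^ 4 + c₅ * x ^ 5 = 0) :
    c₀ = 0 ∧ c₁ = 0 ∧ c₂ = 0 ∧ c₃ = 0 ∧ c₄ = 0 ∧ c₅ = 0 := by
  have h0 := h 0
  have h1 := h 1
  have h2 := h (-1)
  have h3 := h 2
  have h4 := h (-2)
  have h5 := h 3
  norm_num at h0 h1 h2 h3 h4 h5
  refine ⟨h0, ?_, ?_, ?_, ?_, ?_⟩ <;> linarith only [h0, h1, h2, h3, h4, h5]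

/-- The two corner triangles at a vertex and their two neighbours, for a spline vanishing to second
order on the adjacent edges and to third order at the vertex. -/
lemma corner_elimination {p q i j : ℝ → ℝ → ℝ} {k₁ k₂ k₃ k₄ k₅ h₁ h₂ h₃ h₄ h₅ m₀ m₁ m₂ n₀ n₁ n₂
      l₀ l₁ l₂ l₀' l₁' l₂' : ℝ}
    (hp : ∀ x y, p x y = y ^ 3 * (k₁ * x + k₂ * y + k₃ * x ^ 2 + k₄ * x * y + k₅ * y ^ 2))
    (hq : ∀ x y, q x y = x ^ 3 * (h₁ * y + h₂ * x + h₃ * y ^ 2 + h₄ * y * x + h₅ * x ^ 2))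
    (hM : ∀ x y, p x y - q x y = (x - y) ^ 4 * (m₀ + m₁ * x + m₂ * y))
    (hN : ∀ x y, i x y - j x y = (x - y) ^ 4 * (n₀ + n₁ * x + n₂ * y))
    (hL : ∀ x y, p x y - i x y = (1 - 2 * x - 2 * y) ^ 4 * (l₀ + l₁ * x + l₂ * y))
    (hL' : ∀ x y, q x y - j x y = (1 - 2 * x - 2 * y) ^ 4 * (l₀' + l₁' * x + l₂' * y)) :
    (∀ x y, p x y = y ^ 3 * ((6 * m₂ - 4 * m₁) * x ^ 2 + (m₁ - 4 * m₂) * x * y + m₂ * y ^ 2)) ∧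
    (∀ x y, q x y = -x ^ 3 * (m₁ * x ^ 2 + (m₂ - 4 * m₁) * x * y + (6 * m₁ - 4 * m₂) * y ^ 2)) ∧
    (∀ x y, q x y - j x y = (1 - 2 * x - 2 * y) ^ 4 * (l₀ + l₁ * x + l₂ * y)) := by
  have key : ∀ x y : ℝ, y ^ 3 * (k₁ * x + k₂ * y + k₃ * x ^ 2 + k₄ * x * y + k₅ * y ^ 2) -
      x ^ 3 * (h₁ * y + h₂ * x + h₃ * y ^ 2 + h₄ * y * x + h₅ * x ^ 2) =
      (x - y) ^ 4 * (m₀ + m₁ * x + m₂ * y) := fun x y => by rw [← hM, hp, hq]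
  -- The identity `key` is read as a polynomial in `x` for each fixed `y`, and in `c3` the other way
  -- round. Both sides remain functions of the fixed variable, which suffices to rewrite `p` and
  -- `q`.
  have c4 : ∀ y : ℝ, k₂ * y ^ 4 + k₅ * y ^ 5 = m₀ * y ^ 4 + m₂ * y ^ 5 ∧
      k₁ * y ^ 3 + k₄ * y ^ 4 = -4 * m₀ * y ^ 3 + (m₁ - 4 * m₂) * y ^ 4 ∧
      k₃ * y ^ 3 = 6 * m₀ * y ^ 2 + (6 * m₂ - 4 * m₁) * y ^ 3 := by
    intro y
    have := six_coeffs (c₀ := k₂ * y ^ 4 + k₅ * y ^ 5 - (m₀ * y ^ 4 + m₂ * y ^ 5))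
      (c₁ := k₁ * y ^ 3 + k₄ * y ^ 4 - (-4 * m₀ * y ^ 3 + (m₁ - 4 * m₂) * y ^ 4))
      (c₂ := k₃ * y ^ 3 - (6 * m₀ * y ^ 2 + (6 * m₂ - 4 * m₁) * y ^ 3))
      (c₃ := - (h₁ * y + h₃ * y ^ 2) - (-4 * m₀ * y + (6 * m₁ - 4 * m₂) * y ^ 2))
      (c₄ := - (h₂ + h₄ * y) - (m₀ + m₂ * y - 4 * m₁ * y)) (c₅ := - h₅ - m₁)
      (fun x => by linear_combination key x y)
    obtain ⟨a, b, c, -⟩ := this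
    exact ⟨sub_eq_zero.1 a, sub_eq_zero.1 b, sub_eq_zero.1 c⟩
  have c3 : ∀ x : ℝ, h₂ * x ^ 4 + h₅ * x ^ 5 = -m₀ * x ^ 4 - m₁ * x ^ 5 ∧
      h₁ * x ^ 3 + h₄ * x ^ 4 = 4 * m₀ * x ^ 3 - (m₂ - 4 * m₁) * x ^ 4 ∧
      h₃ * x ^ 3 = -6 * m₀ * x ^ 2 - (6 * m₁ - 4 * m₂) * x ^ 3 := by
    intro x
    have := six_coeffs (c₀ := h₂ * x ^ 4 + h₅ * x ^ 5 + (m₀ * x ^ 4 + m₁ * x ^ 5))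
      (c₁ := h₁ * x ^ 3 + h₄ * x ^ 4 + (-4 * m₀ * x ^ 3 + (m₂ - 4 * m₁) * x ^ 4))
      (c₂ := h₃ * x ^ 3 + (6 * m₀ * x ^ 2 + (6 * m₁ - 4 * m₂) * x ^ 3))
      (c₃ := - (k₁ * x + k₃ * x ^ 2) + (-4 * m₀ * x + (6 * m₂ - 4 * m₁) * x ^ 2))
      (c₄ := - (k₂ + k₄ * x) + (m₀ + m₁ * x - 4 * m₂ * x)) (c₅ := - k₅ + m₂)
      (fun y => by linear_combination - key x y)
    obtain ⟨a, b, c, -⟩ := this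
    exact ⟨by linear_combination a, by linear_combination b, by linear_combination c⟩
  -- The term `6 * m₀` of degree (2, 2) has no counterpart, since `p` carries `y ^ 3` and `q`
  -- carries `x ^ 3`. Its even power of `y` is separated from the cubic terms by evaluating at 1 and
  -- -1.
  have m0 : m₀ = 0 := by
    have e1 := (c4 1).2.2
    have e2 := (c4 (-1)).2.2
    norm_num at e1 e2
    linarith
  subst m0
  have hp' : ∀ x y, p x y =
      y ^ 3 * ((6 * m₂ - 4 * m₁) * x ^ 2 + (m₁ - 4 * m₂) * x * y + m₂ * y ^ 2) := fun x y => by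
    rw [hp]
    obtain ⟨a, b, c⟩ := c4 y
    linear_combination a + x * b + x ^ 2 * c
  have hq' : ∀ x y, q x y =
      -x ^ 3 * (m₁ * x ^ 2 + (m₂ - 4 * m₁) * x * y + (6 * m₁ - 4 * m₂) * y ^ 2) := fun x y => by
    rw [hq]
    obtain ⟨a, b, c⟩ := c3 x
    linear_combination a + y * b + y ^ 2 * c
  refine ⟨hp', hq', ?_⟩
  -- The jumps between the four pieces around the crossing point add up to zero. An equality between
  -- multiples of fourth powers of two different lines, in degree five, forces both affine factors
  -- to vanish; evaluation at a few points makes this explicit.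
  have conf : ∀ x y : ℝ, (x - y) ^ 4 * ((m₁ - n₁) * x + (m₂ - n₂) * y - n₀) =
      (1 - 2 * x - 2 * y) ^ 4 * ((l₀ - l₀') + (l₁ - l₁') * x + (l₂ - l₂') * y) := fun x y => by
    linear_combination - hM x y + hN x y + hL x y - hL' x y
  have t0 := conf 0 0
  have t1 := conf 1 1
  have t2 := conf (1 / 4) (3 / 4)
  have t3 := conf 0 (1 / 2)
  have t4 := conf (1 / 2) 0
  have t5 := conf 1 0
  have t6 := conf 0 1
  have t7 := conf 2 0
  have t8 := conf 3 0
  norm_num at t0 t1 t2 t3 t4 t5 t6 t7 t8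
  have r0 : l₀ = l₀' := by linarith only [t0]
  subst r0
  have r1 : l₁ = l₁' := by linarith only [t1, t2, t3, t4, t5, t6, t7, t8]
  subst r1
  have r2 : l₂ = l₂' := by linarith only [t1]
  subst r2
  exact hL'

/-- The three medians meet at the centroid. In coordinates centred there, the identity splits into
degrees four and five: fourth powers of three pairwise independent linear forms are independent, and
their six products with linear forms are a basis of the binary quintic forms. Nine sample points
turn this into a nonsingular linear system. -/
lemma centroid_elimination {a₀ a₁ a₂ b₀ b₁ b₂ c₀ c₁ c₂ : ℝ}
    (h : ∀ x y : ℝ, (x - y) ^ 4 * (a₀ + a₁ * x + a₂ * y) +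
      (1 - x - 2 * y) ^ 4 * (b₀ + b₁ * x + b₂ * y) +
      (1 - 2 * x - y) ^ 4 * (c₀ + c₁ * x + c₂ * y) = 0) :
    a₀ = 0 ∧ a₁ = 0 ∧ a₂ = 0 ∧ b₀ = 0 ∧ b₁ = 0 ∧ b₂ = 0 ∧ c₀ = 0 ∧ c₁ = 0 ∧ c₂ = 0 := by
  have h0 := h (0) (1 / 3)
  have h1 := h (1 / 3) (0)
  have h2 := h (1 / 3) (2 / 3)
  have h3 := h (2 / 3) (1 / 3)
  have h4 := h (0) (0)
  have h5 := h (0) (2 / 3)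
  have h6 := h (2 / 3) (0)
  have h7 := h (-1 / 3) (0)
  have h8 := h (-1 / 3) (2 / 3)
  norm_num at h0 h1 h2 h3 h4 h5 h6 h7 h8
  refine ⟨?_, ?_, ?_, ?_, ?_, ?_, ?_, ?_, ?_⟩ <;>
    linarith only [h0, h1, h2, h3, h4, h5, h6, h7, h8]

/-- The `C³` quintics on the 12-split of a triangle with vanishing Hermite data vanish: the six
corner pieces and the six inner pieces, in barycentric coordinates `(1 - x - y, x, y)`. -/
lemma split_elimination {Cab Cac Cbc Cba Cca Ccb Iab Iac Ibc Iba Ica Icb : ℝ → ℝ → ℝ}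
    {β₁ γ₁ β₂ γ₂ β₃ γ₃ l₀ l₁ l₂ m₀ m₁ m₂ n₀ n₁ n₂ c₀ c₁ c₂ a₀ a₁ a₂ b₀ b₁ b₂ : ℝ}
    (hab : ∀ x y, Cab x y = y ^ 3 * ((6 * γ₁ - 4 * β₁) * x ^ 2 + (β₁ - 4 * γ₁) * x * y + γ₁ * y ^ 2))
    (hac : ∀ x y, Cac x y =
      -x ^ 3 * (β₁ * x ^ 2 + (γ₁ - 4 * β₁) * x * y + (6 * β₁ - 4 * γ₁) * y ^ 2))
    (hiab : ∀ x y, Cab x y - Iab x y = (1 - 2 * x - 2 * y) ^ 4 * (l₀ + l₁ * x + l₂ * y))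
    (hiac : ∀ x y, Cac x y - Iac x y = (1 - 2 * x - 2 * y) ^ 4 * (l₀ + l₁ * x + l₂ * y))
    (hbc : ∀ x y, Cbc x y = (1 - x - y) ^ 3 *
      ((6 * γ₂ - 4 * β₂) * y ^ 2 + (β₂ - 4 * γ₂) * y * (1 - x - y) + γ₂ * (1 - x - y) ^ 2))
    (hba : ∀ x y, Cba x y = -y ^ 3 *
      (β₂ * y ^ 2 + (γ₂ - 4 * β₂) * y * (1 - x - y) + (6 * β₂ - 4 * γ₂) * (1 - x - y) ^ 2))
    (hibc : ∀ x y, Cbc x y - Ibc x y =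
      (1 - 2 * y - 2 * (1 - x - y)) ^ 4 * (m₀ + m₁ * y + m₂ * (1 - x - y)))
    (hiba : ∀ x y, Cba x y - Iba x y =
      (1 - 2 * y - 2 * (1 - x - y)) ^ 4 * (m₀ + m₁ * y + m₂ * (1 - x - y)))
    (hca : ∀ x y, Cca x y = x ^ 3 *
      ((6 * γ₃ - 4 * β₃) * (1 - x - y) ^ 2 + (β₃ - 4 * γ₃) * (1 - x - y) * x + γ₃ * x ^ 2))
    (hcb : ∀ x y, Ccb x y = -(1 - x - y) ^ 3 *
      (β₃ * (1 - x - y) ^ 2 + (γ₃ - 4 * β₃) * (1 - x - y) * x + (6 * β₃ - 4 * γ₃) * x ^ 2))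
    (hica : ∀ x y, Cca x y - Ica x y =
      (1 - 2 * (1 - x - y) - 2 * x) ^ 4 * (n₀ + n₁ * (1 - x - y) + n₂ * x))
    (hicb : ∀ x y, Ccb x y - Icb x y =
      (1 - 2 * (1 - x - y) - 2 * x) ^ 4 * (n₀ + n₁ * (1 - x - y) + n₂ * x))
    (hc : ∀ x y, Iab x y - Iba x y = (1 - 2 * x - y) ^ 4 * (c₀ + c₁ * x + c₂ * y))
    (ha : ∀ x y, Ibc x y - Icb x y = (x - y) ^ 4 * (a₀ + a₁ * x + a₂ * y))
    (hb : ∀ x y, Ica x y - Iac x y = (1 - x - 2 * y) ^ 4 * (b₀ + b₁ * x + b₂ * y)) :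
    ∀ x y, Cab x y = 0 ∧ Iab x y = 0 := by
  -- The jumps of the six inner pieces around the centroid add up to zero. The jump between the
  -- inner pieces at a vertex equals that of the corner pieces, because both cuts there carry the
  -- same factor; so each median has the same affine factor on both sides of the centroid.
  obtain ⟨ea₀, ea₁, ea₂, eb₀, eb₁, eb₂, ec₀, ec₁, ec₂⟩ := centroid_elimination
    (a₀ := a₀) (a₁ := a₁ - β₁) (a₂ := a₂ - γ₁) (b₀ := b₀ - γ₂) (b₁ := b₁ + γ₂) (b₂ := b₂ + γ₂ - β₂)
    (c₀ := c₀ - β₃) (c₁ := c₁ + β₃ - γ₃) (c₂ := c₂ + β₃) (fun x y => by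
      linear_combination - hc x y - ha x y - hb x y - hiab x y + hiac x y - hibc x y + hiba x y
        - hica x y + hicb x y + hab x y - hac x y + hbc x y - hba x y + hca x y - hcb x y)
  obtain rfl : c₀ = β₃ := by linarith
  obtain rfl : a₀ = 0 := ea₀
  obtain rfl : b₀ = γ₂ := by linarith
  obtain rfl : c₁ = γ₃ - c₀ := by linarith
  obtain rfl : c₂ = - c₀ := by linarith
  obtain rfl : a₁ = β₁ := by linarith
  obtain rfl : a₂ = γ₁ := by linarith
  -- Fifteen unknowns remain: two median parameters and one affine factor of a cut for each corner.
  -- Fifteen evaluations of the jumps across the medians from `c` and from `a` determine those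
  -- belonging to the corner `a`; the other labellings are covered by symmetry.
  have z : a₁ = 0 ∧ a₂ = 0 ∧ l₀ = 0 ∧ l₁ = 0 ∧ l₂ = 0 := by
    have iab := fun x y => eq_sub_of_add_eq (sub_eq_iff_eq_add'.1 (hiab x y)).symm
    have iba := fun x y => eq_sub_of_add_eq (sub_eq_iff_eq_add'.1 (hiba x y)).symm
    have ibc := fun x y => eq_sub_of_add_eq (sub_eq_iff_eq_add'.1 (hibc x y)).symm
    have icb := fun x y => eq_sub_of_add_eq (sub_eq_iff_eq_add'.1 (hicb x y)).symm
    have k0 := hc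
    have k1 := ha
    simp only [iab, iba, ibc, icb, hab, hba, hbc, hcb] at k0 k1
    clear hab hac hiab hiac hbc hba hibc hiba hca hcb hica hicb hc ha hb iab iba ibc icb
    have h0 := k0 (0) (0)
    have h1 := k1 (0) (0)
    have h2 := k0 (-1/2) (0)
    have h3 := k1 (-1/2) (0)
    have h4 := k0 (0) (-1/2)
    have h5 := k1 (0) (-1/2)
    have h6 := k0 (0) (1/2)
    have h7 := k1 (1/2) (0)
    have h8 := k1 (-1) (0)
    have h9 := k0 (-1/2) (-1/2)
    have h10 := k1 (-1/2) (-1/2)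
    have h11 := k0 (-1/2) (1/2)
    have h12 := k1 (-1/2) (1/2)
    have h13 := k0 (0) (-1)
    have h14 := k0 (0) (1)
    norm_num at h0 h1 h2 h3 h4 h5 h6 h7 h8 h9 h10 h11 h12 h13 h14
    refine ⟨?_, ?_, ?_, ?_, ?_⟩ <;>
      linarith only [h0, h1, h2, h3, h4, h5, h6, h7, h8, h9, h10, h11, h12, h13, h14]
  obtain ⟨rfl, rfl, rfl, rfl, rfl⟩ := z
  intro x y
  have h1 := hab x y
  have h2 := hiab x y
  constructor <;> linarith

/-! ### Pieces of a 12-split and their contact along interior segments -/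

/-- The midpoint of two points. -/
def mid (a b : Plane) : Plane := (1 / 2 : ℝ) • (a + b)

/-- The crossing of the median from `a` with the segment joining the midpoints of the edges
at `a`. -/
def quar (a b c : Plane) : Plane := (1 / 4 : ℝ) • ((2 : ℝ) • a + b + c)

/-- The centroid. -/
def cen (a b c : Plane) : Plane := (1 / 3 : ℝ) • (a + b + c)

lemma cen_comm (a b c : Plane) : cen a c b = cen a b c := by unfold cen; module

lemma quar_comm (a b c : Plane) : quar a c b = quar a b c := by unfold quar; module

/-- Quintics on the corner triangles `C` and the inner triangles `I` of a 12-split, labelled by the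
enumerations of the vertex set `t`, which join with contact of order three. -/
structure IsSplitPieces (t : Set Plane) (C I : Plane → Plane → Plane → MvPolynomial (Fin 2) ℝ) :
    Prop where
  degC : ∀ a b c, t = {a, b, c} → (C a b c).totalDegree ≤ 5
  degI : ∀ a b c, t = {a, b, c} → (I a b c).totalDegree ≤ 5
  corner_corner : ∀ a b c, t = {a, b, c} → ∀ z ∈ segment ℝ a (quar a b c),
    JetEq 3 (C a b c) (C a c b) z
  corner_inner : ∀ a b c, t = {a, b, c} → ∀ z ∈ segment ℝ (mid a b) (quar a b c),
    JetEq 3 (C a b c) (I a b c) z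
  inner_inner : ∀ a b c, t = {a, b, c} → ∀ z ∈ segment ℝ (quar a b c) (cen a b c),
    JetEq 3 (I a b c) (I a c b) z
  inner_inner' : ∀ a b c, t = {a, b, c} → ∀ z ∈ segment ℝ (mid a b) (cen a b c),
    JetEq 3 (I a b c) (I b a c) z

lemma sub_of_contact_segment {p q : MvPolynomial (Fin 2) ℝ} (hp : p.totalDegree ≤ 5)
    (hq : q.totalDegree ≤ 5) {z z' : Plane} (h : ∀ w ∈ segment ℝ z z', JetEq 3 p q w) (v : Plane) :
    ∃ α β γ : ℝ, ∀ x y, polyFun p (fr z (z' - z) v x y) - polyFun q (fr z (z' - z) v x y) =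
      y ^ 4 * (α + β * x + γ * y) := by
  apply sub_of_contact hp hq <;> apply h
  · simpa [fr] using left_mem_segment ℝ z z'
  · simpa [fr] using right_mem_segment ℝ z z'
  · refine ⟨1 / 2, 1 / 2, by norm_num, by norm_num, by norm_num, ?_⟩
    unfold fr; module

lemma triple_swap (a b c : Plane) : ({a, b, c} : Set Plane) = {a, c, b} := by
  ext; simp; tauto

lemma triple_rot (a b c : Plane) : ({a, b, c} : Set Plane) = {b, c, a} := by
  ext; simp; tauto

lemma triple_swap' (a b c : Plane) : ({a, b, c} : Set Plane) = {b, a, c} := by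
  ext; simp; tauto

lemma fr_swap (a b c : Plane) (x y : ℝ) :
    fr a (c - a) (b - a) y x = fr a (b - a) (c - a) x y := by unfold fr; module

lemma fr_rot (a b c : Plane) (x y : ℝ) :
    fr b (c - b) (a - b) y (1 - x - y) = fr a (b - a) (c - a) x y := by unfold fr; module

section
variable {t : Set Plane} {C I : Plane → Plane → Plane → MvPolynomial (Fin 2) ℝ} {a b c : Plane}

lemma IsSplitPieces.exists_median (h : IsSplitPieces t C I) (ht : t = {a, b, c}) :
    ∃ m₀ m₁ m₂ : ℝ, ∀ x y, polyFun (C a b c) (fr a (b - a) (c - a) x y) -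
      polyFun (C a c b) (fr a (b - a) (c - a) x y) = (x - y) ^ 4 * (m₀ + m₁ * x + m₂ * y) := by
  obtain ⟨α, β, γ, e⟩ := sub_of_contact_segment (h.degC a b c ht)
    (h.degC a c b (ht.trans (triple_swap a b c))) (h.corner_corner a b c ht) (c - a)
  refine ⟨α, 4 * β - γ, γ, fun x y => ?_⟩
  have := e (4 * x) (y - x)
  rw [show fr a (quar a b c - a) (c - a) (4 * x) (y - x) = fr a (b - a) (c - a) x y by
    unfold fr quar; module] at this
  rw [this]; ring

lemma IsSplitPieces.exists_inner_median (h : IsSplitPieces t C I) (ht : t = {a, b, c}) :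
    ∃ m₀ m₁ m₂ : ℝ, ∀ x y, polyFun (I a b c) (fr a (b - a) (c - a) x y) -
      polyFun (I a c b) (fr a (b - a) (c - a) x y) = (x - y) ^ 4 * (m₀ + m₁ * x + m₂ * y) := by
  obtain ⟨α, β, γ, e⟩ := sub_of_contact_segment (h.degI a b c ht)
    (h.degI a c b (ht.trans (triple_swap a b c))) (h.inner_inner a b c ht) (c - a)
  refine ⟨α - 3 * β, 12 * β - γ, γ, fun x y => ?_⟩
  have := e (12 * (x - 1 / 4)) (y - x)
  rw [show fr (quar a b c) (cen a b c - quar a b c) (c - a) (12 * (x - 1 / 4)) (y - x) =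
    fr a (b - a) (c - a) x y by unfold fr quar cen; module] at this
  rw [this]; ring

lemma IsSplitPieces.exists_cut (h : IsSplitPieces t C I) (ht : t = {a, b, c}) :
    ∃ m₀ m₁ m₂ : ℝ, ∀ x y, polyFun (C a b c) (fr a (b - a) (c - a) x y) -
      polyFun (I a b c) (fr a (b - a) (c - a) x y) =
        (1 - 2 * x - 2 * y) ^ 4 * (m₀ + m₁ * x + m₂ * y) := by
  obtain ⟨α, β, γ, e⟩ := sub_of_contact_segment (h.degC a b c ht)
    (h.degI a b c ht) (h.corner_inner a b c ht) (b - a)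
  refine ⟨(α - γ / 2) / 16, γ / 16, (4 * β + γ) / 16, fun x y => ?_⟩
  have := e (4 * y) (x + y - 1 / 2)
  rw [show fr (mid a b) (quar a b c - mid a b) (b - a) (4 * y) (x + y - 1 / 2) =
    fr a (b - a) (c - a) x y by unfold fr quar mid; module] at this
  rw [this]; ring

lemma IsSplitPieces.exists_inner (h : IsSplitPieces t C I) (ht : t = {a, b, c}) :
    ∃ m₀ m₁ m₂ : ℝ, ∀ x y, polyFun (I a b c) (fr a (b - a) (c - a) x y) -
      polyFun (I b a c) (fr a (b - a) (c - a) x y) =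
        (1 - 2 * x - y) ^ 4 * (m₀ + m₁ * x + m₂ * y) := by
  obtain ⟨α, β, γ, e⟩ := sub_of_contact_segment (h.degI a b c ht)
    (h.degI b a c (ht.trans (triple_swap' a b c))) (h.inner_inner' a b c ht) (b - a)
  refine ⟨(α - γ / 2) / 16, γ / 16, (3 * β + γ / 2) / 16, fun x y => ?_⟩
  have := e (3 * y) (x + y / 2 - 1 / 2)
  rw [show fr (mid a b) (cen a b c - mid a b) (b - a) (3 * y) (x + y / 2 - 1 / 2) =
    fr a (b - a) (c - a) x y by unfold fr cen mid; module] at this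
  rw [this]; ring

/-- The edge data make the two corner pieces at `a` multiples of cubes of the two edge forms, and
the contact conditions across the median and the two cuts are then those of `corner_elimination`.
Only two median parameters and one common factor for the two cuts survive. -/
lemma IsSplitPieces.corner (h : IsSplitPieces t C I)
    (hE : ∀ a b c, t = {a, b, c} → ∃ u, cr (b - a) u ≠ 0 ∧ EdgeZero (C a b c) (C b a c) a b u)
    (ht : t = {a, b, c}) :
    ∃ β γ l₀ l₁ l₂ : ℝ,
      (∀ x y, polyFun (C a b c) (fr a (b - a) (c - a) x y) =
        y ^ 3 * ((6 * γ - 4 * β) * x ^ 2 + (β - 4 * γ) * x * y + γ * y ^ 2)) ∧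
      (∀ x y, polyFun (C a c b) (fr a (b - a) (c - a) x y) =
        -x ^ 3 * (β * x ^ 2 + (γ - 4 * β) * x * y + (6 * β - 4 * γ) * y ^ 2)) ∧
      (∀ x y, polyFun (C a b c) (fr a (b - a) (c - a) x y) -
        polyFun (I a b c) (fr a (b - a) (c - a) x y) =
          (1 - 2 * x - 2 * y) ^ 4 * (l₀ + l₁ * x + l₂ * y)) ∧
      (∀ x y, polyFun (C a c b) (fr a (b - a) (c - a) x y) -
        polyFun (I a c b) (fr a (b - a) (c - a) x y) =
          (1 - 2 * x - 2 * y) ^ 4 * (l₀ + l₁ * x + l₂ * y)) := by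
  have ht' := ht.trans (triple_swap a b c)
  obtain ⟨u, hu, hz⟩ := hE a b c ht
  obtain ⟨k₁, k₂, k₃, k₄, k₅, hp⟩ := hz.eq_cube (c := c) (h.degC a b c ht)
    (h.degC b a c (ht.trans (triple_swap' a b c))) hu
  obtain ⟨u', hu', hz'⟩ := hE a c b ht'
  obtain ⟨h₁, h₂, h₃, h₄, h₅, hq⟩ := hz'.eq_cube (c := b) (h.degC a c b ht')
    (h.degC c a b (ht'.trans (triple_swap' a c b))) hu'
  obtain ⟨m₀, m₁, m₂, hM⟩ := h.exists_median ht
  obtain ⟨n₀, n₁, n₂, hN⟩ := h.exists_inner_median ht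
  obtain ⟨l₀, l₁, l₂, hL⟩ := h.exists_cut ht
  obtain ⟨l₀', l₁', l₂', hL'⟩ := h.exists_cut ht'
  -- The cut of the second corner is described in the swapped frame, which explains the exchanged
  -- coefficients `l₂'` and `l₁'`.
  obtain ⟨r₁, r₂, r₃⟩ := corner_elimination
    (p := fun x y => polyFun (C a b c) (fr a (b - a) (c - a) x y))
    (q := fun x y => polyFun (C a c b) (fr a (b - a) (c - a) x y))
    (i := fun x y => polyFun (I a b c) (fr a (b - a) (c - a) x y))
    (j := fun x y => polyFun (I a c b) (fr a (b - a) (c - a) x y))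
    (l₀' := l₀') (l₁' := l₂') (l₂' := l₁') hp
    (fun x y => by simpa only [fr_swap] using hq y x) hM hN hL
    (fun x y => by
      have := hL' y x
      rw [fr_swap] at this
      rw [this]; ring)
  exact ⟨m₁, m₂, l₀, l₁, l₂, r₁, r₂, hL, r₃⟩

/-- A `C³` quintic on the 12-split of a triangle is determined by its Hermite data. -/
theorem IsSplitPieces.eq_zero (h : IsSplitPieces t C I)
    (hE : ∀ a b c, t = {a, b, c} → ∃ u, cr (b - a) u ≠ 0 ∧ EdgeZero (C a b c) (C b a c) a b u)
    (ht : t = {a, b, c}) (hcr : cr (b - a) (c - a) ≠ 0) (z : Plane) :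
    polyFun (C a b c) z = 0 ∧ polyFun (I a b c) z = 0 := by
  have ht2 := ht.trans (triple_rot a b c)
  have ht3 := ht2.trans (triple_rot b c a)
  obtain ⟨β₁, γ₁, l₀, l₁, l₂, a1, a2, a3, a4⟩ := h.corner hE ht
  obtain ⟨β₂, γ₂, m₀, m₁, m₂, b1, b2, b3, b4⟩ := h.corner hE ht2
  obtain ⟨β₃, γ₃, n₀, n₁, n₂, c1, c2, c3, c4⟩ := h.corner hE ht3
  obtain ⟨c₀, c₁, c₂, kc⟩ := h.exists_inner ht
  obtain ⟨a₀', a₁', a₂', ka⟩ := h.exists_inner ht2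
  obtain ⟨b₀', b₁', b₂', kb⟩ := h.exists_inner ht3
  have e2 : ∀ x y, fr b (c - b) (a - b) y (1 - x - y) = fr a (b - a) (c - a) x y := fr_rot a b c
  have e3 : ∀ x y, fr c (a - c) (b - c) (1 - x - y) x = fr a (b - a) (c - a) x y := fun x y => by
    unfold fr; module
  obtain ⟨x, y, rfl⟩ := exists_fr hcr a z
  -- The relations at `b` and `c` hold in cyclically permuted barycentric coordinates. The
  -- coefficients given for `a₀`, …, `b₂` re-expand their affine factors in the coordinates `x`, `y`
  -- based at `a`.
  refine split_elimination
    (Cab := fun x y => polyFun (C a b c) (fr a (b - a) (c - a) x y))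
    (Cac := fun x y => polyFun (C a c b) (fr a (b - a) (c - a) x y))
    (Cbc := fun x y => polyFun (C b c a) (fr a (b - a) (c - a) x y))
    (Cba := fun x y => polyFun (C b a c) (fr a (b - a) (c - a) x y))
    (Cca := fun x y => polyFun (C c a b) (fr a (b - a) (c - a) x y))
    (Ccb := fun x y => polyFun (C c b a) (fr a (b - a) (c - a) x y))
    (Iab := fun x y => polyFun (I a b c) (fr a (b - a) (c - a) x y))
    (Iac := fun x y => polyFun (I a c b) (fr a (b - a) (c - a) x y))
    (Ibc := fun x y => polyFun (I b c a) (fr a (b - a) (c - a) x y))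
    (Iba := fun x y => polyFun (I b a c) (fr a (b - a) (c - a) x y))
    (Ica := fun x y => polyFun (I c a b) (fr a (b - a) (c - a) x y))
    (Icb := fun x y => polyFun (I c b a) (fr a (b - a) (c - a) x y))
    (β₂ := β₂) (γ₂ := γ₂) (β₃ := β₃) (γ₃ := γ₃) (m₀ := m₀) (m₁ := m₁) (m₂ := m₂) (n₀ := n₀) (n₁ := n₁)
    (n₂ := n₂) (a₀ := a₀' + a₂') (a₁ := - a₂') (a₂ := a₁' - a₂')
    (b₀ := b₀' + b₁') (b₁ := b₂' - b₁') (b₂ := - b₁')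
    a1 a2 a3 a4 ?_ ?_ ?_ ?_ ?_ ?_ ?_ ?_ kc ?_ ?_ x y
  · intro x y; simpa only [e2] using b1 y (1 - x - y)
  · intro x y; simpa only [e2] using b2 y (1 - x - y)
  · intro x y; simpa only [e2] using b3 y (1 - x - y)
  · intro x y; simpa only [e2] using b4 y (1 - x - y)
  · intro x y; simpa only [e3] using c1 (1 - x - y) x
  · intro x y; simpa only [e3] using c2 (1 - x - y) x
  · intro x y; simpa only [e3] using c3 (1 - x - y) x
  · intro x y; simpa only [e3] using c4 (1 - x - y) x
  · intro x y
    have := ka y (1 - x - y)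
    rw [e2] at this
    rw [this]; ring
  · intro x y
    have := kb (1 - x - y) x
    rw [e3] at this
    rw [this]; ring

end

/-! ### Triangles -/

lemma mem_convexHull_triple {a b c z : Plane} :
    z ∈ convexHull ℝ ({a, b, c} : Set Plane) ↔
      ∃ x y : ℝ, 0 ≤ x ∧ 0 ≤ y ∧ x + y ≤ 1 ∧ z = fr a (b - a) (c - a) x y := by
  constructor
  · intro hz
    let S : Set Plane := {z | ∃ x y : ℝ, 0 ≤ x ∧ 0 ≤ y ∧ x + y ≤ 1 ∧ z = fr a (b - a) (c - a) x y}
    have hS : Convex ℝ S := by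
      rintro _ ⟨x, y, hx, hy, hxy, rfl⟩ _ ⟨x', y', hx', hy', hxy', rfl⟩ α β hα hβ hαβ
      refine ⟨α * x + β * x', α * y + β * y', by positivity, by positivity, ?_, ?_⟩
      · nlinarith
      · unfold fr
        obtain rfl : β = 1 - α := by linarith
        module
    refine convexHull_min ?_ hS hz
    rintro w (rfl | rfl | rfl)
    · exact ⟨0, 0, le_rfl, le_rfl, by norm_num, by simp [fr]⟩
    · exact ⟨1, 0, by norm_num, le_rfl, by norm_num, by simp [fr]⟩
    · exact ⟨0, 1, le_rfl, by norm_num, by norm_num, by simp [fr]⟩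
  · rintro ⟨x, y, hx, hy, hxy, rfl⟩
    have := (convex_convexHull ℝ ({a, b, c} : Set Plane)).sum_mem (t := Finset.univ)
      (w := ![1 - x - y, x, y]) (z := ![a, b, c]) ?_ ?_ ?_
    · rw [Fin.sum_univ_three] at this
      convert this using 1
      simp only [fr, Matrix.cons_val]
      module
    · intro i _
      fin_cases i
      · simp; linarith
      · simpa
      · simpa
    · rw [Fin.sum_univ_three]; simp; ring
    · intro i _
      apply subset_convexHull
      fin_cases i <;> simp

lemma cr_add_smul (w₁ w₂ : Plane) (x y x' y' : ℝ) :
    cr (x • w₁ + y • w₂) (x' • w₁ + y' • w₂) = (x * y' - y * x') * cr w₁ w₂ := by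
  simp [cr]; ring

lemma fr_injective {o w₁ w₂ : Plane} (h : cr w₁ w₂ ≠ 0) {x y x' y' : ℝ}
    (e : fr o w₁ w₂ x y = fr o w₁ w₂ x' y') : x = x' ∧ y = y' := by
  have h0 := congrArg (fun z : Plane => z 0) e
  have h1 := congrArg (fun z : Plane => z 1) e
  simp only [fr_apply] at h0 h1
  constructor
  · apply sub_eq_zero.1 ((mul_eq_zero.1 (_ : (x - x') * cr w₁ w₂ = 0)).resolve_right h)
    simp only [cr]; linear_combination w₂ 1 * h0 - w₂ 0 * h1
  · apply sub_eq_zero.1 ((mul_eq_zero.1 (_ : (y - y') * cr w₁ w₂ = 0)).resolve_right h)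
    simp only [cr]; linear_combination w₁ 0 * h1 - w₁ 1 * h0

lemma interior_triple_nonempty {a b c : Plane} (h : cr (b - a) (c - a) ≠ 0) :
    (interior (convexHull ℝ ({a, b, c} : Set Plane))).Nonempty := by
  let X : Plane → ℝ := fun z => cr (z - a) (c - a) / cr (b - a) (c - a)
  let Y : Plane → ℝ := fun z => cr (b - a) (z - a) / cr (b - a) (c - a)
  have hX : Continuous X := by unfold X cr; simp only [PiLp.sub_apply]; fun_prop
  have hY : Continuous Y := by unfold Y cr; simp only [PiLp.sub_apply]; fun_prop
  have hfr : ∀ z, z = fr a (b - a) (c - a) (X z) (Y z) := fun z => by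
    rw [fr, add_assoc, ← exists_smul_of_cr h (z - a)]; abel
  have hopen : IsOpen {z | 0 < X z ∧ 0 < Y z ∧ X z + Y z < 1} :=
    (isOpen_lt continuous_const hX).inter
      ((isOpen_lt continuous_const hY).inter (isOpen_lt (hX.add hY) continuous_const))
  refine ⟨fr a (b - a) (c - a) (1 / 3) (1 / 3), interior_maximal ?_ hopen ?_⟩
  · rintro z ⟨h1, h2, h3⟩
    exact mem_convexHull_triple.2 ⟨_, _, h1.le, h2.le, h3.le, hfr z⟩
  · obtain ⟨e1, e2⟩ := fr_injective h (hfr (fr a (b - a) (c - a) (1 / 3) (1 / 3)))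
    simp only [Set.mem_ofPred_eq, ← e1, ← e2]
    norm_num

/-- The corner triangle of the 12-split. -/
def corner (a b c : Plane) : Set Plane := {a, mid a b, quar a b c}

/-- The inner triangle of the 12-split. -/
def inner (a b c : Plane) : Set Plane := {mid a b, quar a b c, cen a b c}

lemma mem_split12 {t τ : Set Plane} :
    τ ∈ split12 t ↔ ∃ a b c, t = {a, b, c} ∧ (τ = corner a b c ∨ τ = inner a b c) := Iff.rfl

/-- The corner triangle in barycentric coordinates. -/
lemma mem_convexHull_corner {a b c z : Plane} :
    z ∈ convexHull ℝ (corner a b c) ↔ ∃ x y : ℝ, 0 ≤ y ∧ y ≤ x ∧ x + y ≤ 1 / 2 ∧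
      z = fr a (b - a) (c - a) x y := by
  rw [corner, mem_convexHull_triple]
  constructor
  · rintro ⟨x, y, hx, hy, hxy, rfl⟩
    refine ⟨x / 2 + y / 4, y / 4, by linarith, by linarith, by linarith, ?_⟩
    unfold fr mid quar; module
  · rintro ⟨x, y, hx, hy, hxy, rfl⟩
    -- The coordinates relative to `a`, `mid a b` at (1/2, 0) and `quar a b c` at (1/4, 1/4); the
    -- inner triangle below is treated the same way with the centroid at (1/3, 1/3).
    refine ⟨2 * (x - y), 4 * y, by linarith, by linarith, by linarith, ?_⟩
    unfold fr mid quar; module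

/-- The inner triangle in barycentric coordinates. -/
lemma mem_convexHull_inner {a b c z : Plane} :
    z ∈ convexHull ℝ (inner a b c) ↔ ∃ x y : ℝ, y ≤ x ∧ 2 * x + y ≤ 1 ∧ 1 / 2 ≤ x + y ∧
      z = fr a (b - a) (c - a) x y := by
  rw [inner, mem_convexHull_triple]
  constructor
  · rintro ⟨x, y, hx, hy, hxy, rfl⟩
    refine ⟨1 / 2 - x / 4 - y / 6, x / 4 + y / 3, by linarith, by linarith, by linarith, ?_⟩
    unfold fr mid quar cen; module
  · rintro ⟨x, y, hx, hy, hxy, rfl⟩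
    refine ⟨4 * (1 - 2 * x - y), 6 * (x + y - 1 / 2), by linarith, by linarith, by linarith, ?_⟩
    unfold fr mid quar cen; module

lemma interior_corner_nonempty {a b c : Plane} (h : cr (b - a) (c - a) ≠ 0) :
    (interior (convexHull ℝ (corner a b c))).Nonempty := by
  apply interior_triple_nonempty
  rw [show mid a b - a = (1 / 2 : ℝ) • (b - a) + (0 : ℝ) • (c - a) by unfold mid; module,
    show quar a b c - a = (1 / 4 : ℝ) • (b - a) + (1 / 4 : ℝ) • (c - a) by unfold quar; module,
    cr_add_smul]
  exact mul_ne_zero (by norm_num) h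

lemma interior_inner_nonempty {a b c : Plane} (h : cr (b - a) (c - a) ≠ 0) :
    (interior (convexHull ℝ (inner a b c))).Nonempty := by
  apply interior_triple_nonempty
  rw [show quar a b c - mid a b = (-1 / 4 : ℝ) • (b - a) + (1 / 4 : ℝ) • (c - a) by
      unfold mid quar; module,
    show cen a b c - mid a b = (-1 / 6 : ℝ) • (b - a) + (1 / 3 : ℝ) • (c - a) by
      unfold mid cen; module, cr_add_smul]
  exact mul_ne_zero (by norm_num) h

lemma convexHull_corner_subset (a b c : Plane) :
    convexHull ℝ (corner a b c) ⊆ convexHull ℝ {a, b, c} := by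
  intro z hz
  obtain ⟨x, y, h1, h2, h3, rfl⟩ := mem_convexHull_corner.1 hz
  exact mem_convexHull_triple.2 ⟨x, y, by linarith, by linarith, by linarith, rfl⟩

lemma convexHull_inner_subset (a b c : Plane) :
    convexHull ℝ (inner a b c) ⊆ convexHull ℝ {a, b, c} := by
  intro z hz
  obtain ⟨x, y, h1, h2, h3, rfl⟩ := mem_convexHull_inner.1 hz
  exact mem_convexHull_triple.2 ⟨x, y, by linarith, by linarith, by linarith, rfl⟩

/-- The 12 triangles of the split cover the triangle. -/
lemma exists_cell_of_mem {t : Set Plane} {a b c z : Plane} (ht : t = {a, b, c})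
    (hz : z ∈ convexHull ℝ t) : ∃ a b c, t = {a, b, c} ∧
      (z ∈ convexHull ℝ (corner a b c) ∨ z ∈ convexHull ℝ (inner a b c)) := by
  -- The labelling is chosen so that the barycentric coordinates of `z` decrease from `a` to `b` to
  -- `c`. The sign of `x + y - 1 / 2` then separates the corner triangle from the inner one.
  have key : ∀ a b c, t = {a, b, c} → ∀ x y : ℝ, 0 ≤ y → y ≤ x → 2 * x + y ≤ 1 →
      z = fr a (b - a) (c - a) x y → ∃ a b c, t = {a, b, c} ∧
      (z ∈ convexHull ℝ (corner a b c) ∨ z ∈ convexHull ℝ (inner a b c)) := by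
    intro a b c ht x y h1 h2 h3 h4
    refine ⟨a, b, c, ht, ?_⟩
    rcases le_total (x + y) (1 / 2) with h | h
    · exact Or.inl (mem_convexHull_corner.2 ⟨x, y, h1, h2, h, h4⟩)
    · exact Or.inr (mem_convexHull_inner.2 ⟨x, y, h2, h3, h, h4⟩)
  rw [ht] at hz
  obtain ⟨x, y, hx, hy, hxy, hz⟩ := mem_convexHull_triple.1 hz
  have t2 := ht.trans (triple_rot a b c)
  have t3 := t2.trans (triple_rot b c a)
  rcases le_total x y with h1 | h1 <;> rcases le_total x (1 - x - y) with h2 | h2 <;>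
    rcases le_total y (1 - x - y) with h3 | h3
  · exact key a c b (ht.trans (triple_swap a b c)) y x (by linarith) (by linarith) (by linarith)
      (by rw [hz]; unfold fr; module)
  · exact key c a b t3 (1 - x - y) x (by linarith) (by linarith) (by linarith)
      (by rw [hz]; unfold fr; module)
  · exact key c b a (t3.trans (triple_swap c a b)) x (1 - x - y) (by linarith) (by linarith)
      (by linarith) (by rw [hz]; unfold fr; module)
  · exact key c b a (t3.trans (triple_swap c a b)) x (1 - x - y) (by linarith) (by linarith)
      (by linarith) (by rw [hz]; unfold fr; module)
  · exact key a b c ht x y (by linarith) (by linarith) (by linarith)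
      (by rw [hz])
  · exact key a b c ht x y (by linarith) (by linarith) (by linarith)
      (by rw [hz])
  · exact key b a c (ht.trans (triple_swap' a b c)) (1 - x - y) y (by linarith) (by linarith)
      (by linarith) (by rw [hz]; unfold fr; module)
  · exact key b c a t2 y (1 - x - y) (by linarith) (by linarith) (by linarith)
      (by rw [hz]; unfold fr; module)

lemma mem_corner_of_vertex {a b c v : Plane} (h : cr (b - a) (c - a) ≠ 0)
    (hv : v ∈ ({a, b, c} : Set Plane)) (hz : v ∈ convexHull ℝ (corner a b c)) : v = a := by
  obtain ⟨x, y, h1, h2, h3, h4⟩ := mem_convexHull_corner.1 hz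
  rcases hv with rfl | rfl | rfl
  · rfl
  · have e : fr a (v - a) (c - a) 1 0 = v := by simp [fr]
    obtain ⟨e1, e2⟩ := fr_injective h (e.trans h4)
    linarith
  · have e : fr a (b - a) (v - a) 0 1 = v := by simp [fr]
    obtain ⟨e1, e2⟩ := fr_injective h (e.trans h4)
    linarith

lemma not_mem_inner_of_vertex {a b c v : Plane} (h : cr (b - a) (c - a) ≠ 0)
    (hv : v ∈ ({a, b, c} : Set Plane)) : v ∉ convexHull ℝ (inner a b c) := by
  intro hz
  obtain ⟨x, y, h1, h2, h3, h4⟩ := mem_convexHull_inner.1 hz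
  rcases hv with rfl | rfl | rfl
  · have e : fr v (b - v) (c - v) 0 0 = v := by simp [fr]
    obtain ⟨e1, e2⟩ := fr_injective h (e.trans h4)
    linarith
  · have e : fr a (v - a) (c - a) 1 0 = v := by simp [fr]
    obtain ⟨e1, e2⟩ := fr_injective h (e.trans h4)
    linarith
  · have e : fr a (b - a) (v - a) 0 1 = v := by simp [fr]
    obtain ⟨e1, e2⟩ := fr_injective h (e.trans h4)
    linarith

/-! ### Triangles and edges of a triangulation -/

section
variable {K : Geometry.SimplicialComplex ℝ Plane}

lemma exists_labels {t : Finset Plane} (ht : t ∈ triangles K) :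
    ∃ a b c, (t : Set Plane) = {a, b, c} := by
  obtain ⟨a, b, c, -, -, -, h⟩ := Finset.card_eq_three.1 ht.2
  exact ⟨a, b, c, by simp [h]⟩

/-- Since `t` has three elements, any labelling of it is free of repetitions, and the affine
independence of the simplex becomes linear independence of the two edge vectors. -/
lemma cr_ne_zero {t : Finset Plane} (ht : t ∈ triangles K) {a b c : Plane}
    (h : (t : Set Plane) = {a, b, c}) : cr (b - a) (c - a) ≠ 0 := by
  have hind := K.indep ht.1
  have hcard := ht.2
  have ht' : t = {a, b, c} := by rw [← Finset.coe_inj]; simpa using h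
  have hab : a ≠ b := by
    rintro rfl
    rw [ht'] at hcard
    simp only [Finset.insert_idem] at hcard
    exact absurd hcard (by have := Finset.card_le_two (a := a) (b := c); omega)
  have hac : a ≠ c := by
    rintro rfl
    rw [ht', Finset.insert_eq_of_mem (by simp)] at hcard
    exact absurd hcard (by have := Finset.card_le_two (a := b) (b := a); omega)
  have hbc : b ≠ c := by
    rintro rfl
    rw [ht'] at hcard
    simp only [Finset.pair_eq_singleton] at hcard
    exact absurd hcard (by have := Finset.card_le_two (a := a) (b := b); omega)
  have hmem : ∀ i, ![a, b, c] i ∈ t := by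
    intro i; rw [ht']; fin_cases i <;> simp
  have hinj : Function.Injective (fun i => (⟨![a, b, c] i, hmem i⟩ : t)) := by
    intro i j hij
    simp only [Subtype.mk.injEq] at hij
    fin_cases i <;> fin_cases j <;> simp_all
  have h3 : AffineIndependent ℝ ![a, b, c] :=
    hind.comp_embedding ⟨_, hinj⟩
  rw [affineIndependent_iff_linearIndependent_vsub ℝ _ (0 : Fin 3)] at h3
  have h4 := h3.comp (fun i : Fin 2 => (⟨i.succ, Fin.succ_ne_zero i⟩ : {x : Fin 3 // x ≠ 0}))
    (fun i j hij => by simpa using hij)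
  rw [← linearIndependent_iff_cr]
  have e : ![b - a, c - a] = (fun i : {x : Fin 3 // x ≠ 0} => ![a, b, c] i -ᵥ ![a, b, c] 0) ∘
      fun i : Fin 2 => ⟨i.succ, Fin.succ_ne_zero i⟩ := by
    funext i
    fin_cases i <;> simp
  rw [e]
  exact h4

lemma exists_triangle_of_edge (hK : IsTriangulation K) {e : Finset Plane} (he : e ∈ edges K) :
    ∃ t ∈ triangles K, ∃ a b c, (t : Set Plane) = {a, b, c} ∧ (e : Set Plane) = {a, b} := by
  obtain ⟨t, ht, hst, hc⟩ := hK.pure e he.1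
  obtain ⟨a, b, hab, rfl⟩ := Finset.card_eq_two.1 he.2
  obtain ⟨c, hc', h⟩ : ∃ c, c ∉ ({a, b} : Finset Plane) ∧ insert c {a, b} = t :=
    Finset.exists_eq_insert_iff.2 ⟨hst, by rw [he.2, hc]⟩ |>.imp fun c hc => by simpa using hc
  refine ⟨t, ⟨ht, hc⟩, a, b, c, ?_, by simp⟩
  rw [← h]
  ext; simp; tauto

lemma exists_triangle_of_vertex (hK : IsTriangulation K) {v : Plane} (hv : v ∈ K.vertices) :
    ∃ t ∈ triangles K, ∃ b c, (t : Set Plane) = {v, b, c} := by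
  obtain ⟨t, ht, hst, hc⟩ := hK.pure _ hv
  have hvt : v ∈ t := by simpa using hst
  obtain ⟨a, b, c, h⟩ := exists_labels (K := K) ⟨ht, hc⟩
  have : v ∈ ({a, b, c} : Set Plane) := by rw [← h]; exact hvt
  rcases this with rfl | rfl | rfl
  · exact ⟨t, ⟨ht, hc⟩, b, c, h⟩
  · exact ⟨t, ⟨ht, hc⟩, c, a, h.trans (triple_rot _ _ _)⟩
  · exact ⟨t, ⟨ht, hc⟩, a, b, h.trans ((triple_rot _ _ _).trans (triple_rot _ _ _))⟩

lemma mem_vertices_of_mem {t : Finset Plane} (ht : t ∈ triangles K) {v : Plane} (hv : v ∈ t) :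
    v ∈ K.vertices :=
  K.down_closed ht.1 (by simpa using hv) (by simp)

lemma mem_edges_of_mem {t : Finset Plane} (ht : t ∈ triangles K) {a b c : Plane}
    (h : (t : Set Plane) = {a, b, c}) : ({a, b} : Finset Plane) ∈ edges K := by
  have hcr := cr_ne_zero ht h
  have hab : a ≠ b := by rintro rfl; simp [cr] at hcr
  refine ⟨K.down_closed ht.1 ?_ (by simp), Finset.card_pair hab⟩
  rw [← Finset.coe_subset, h]
  intro z; simp; tauto

lemma space_eq (hK : IsTriangulation K) : K.space = ⋃ t ∈ triangles K, convexHull ℝ (t : Set Plane) := by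
  ext z
  simp only [Geometry.SimplicialComplex.mem_space_iff, Set.mem_iUnion]
  constructor
  · rintro ⟨s, hs, hz⟩
    obtain ⟨t, ht, hst, hc⟩ := hK.pure s hs
    exact ⟨t, ⟨ht, hc⟩, convexHull_mono (by exact_mod_cast hst) hz⟩
  · rintro ⟨t, ht, hz⟩
    exact ⟨t, ht.1, hz⟩

lemma convexHull_subset_space {t : Finset Plane} (ht : t ∈ triangles K) :
    convexHull ℝ (t : Set Plane) ⊆ K.space := K.convexHull_subset_space ht.1

lemma convexHull_cell_subset {t : Set Plane} {τ : Set Plane} (hτ : τ ∈ split12 t) :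
    convexHull ℝ τ ⊆ convexHull ℝ t := by
  obtain ⟨a, b, c, rfl, rfl | rfl⟩ := mem_split12.1 hτ
  · exact convexHull_corner_subset a b c
  · exact convexHull_inner_subset a b c

lemma interior_cell_nonempty {t : Finset Plane} (ht : t ∈ triangles K) {τ : Set Plane}
    (hτ : τ ∈ split12 (t : Set Plane)) : (interior (convexHull ℝ τ)).Nonempty := by
  obtain ⟨a, b, c, h, rfl | rfl⟩ := mem_split12.1 hτ
  · exact interior_corner_nonempty (cr_ne_zero ht h)
  · exact interior_inner_nonempty (cr_ne_zero ht h)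

lemma space_eq_cells (hK : IsTriangulation K) : K.space = ⋃ τ ∈ refine12 K, convexHull ℝ τ := by
  ext z
  simp only [space_eq hK, refine12, Set.mem_iUnion]
  constructor
  · rintro ⟨t, ht, hz⟩
    obtain ⟨a, b, c, h⟩ := exists_labels ht
    obtain ⟨a, b, c, h, h' | h'⟩ := exists_cell_of_mem h hz
    · exact ⟨_, ⟨t, ht, mem_split12.2 ⟨a, b, c, h, Or.inl rfl⟩⟩, h'⟩
    · exact ⟨_, ⟨t, ht, mem_split12.2 ⟨a, b, c, h, Or.inr rfl⟩⟩, h'⟩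
  · rintro ⟨τ, ⟨t, ht, hτ⟩, hz⟩
    exact ⟨t, ht, convexHull_cell_subset hτ hz⟩

lemma finite_refine12 (hK : IsTriangulation K) : (refine12 K).Finite := by
  refine Set.Finite.biUnion (hK.finite.subset fun t ht => ht.1) fun t _ => ?_
  have hf : ((t : Set Plane) ×ˢ (t : Set Plane) ×ˢ (t : Set Plane)).Finite :=
    t.finite_toSet.prod (t.finite_toSet.prod t.finite_toSet)
  refine ((hf.image fun x => corner x.1 x.2.1 x.2.2).union
    (hf.image fun x => inner x.1 x.2.1 x.2.2)).subset ?_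
  intro τ hτ
  obtain ⟨a, b, c, h, h'⟩ := mem_split12.1 hτ
  have hm : (a, b, c) ∈ (t : Set Plane) ×ˢ (t : Set Plane) ×ˢ (t : Set Plane) := by
    rw [h]; simp
  rcases h' with rfl | rfl
  · exact Or.inl ⟨_, hm, rfl⟩
  · exact Or.inr ⟨_, hm, rfl⟩

/-- A vertex of the triangulation lying in a triangle of the split is a vertex of it. -/
lemma vertex_mem_cell {τ : Set Plane} (hτ : τ ∈ refine12 K) {v : Plane} (hv : v ∈ K.vertices)
    (hz : v ∈ convexHull ℝ τ) : v ∈ τ := by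
  simp only [refine12, Set.mem_iUnion] at hτ
  obtain ⟨t, ht, hτ⟩ := hτ
  have hvt : v ∈ (t : Set Plane) :=
    (K.vertex_mem_convexHull_iff hv ht.1).1 (convexHull_cell_subset hτ hz)
  obtain ⟨a, b, c, h, rfl | rfl⟩ := mem_split12.1 hτ
  · rw [h] at hvt
    rw [mem_corner_of_vertex (cr_ne_zero ht h) hvt hz]
    simp [corner]
  · rw [h] at hvt
    exact absurd hz (not_mem_inner_of_vertex (cr_ne_zero ht h) hvt)

end

/-! ### Derivatives of splines within the region -/

/-- On the interior of `T` the two derivatives agree trivially. Both are continuous on `T`, and a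
convex set with nonempty interior lies in the closure of that interior, so the equality extends to
boundary points, where several pieces may meet. -/
lemma iteratedFDerivWithin_eq_of_eqOn {Ω T : Set Plane} (hΩ : UniqueDiffOn ℝ Ω) (hTΩ : T ⊆ Ω)
    (hT : Convex ℝ T) (hint : (interior T).Nonempty) {s f : Plane → ℝ} {n : ℕ}
    (hs : ContDiffOn ℝ n s Ω) (hf : ContDiff ℝ (⊤ : ℕ∞) f) (h : Set.EqOn s f T) {k : ℕ} (hk : k ≤ n)
    {z : Plane} (hz : z ∈ T) : iteratedFDerivWithin ℝ k s Ω z = iteratedFDeriv ℝ k f z := by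
  have hE : Set.EqOn (iteratedFDerivWithin ℝ k s Ω) (iteratedFDeriv ℝ k f) (interior T) := by
    intro y hy
    have h1 : Ω =ᶠ[nhds y] (Set.univ : Set Plane) := by
      filter_upwards [isOpen_interior.mem_nhds hy] with w hw
      exact propext ⟨fun _ => trivial, fun _ => hTΩ (interior_subset hw)⟩
    have h2 : s =ᶠ[nhds y] f := by
      filter_upwards [isOpen_interior.mem_nhds hy] with w hw using h (interior_subset hw)
    rw [iteratedFDerivWithin_congr_set h1, iteratedFDerivWithin_univ]
    exact (h2.iteratedFDeriv ℝ k).eq_of_nhds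
  refine hE.of_subset_closure (t := T) ?_ ?_ interior_subset ?_ hz
  · exact (hs.continuousOn_iteratedFDerivWithin (by exact_mod_cast hk) hΩ).mono hTΩ
  · exact (hf.continuous_iteratedFDeriv (by exact_mod_cast le_top)).continuousOn
  · rw [hT.closure_interior_eq_closure_of_nonempty_interior hint]
    exact subset_closure

section
variable {K : Geometry.SimplicialComplex ℝ Plane}

lemma uniqueDiffOn_triangle {t : Finset Plane} (ht : t ∈ triangles K) :
    UniqueDiffOn ℝ (convexHull ℝ (t : Set Plane)) := by
  obtain ⟨a, b, c, h⟩ := exists_labels ht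
  refine uniqueDiffOn_convex (convex_convexHull ℝ _) ?_
  rw [h]
  exact interior_triple_nonempty (cr_ne_zero ht h)

lemma uniqueDiffOn_space (hK : IsTriangulation K) : UniqueDiffOn ℝ K.space := by
  intro z hz
  rw [space_eq hK] at hz
  simp only [Set.mem_iUnion] at hz
  obtain ⟨t, ht, hz⟩ := hz
  exact (uniqueDiffOn_triangle ht z hz).mono (convexHull_subset_space ht)

lemma cell_subset_space {τ : Set Plane} (hτ : τ ∈ refine12 K) : convexHull ℝ τ ⊆ K.space := by
  simp only [refine12, Set.mem_iUnion] at hτ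
  obtain ⟨t, ht, hτ⟩ := hτ
  exact (convexHull_cell_subset hτ).trans (convexHull_subset_space ht)

lemma interior_nonempty_of_mem {τ : Set Plane} (hτ : τ ∈ refine12 K) :
    (interior (convexHull ℝ τ)).Nonempty := by
  simp only [refine12, Set.mem_iUnion] at hτ
  obtain ⟨t, ht, hτ⟩ := hτ
  exact interior_cell_nonempty ht hτ

/-- A function determines the jets of its representing polynomial on a cell with nonempty interior.
The existential choice of polynomials in `SmoothAtVertex` is therefore harmless. -/
lemma jetEq_of_isPiece {τ : Set Plane} (hτ : τ ∈ refine12 K) {s : Plane → ℝ}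
    {p q : MvPolynomial (Fin 2) ℝ} (hp : IsPiece s τ p) (hq : IsPiece s τ q) {z : Plane}
    (hz : z ∈ convexHull ℝ τ) (k : ℕ) : JetEq k p q z := by
  intro m _
  have hu : UniqueDiffOn ℝ (convexHull ℝ τ) :=
    uniqueDiffOn_convex (convex_convexHull ℝ _) (interior_nonempty_of_mem hτ)
  have hs : ContDiffOn ℝ m s (convexHull ℝ τ) := (contDiff_polyFun p m).contDiffOn.congr hp
  rw [← iteratedFDerivWithin_eq_of_eqOn hu subset_rfl (convex_convexHull ℝ _)
    (interior_nonempty_of_mem hτ) hs (contDiff_polyFun p _) hp le_rfl hz,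
    ← iteratedFDerivWithin_eq_of_eqOn hu subset_rfl (convex_convexHull ℝ _)
    (interior_nonempty_of_mem hτ) hs (contDiff_polyFun q _) hq le_rfl hz]

lemma iteratedFDerivWithin_of_le_two (hK : IsTriangulation K) {s : Plane → ℝ}
    (hs : s ∈ superSplineSpace K) {τ : Set Plane} (hτ : τ ∈ refine12 K)
    {p : MvPolynomial (Fin 2) ℝ} (hp : IsPiece s τ p) {z : Plane} (hz : z ∈ convexHull ℝ τ) {k : ℕ}
    (hk : k ≤ 2) : iteratedFDerivWithin ℝ k s K.space z = iteratedFDeriv ℝ k (polyFun p) z :=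
  iteratedFDerivWithin_eq_of_eqOn (uniqueDiffOn_space hK) (cell_subset_space hτ)
    (convex_convexHull ℝ _) (interior_nonempty_of_mem hτ) hs.1.2.1 (contDiff_polyFun p _) hp hk hz

lemma hasFDerivWithinAt_biUnion {E F : Type*} [NormedAddCommGroup E] [NormedSpace ℝ E]
    [NormedAddCommGroup F] [NormedSpace ℝ F] {ι : Type*} {I : Set ι} (hI : I.Finite) {f : E → F}
    {f' : E →L[ℝ] F} {T : ι → Set E} {x : E} (h : ∀ i ∈ I, HasFDerivWithinAt f f' (T i) x) :
    HasFDerivWithinAt f f' (⋃ i ∈ I, T i) x := by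
  induction I, hI using Set.Finite.induction_on with
  | empty => simp [HasFDerivWithinAt.of_notMem_closure]
  | insert _ _ ih =>
    rw [Set.biUnion_insert]
    exact (h _ (Set.mem_insert _ _)).union (ih fun i hi => h i (Set.mem_insert_of_mem _ hi))

lemma isClosed_cell {τ : Set Plane} (hτ : τ ∈ refine12 K) : IsClosed (convexHull ℝ τ) := by
  simp only [refine12, Set.mem_iUnion] at hτ
  obtain ⟨t, ht, hτ⟩ := hτ
  obtain ⟨a, b, c, h, rfl | rfl⟩ := mem_split12.1 hτ
  · exact (Set.Finite.isCompact_convexHull ℝ (by simp [corner])).isClosed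
  · exact (Set.Finite.isCompact_convexHull ℝ (by simp [inner])).isClosed

lemma exists_piece {s : Plane → ℝ} (hs : s ∈ superSplineSpace K) {τ : Set Plane}
    (hτ : τ ∈ refine12 K) : ∃ p : MvPolynomial (Fin 2) ℝ, p.totalDegree ≤ 5 ∧ IsPiece s τ p :=
  hs.1.2.2 τ hτ

lemma jetEq_at_vertex {s : Plane → ℝ} (hs : s ∈ superSplineSpace K) {v : Plane}
    (hv : v ∈ K.vertices) {τ τ' : Set Plane} (hτ : τ ∈ refine12 K) (hτ' : τ' ∈ refine12 K)
    (hvτ : v ∈ τ) (hvτ' : v ∈ τ') {p q : MvPolynomial (Fin 2) ℝ} (hp : IsPiece s τ p)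
    (hq : IsPiece s τ' q) : JetEq 3 p q v := by
  obtain ⟨p', q', hp', hq', h⟩ := hs.2.2 v hv τ hτ τ' hτ' hvτ hvτ'
  intro m hm
  rw [jetEq_of_isPiece hτ hp hp' (subset_convexHull ℝ _ hvτ) 3 m hm,
    jetEq_of_isPiece hτ' hq hq' (subset_convexHull ℝ _ hvτ') 3 m hm, h m hm]

/-- At a vertex the derivatives of a spline up to order three, taken within the region, are those
of any of its pieces. -/
lemma iteratedFDerivWithin_vertex (hK : IsTriangulation K) {s : Plane → ℝ}
    (hs : s ∈ superSplineSpace K) {τ : Set Plane} (hτ : τ ∈ refine12 K)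
    {p : MvPolynomial (Fin 2) ℝ} (hp : IsPiece s τ p) {v : Plane} (hv : v ∈ K.vertices)
    (hvτ : v ∈ τ) {k : ℕ} (hk : k ≤ 3) :
    iteratedFDerivWithin ℝ k s K.space v = iteratedFDeriv ℝ k (polyFun p) v := by
  have hvz := subset_convexHull ℝ _ hvτ
  rcases Nat.lt_or_eq_of_le hk with hk | rfl
  · exact iteratedFDerivWithin_of_le_two hK hs hτ hp hvz (by omega)
  -- A spline is only `C²` on the region, so order three needs an argument special to vertices. On
  -- each cell containing `v` the second derivative coincides with that of a polynomial, and these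
  -- polynomials share their third derivative at `v`. The finitely many one-cell derivatives combine
  -- over the union; cells away from `v` do not matter because they are closed.
  have key : HasFDerivWithinAt (iteratedFDerivWithin ℝ 2 s K.space)
      (fderiv ℝ (iteratedFDeriv ℝ 2 (polyFun p)) v) K.space v := by
    nth_rw 2 [space_eq_cells hK]
    refine hasFDerivWithinAt_biUnion (finite_refine12 hK) fun τ' hτ' => ?_
    by_cases hvτ' : v ∈ convexHull ℝ τ'
    · obtain ⟨q, -, hq⟩ := exists_piece hs hτ'
      have e : fderiv ℝ (iteratedFDeriv ℝ 2 (polyFun p)) v =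
          fderiv ℝ (iteratedFDeriv ℝ 2 (polyFun q)) v := by
        rw [fderiv_iteratedFDeriv, fderiv_iteratedFDeriv, Function.comp, Function.comp]
        rw [jetEq_at_vertex hs hv hτ hτ' hvτ (vertex_mem_cell hτ' hv hvτ') hp hq 3 le_rfl]
      rw [e]
      have hd : Differentiable ℝ (iteratedFDeriv ℝ 2 (polyFun q)) :=
        (contDiff_polyFun q 3).differentiable_iteratedFDeriv (by norm_num)
      refine (hd v).hasFDerivAt.hasFDerivWithinAt.congr (fun z hz => ?_) ?_
      · exact iteratedFDerivWithin_of_le_two hK hs hτ' hq hz le_rfl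
      · exact iteratedFDerivWithin_of_le_two hK hs hτ' hq hvτ' le_rfl
    · refine .of_notMem_closure ?_
      rwa [(isClosed_cell hτ').closure_eq]
  ext m
  rw [iteratedFDerivWithin_succ_apply_left, iteratedFDeriv_succ_apply_left,
    key.fderivWithin (uniqueDiffOn_space hK v (cell_subset_space hτ hvz))]

/-- The pieces of a function which is `C³` on a triangle join with contact of order three. -/
lemma isSplitPieces {t : Finset Plane} (ht : t ∈ triangles K) {s : Plane → ℝ}
    (hs : ContDiffOn ℝ 3 s (convexHull ℝ (t : Set Plane)))
    {C I : Plane → Plane → Plane → MvPolynomial (Fin 2) ℝ}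
    (hC : ∀ a b c, (t : Set Plane) = {a, b, c} →
      (C a b c).totalDegree ≤ 5 ∧ IsPiece s (corner a b c) (C a b c))
    (hI : ∀ a b c, (t : Set Plane) = {a, b, c} →
      (I a b c).totalDegree ≤ 5 ∧ IsPiece s (inner a b c) (I a b c)) :
    IsSplitPieces t C I := by
  have jetC : ∀ a b c, (t : Set Plane) = {a, b, c} → ∀ z ∈ convexHull ℝ (corner a b c), ∀ k ≤ 3,
      iteratedFDerivWithin ℝ k s (convexHull ℝ (t : Set Plane)) z =
        iteratedFDeriv ℝ k (polyFun (C a b c)) z := fun a b c h z hz k hk =>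
    iteratedFDerivWithin_eq_of_eqOn (uniqueDiffOn_triangle ht)
      (h ▸ convexHull_corner_subset a b c) (convex_convexHull ℝ _)
      (interior_corner_nonempty (cr_ne_zero ht h)) (by exact_mod_cast hs) (contDiff_polyFun _ _)
      (hC a b c h).2 hk hz
  have jetI : ∀ a b c, (t : Set Plane) = {a, b, c} → ∀ z ∈ convexHull ℝ (inner a b c), ∀ k ≤ 3,
      iteratedFDerivWithin ℝ k s (convexHull ℝ (t : Set Plane)) z =
        iteratedFDeriv ℝ k (polyFun (I a b c)) z := fun a b c h z hz k hk =>
    iteratedFDerivWithin_eq_of_eqOn (uniqueDiffOn_triangle ht)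
      (h ▸ convexHull_inner_subset a b c) (convex_convexHull ℝ _)
      (interior_inner_nonempty (cr_ne_zero ht h)) (by exact_mod_cast hs) (contDiff_polyFun _ _)
      (hI a b c h).2 hk hz
  -- Both cells adjacent to an interior segment contain it, so their jets there equal the derivative
  -- of `s` within the macrotriangle, and hence each other.
  have seg : ∀ {z z' w : Plane} {τ : Set Plane}, w ∈ segment ℝ z z' → z ∈ τ → z' ∈ τ →
      w ∈ convexHull ℝ τ := fun hw h h' => segment_subset_convexHull h h' hw
  have mid_comm : ∀ a b, mid b a = mid a b := fun a b => by unfold mid; module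
  have cen_comm' : ∀ a b c, cen b a c = cen a b c := fun a b c => by unfold cen; module
  refine ⟨fun a b c h => (hC a b c h).1, fun a b c h => (hI a b c h).1, ?_, ?_, ?_, ?_⟩
  · intro a b c h z hz k hk
    rw [← jetC a b c h z (seg hz (by simp [corner]) (by simp [corner])) k hk,
      ← jetC a c b (h.trans (triple_swap a b c)) z
        (seg hz (by simp [corner]) (by simp [corner, quar_comm])) k hk]
  · intro a b c h z hz k hk
    rw [← jetC a b c h z (seg hz (by simp [corner]) (by simp [corner])) k hk,
      ← jetI a b c h z (seg hz (by simp [inner]) (by simp [inner])) k hk]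
  · intro a b c h z hz k hk
    rw [← jetI a b c h z (seg hz (by simp [inner]) (by simp [inner])) k hk,
      ← jetI a c b (h.trans (triple_swap a b c)) z
        (seg hz (by simp [inner, quar_comm]) (by simp [inner, cen_comm])) k hk]
  · intro a b c h z hz k hk
    rw [← jetI a b c h z (seg hz (by simp [inner]) (by simp [inner])) k hk,
      ← jetI b a c (h.trans (triple_swap' a b c)) z
        (seg hz (by simp [inner, mid_comm]) (by simp [inner, cen_comm'])) k hk]

end

/-! ### Hermite data on an edge and unisolvence on a triangle -/

lemma edgeMidpoint_pair {a b : Plane} (h : a ≠ b) :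
    edgeMidpoint {a, b} = (1 / 2 : ℝ) • (a + b) := by
  rw [edgeMidpoint, Finset.sum_pair h]

lemma edgeQuarter_pair {a b : Plane} (h : a ≠ b) :
    edgeQuarter {a, b} a = (1 / 4 : ℝ) • ((2 : ℝ) • a + (a + b)) := by
  rw [edgeQuarter, Finset.sum_pair h]

lemma cr_ne_zero_of_not_mem {a b u : Plane} (hab : a ≠ b)
    (hu : u ∉ vectorSpan ℝ (({a, b} : Finset Plane) : Set Plane)) : cr (b - a) u ≠ 0 := by
  intro h
  apply hu
  rw [Finset.coe_pair, Set.pair_comm, mem_vectorSpan_pair]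
  simp only [vsub_eq_sub]
  have hw : b - a ≠ 0 := sub_ne_zero.2 hab.symm
  set w := b - a
  have hpos : w 0 ^ 2 + w 1 ^ 2 ≠ 0 := by
    intro h0
    apply hw
    apply plane_ext <;> simp <;> nlinarith [sq_nonneg (w 0), sq_nonneg (w 1)]
  unfold cr at h
  -- The coefficient of the orthogonal projection of `u` onto `w`; a vector parallel to `w` equals
  -- its projection.
  refine ⟨(w 0 * u 0 + w 1 * u 1) / (w 0 ^ 2 + w 1 ^ 2), ?_⟩
  apply plane_ext <;> simp only [PiLp.smul_apply, smul_eq_mul] <;> field_simp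
  · linear_combination w 1 * h
  · linear_combination - w 0 * h

lemma left_mem_corner (a b c : Plane) : a ∈ convexHull ℝ (corner a b c) :=
  subset_convexHull ℝ _ (by simp [corner])

lemma edgeMidpoint_mem_corner {a b : Plane} (h : a ≠ b) (c : Plane) :
    edgeMidpoint {a, b} ∈ convexHull ℝ (corner a b c) :=
  subset_convexHull ℝ _ (by simp [corner, edgeMidpoint_pair h, mid])

lemma edgeQuarter_mem_corner {a b : Plane} (h : a ≠ b) (c : Plane) :
    edgeQuarter {a, b} a ∈ convexHull ℝ (corner a b c) := by
  rw [mem_convexHull_corner, edgeQuarter_pair h]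
  refine ⟨1 / 4, 0, by norm_num, by norm_num, by norm_num, ?_⟩
  unfold fr; module

/-- The Hermite functionals of `f` attached to the corner `a` and the half edge from `a` towards
`b`. -/
structure CornerData (x y : Plane → Plane) (u : Finset Plane → Plane) (f g : Plane → ℝ)
    (a b : Plane) : Prop where
  vertex : ∀ i j, i + j ≤ 3 → iteratedFDeriv ℝ (i + j) f a
    (Fin.append (fun _ : Fin i => x a) (fun _ : Fin j => y a)) = iteratedFDeriv ℝ (i + j) g a
    (Fin.append (fun _ : Fin i => x a) (fun _ : Fin j => y a))
  midpoint : iteratedFDeriv ℝ 1 f (edgeMidpoint {a, b}) (fun _ => u {a, b}) =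
    iteratedFDeriv ℝ 1 g (edgeMidpoint {a, b}) (fun _ => u {a, b})
  quarter : iteratedFDeriv ℝ 2 f (edgeQuarter {a, b} a) (fun _ => u {a, b}) =
    iteratedFDeriv ℝ 2 g (edgeQuarter {a, b} a) (fun _ => u {a, b})

lemma iteratedFDeriv_polyFun_sub (p q : MvPolynomial (Fin 2) ℝ) (n : ℕ) (z : Plane) :
    iteratedFDeriv ℝ n (polyFun (p - q)) z =
      iteratedFDeriv ℝ n (polyFun p) z - iteratedFDeriv ℝ n (polyFun q) z := by
  have : polyFun (p - q) = polyFun p - polyFun q := by funext z; simp [polyFun]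
  rw [this]
  exact iteratedFDeriv_sub_apply (contDiff_polyFun p n).contDiffAt (contDiff_polyFun q n).contDiffAt

lemma iteratedFDeriv_polyFun_zero (n : ℕ) (z : Plane) :
    iteratedFDeriv ℝ n (polyFun 0) z = 0 := by
  have := iteratedFDeriv_polyFun_sub 0 0 n z
  simpa using this

/-- Pieces with the same Hermite data on an edge: the differences have vanishing data. -/
lemma edgeZero_sub {x y : Plane → Plane} {u : Finset Plane → Plane} {a b : Plane} (hab : a ≠ b)
    {p q p' q' : MvPolynomial (Fin 2) ℝ} (hp : p.totalDegree ≤ 5) (hq : q.totalDegree ≤ 5)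
    (hp' : p'.totalDegree ≤ 5) (hq' : q'.totalDegree ≤ 5)
    (ha : cr (x a) (y a) ≠ 0) (hb : cr (x b) (y b) ≠ 0)
    (h : CornerData x y u (polyFun p) (polyFun p') a b)
    (h' : CornerData x y u (polyFun q) (polyFun q') b a)
    (hm : JetEq 3 p q ((1 / 2 : ℝ) • (a + b))) (hm' : JetEq 3 p' q' ((1 / 2 : ℝ) • (a + b))) :
    EdgeZero (p - p') (q - q') a b (u {a, b}) := by
  have jet : ∀ {p q : MvPolynomial (Fin 2) ℝ} {z : Plane}, JetEq 3 p q z → JetEq 3 (p - q) 0 z := by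
    intro p q z h k hk
    rw [iteratedFDeriv_polyFun_sub, h k hk, sub_self, iteratedFDeriv_polyFun_zero]
  refine ⟨jet (jetEq_of_append hp hp' ha h.vertex), jet (jetEq_of_append hq hq' hb h'.vertex),
    fun k hk => ?_, ?_, ?_, ?_⟩
  · rw [iteratedFDeriv_polyFun_sub, iteratedFDeriv_polyFun_sub, hm k hk, hm' k hk]
  · have := h.midpoint
    rw [edgeMidpoint_pair hab] at this
    rw [iteratedFDeriv_polyFun_sub, sub_apply, this, sub_self]
  · have := h.quarter
    rw [edgeQuarter_pair hab] at this
    rw [iteratedFDeriv_polyFun_sub, sub_apply, this, sub_self]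
  · have := h'.quarter
    rw [edgeQuarter_pair hab.symm, Finset.pair_comm b a, add_comm b a] at this
    rw [iteratedFDeriv_polyFun_sub, sub_apply, this, sub_self]

section
variable {K : Geometry.SimplicialComplex ℝ Plane}

lemma ne_of_labels {t : Finset Plane} (ht : t ∈ triangles K) {a b c : Plane}
    (h : (t : Set Plane) = {a, b, c}) : a ≠ b := by
  rintro rfl
  exact cr_ne_zero ht h (by simp [cr])

/-- The corner triangles at `a` and `b` share only the midpoint, so the contact is carried through
the two inner triangles that also have this vertex. -/
lemma IsSplitPieces.jetEq_mid {t : Set Plane} {C I : Plane → Plane → Plane → MvPolynomial (Fin 2) ℝ}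
    (hS : IsSplitPieces t C I) {a b c : Plane} (h : t = {a, b, c}) :
    JetEq 3 (C a b c) (C b a c) ((1 / 2 : ℝ) • (a + b)) := by
  intro k hk
  have h' := h.trans (triple_swap' a b c)
  have e1 := hS.corner_inner a b c h _ (left_mem_segment ℝ _ _) k hk
  have e2 := hS.inner_inner' a b c h _ (left_mem_segment ℝ _ _) k hk
  have e3 := hS.corner_inner b a c h' _ (left_mem_segment ℝ _ _) k hk
  unfold mid at e1 e2 e3
  rw [add_comm b a] at e3
  rw [e1, e2, e3]

/-- A piecewise quintic which is `C³` on a triangle and has vanishing Hermite data vanishes. -/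
theorem eq_zero_of_hermite {x y : Plane → Plane} {u : Finset Plane → Plane}
    (hxy : ∀ v ∈ K.vertices, cr (x v) (y v) ≠ 0)
    (hu : ∀ e ∈ edges K, u e ∉ vectorSpan ℝ (e : Set Plane)) {t : Finset Plane}
    (ht : t ∈ triangles K) {s : Plane → ℝ} (hs : ContDiffOn ℝ 3 s (convexHull ℝ (t : Set Plane)))
    (hpiece : ∀ τ ∈ split12 (t : Set Plane),
      ∃ p : MvPolynomial (Fin 2) ℝ, p.totalDegree ≤ 5 ∧ IsPiece s τ p)
    (hz : ∀ a b c, (t : Set Plane) = {a, b, c} → ∀ p : MvPolynomial (Fin 2) ℝ,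
      IsPiece s (corner a b c) p → CornerData x y u (polyFun p) 0 a b) :
    ∀ z ∈ convexHull ℝ (t : Set Plane), s z = 0 := by
  -- For triples that do not label `t` the polynomial is set to zero, so that the pieces can be
  -- chosen as total functions of the triple.
  have hC : ∀ a b c, ∃ p : MvPolynomial (Fin 2) ℝ, (t : Set Plane) = {a, b, c} →
      p.totalDegree ≤ 5 ∧ IsPiece s (corner a b c) p := by
    intro a b c
    by_cases h : (t : Set Plane) = {a, b, c}
    · exact (hpiece _ (mem_split12.2 ⟨a, b, c, h, Or.inl rfl⟩)).imp fun p hp _ => hp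
    · exact ⟨0, fun h' => absurd h' h⟩
  have hI : ∀ a b c, ∃ p : MvPolynomial (Fin 2) ℝ, (t : Set Plane) = {a, b, c} →
      p.totalDegree ≤ 5 ∧ IsPiece s (inner a b c) p := by
    intro a b c
    by_cases h : (t : Set Plane) = {a, b, c}
    · exact (hpiece _ (mem_split12.2 ⟨a, b, c, h, Or.inr rfl⟩)).imp fun p hp _ => hp
    · exact ⟨0, fun h' => absurd h' h⟩
  choose C hC using hC
  choose I hI using hI
  have hS := isSplitPieces ht hs hC hI
  intro z hz'
  obtain ⟨a, b, c, h⟩ := exists_labels ht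
  obtain ⟨a, b, c, h, hcell⟩ := exists_cell_of_mem h hz'
  have hzero := hS.eq_zero (fun a b c h => ?_) h (cr_ne_zero ht h) z
  · rcases hcell with hcell | hcell
    · rw [(hC a b c h).2 hcell, hzero.1]
    · rw [(hI a b c h).2 hcell, hzero.2]
  · have h' := h.trans (triple_swap' a b c)
    have hab := ne_of_labels ht h
    have hmemv : ∀ w ∈ ({a, b, c} : Set Plane), w ∈ K.vertices := fun w hw =>
      mem_vertices_of_mem ht (by rw [← h] at hw; exact hw)
    refine ⟨u {a, b}, cr_ne_zero_of_not_mem hab (hu _ (mem_edges_of_mem ht h)), ?_⟩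
    have h0 : polyFun 0 = 0 := polyFun_zero
    -- Comparison with the zero pair turns the statement on differences into one on the pieces
    -- themselves.
    have := edgeZero_sub (p' := 0) (q' := 0) hab (hC a b c h).1 (hC b a c h').1 (by simp) (by simp)
      (hxy a (hmemv a (by simp))) (hxy b (hmemv b (by simp)))
      (h0.symm ▸ hz a b c h _ (hC a b c h).2) (h0.symm ▸ hz b a c h' _ (hC b a c h').2)
      (hS.jetEq_mid h) (fun _ _ => rfl)
    simpa using this

end

/-! ### Truncated powers -/

/-- The derivative of the truncated power of exponent `n + 2` is `n + 2` times that of exponent `n +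
1`, which gives the induction. At the breakpoint the derivative is zero, because the function is
bounded by `|r| ^ (n + 2)`. -/
lemma contDiff_max_pow (n : ℕ) : ContDiff ℝ n (fun r : ℝ => max r 0 ^ (n + 1)) := by
  have hd : ∀ n : ℕ, ∀ r : ℝ, HasDerivAt (fun r : ℝ => max r 0 ^ (n + 2))
      ((n + 2 : ℕ) * max r 0 ^ (n + 1)) r := by
    intro n r
    rcases lt_trichotomy r 0 with h | rfl | h
    · rw [max_eq_right h.le]
      simp only [ne_eq, Nat.add_eq_zero_iff, one_ne_zero, and_false, not_false_eq_true, zero_pow,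
        mul_zero]
      refine (hasDerivAt_const r (0 : ℝ)).congr_of_eventuallyEq ?_
      filter_upwards [Iio_mem_nhds h] with w hw
      simp [max_eq_right (Set.mem_Iio.1 hw).le]
    · simp only [max_self, ne_eq, Nat.add_eq_zero_iff, one_ne_zero, and_false, not_false_eq_true,
        zero_pow, mul_zero]
      rw [hasDerivAt_iff_isLittleO]
      simp only [max_self, sub_zero, smul_zero, ne_eq, Nat.add_eq_zero_iff, OfNat.ofNat_ne_zero,
        and_false, not_false_eq_true, zero_pow]
      refine Asymptotics.IsBigO.trans_isLittleO (g := fun w : ℝ => w ^ (n + 2)) ?_ ?_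
      · refine Asymptotics.IsBigO.of_bound 1 (Filter.Eventually.of_forall fun w => ?_)
        rw [one_mul, norm_pow, norm_pow]
        gcongr
        rw [Real.norm_eq_abs, Real.norm_eq_abs, abs_of_nonneg (le_max_right w 0)]
        exact max_le (le_abs_self w) (abs_nonneg w)
      · exact Asymptotics.isLittleO_pow_id (by omega)
    · rw [max_eq_left h.le]
      refine (hasDerivAt_pow (n + 2) r).congr_of_eventuallyEq ?_
      filter_upwards [Ioi_mem_nhds h] with w hw
      simp [max_eq_left (Set.mem_Ioi.1 hw).le]
  induction n with
  | zero =>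
    rw [Nat.cast_zero, contDiff_zero]
    fun_prop
  | succ n ih =>
    rw [Nat.cast_add, Nat.cast_one, contDiff_succ_iff_deriv]
    refine ⟨fun r => (hd n r).differentiableAt, by simp, ?_⟩
    have : deriv (fun r : ℝ => max r 0 ^ (n + 1 + 1)) =
        fun r => ((n + 2 : ℕ) : ℝ) * max r 0 ^ (n + 1) := funext fun r => (hd n r).deriv
    rw [this]
    exact contDiff_const.mul ih

/-! ### Coordinates -/

/-- First coordinate in the frame `(a; b - a, c - a)`. -/
def cX (a b c z : Plane) : ℝ := cr (z - a) (c - a) / cr (b - a) (c - a)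

/-- Second coordinate in the frame `(a; b - a, c - a)`. -/
def cY (a b c z : Plane) : ℝ := cr (b - a) (z - a) / cr (b - a) (c - a)

lemma fr_cX_cY {a b c : Plane} (h : cr (b - a) (c - a) ≠ 0) (z : Plane) :
    fr a (b - a) (c - a) (cX a b c z) (cY a b c z) = z := by
  rw [fr, add_assoc, cX, cY, ← exists_smul_of_cr h (z - a)]; abel

lemma cX_fr {a b c : Plane} (h : cr (b - a) (c - a) ≠ 0) (x y : ℝ) :
    cX a b c (fr a (b - a) (c - a) x y) = x := (fr_injective h (fr_cX_cY h _)).1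

lemma cY_fr {a b c : Plane} (h : cr (b - a) (c - a) ≠ 0) (x y : ℝ) :
    cY a b c (fr a (b - a) (c - a) x y) = y := (fr_injective h (fr_cX_cY h _)).2

lemma contDiff_cX (a b c : Plane) (n : WithTop ℕ∞) : ContDiff ℝ n (cX a b c) := by
  unfold cX cr; simp only [PiLp.sub_apply]; fun_prop

lemma contDiff_cY (a b c : Plane) (n : WithTop ℕ∞) : ContDiff ℝ n (cY a b c) := by
  unfold cY cr; simp only [PiLp.sub_apply]; fun_prop

lemma exists_affine_poly (α β γ : ℝ) : ∃ p : MvPolynomial (Fin 2) ℝ, p.totalDegree ≤ 1 ∧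
    ∀ z, polyFun p z = α + β * z 0 + γ * z 1 := by
  refine ⟨.C α + β • .X 0 + γ • .X 1, ?_, fun z => by simp [polyFun, MvPolynomial.smul_eval]⟩
  refine (MvPolynomial.totalDegree_add _ _).trans (max_le ((MvPolynomial.totalDegree_add _ _).trans
    (max_le ?_ ?_)) ?_)
  · simp
  · exact (MvPolynomial.totalDegree_smul_le _ _).trans (by simp)
  · exact (MvPolynomial.totalDegree_smul_le _ _).trans (by simp)

/-- A polynomial in the frame coordinates is a polynomial of the same degree. -/
lemma exists_comp_coords (a b c : Plane) (q : MvPolynomial (Fin 2) ℝ) :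
    ∃ p : MvPolynomial (Fin 2) ℝ, p.totalDegree ≤ q.totalDegree ∧
      ∀ z, polyFun p z = polyFun q !₂[cX a b c z, cY a b c z] := by
  obtain ⟨f, hf, hf'⟩ := exists_affine_poly
    ((- a 0 * (c - a) 1 + a 1 * (c - a) 0) / cr (b - a) (c - a))
    ((c - a) 1 / cr (b - a) (c - a)) (- (c - a) 0 / cr (b - a) (c - a))
  obtain ⟨g, hg, hg'⟩ := exists_affine_poly
    ((- (b - a) 0 * a 1 + (b - a) 1 * a 0) / cr (b - a) (c - a))
    (- (b - a) 1 / cr (b - a) (c - a)) ((b - a) 0 / cr (b - a) (c - a))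
  refine ⟨MvPolynomial.aeval ![f, g] q, totalDegree_aeval_le _ (fun i => ?_) q, fun z => ?_⟩
  · fin_cases i
    · exact hf
    · exact hg
  · rw [polyFun_aeval]
    congr 1
    ext i
    fin_cases i
    · simp only [Fin.zero_eta, Matrix.cons_val_zero, hf', cX]
      rw [show cr (z - a) (c - a) = - a 0 * (c - a) 1 + a 1 * (c - a) 0 + (c - a) 1 * z 0
        - (c - a) 0 * z 1 by simp only [cr, PiLp.sub_apply]; ring]
      ring
    · simp only [Fin.mk_one, Matrix.cons_val_one, hg', cY, Matrix.cons_val_fin_one]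
      rw [show cr (b - a) (z - a) = - (b - a) 0 * a 1 + (b - a) 1 * a 0 - (b - a) 1 * z 0
        + (b - a) 0 * z 1 by simp only [cr, PiLp.sub_apply]; ring]
      ring

/-! ### The truncated power basis -/

/-- The monomials of degree at most five. -/
abbrev Mono5 : Type := {p : Fin 6 × Fin 6 // (p.1 : ℕ) + p.2 ≤ 5}

/-- Parameters of a `C³` quintic on the 12-split: a polynomial of degree five, and for each of the
six lines of the split a polynomial of degree one. -/
abbrev SplitParam : Type := (Mono5 → ℝ) × (Fin 6 → Fin 3 → ℝ)

/-- The coefficients as a function on all exponents. -/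
def coeffs (θ : Mono5 → ℝ) (i j : ℕ) : ℝ :=
  if h : i + j ≤ 5 then θ ⟨(⟨i, by omega⟩, ⟨j, by omega⟩), h⟩ else 0

lemma deg5_coeffs (θ : Mono5 → ℝ) : Deg5 (coeffs θ) := fun i j h => by
  rw [coeffs, dif_neg (by omega)]

/-- The six lines of the 12-split in barycentric coordinates `(1 - x - y, x, y)`: the three medians
and the three segments joining edge midpoints. -/
def line (k : Fin 6) (x y : ℝ) : ℝ :=
  ![0, 1, 1, 1, -1, -1] k + ![1, -1, -2, -2, 2, 0] k * x + ![-1, -2, -1, -2, 0, 2] k * y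

/-- The polynomial of degree one with coefficients `l`. -/
def affine (l : Fin 3 → ℝ) (x y : ℝ) : ℝ := l 0 + l 1 * x + l 2 * y

/-- The spline with parameters `θ` in coordinates. -/
def truncSpline (θ : SplitParam) (x y : ℝ) : ℝ :=
  quint (coeffs θ.1) x y + ∑ k, max (line k x y) 0 ^ 4 * affine (θ.2 k) x y

/-- The polynomial which agrees with the spline where the lines in `P` are nonnegative and the others
are nonpositive. -/
def truncPiece (θ : SplitParam) (P : Fin 6 → Bool) (x y : ℝ) : ℝ :=
  quint (coeffs θ.1) x y + ∑ k, if P k then line k x y ^ 4 * affine (θ.2 k) x y else 0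

lemma truncSpline_eq_truncPiece (θ : SplitParam) {P : Fin 6 → Bool} {x y : ℝ}
    (h : ∀ k, if P k then 0 ≤ line k x y else line k x y ≤ 0) :
    truncSpline θ x y = truncPiece θ P x y := by
  unfold truncSpline truncPiece
  congr 1
  refine Finset.sum_congr rfl fun k _ => ?_
  have := h k
  split_ifs at this ⊢ with hP
  · rw [max_eq_left this]
  · rw [max_eq_right this]; simp

/-- The linear map sending the parameters to the spline on the plane. -/
def splitMap (a b c : Plane) : SplitParam →ₗ[ℝ] Plane → ℝ where
  toFun θ z := truncSpline θ (cX a b c z) (cY a b c z)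
  map_add' θ θ' := by
    funext z
    have h : coeffs (θ + θ').1 = coeffs θ.1 + coeffs θ'.1 := by
      funext i j; simp only [coeffs, Pi.add_apply, Prod.fst_add]; split_ifs <;> simp
    simp only [truncSpline, affine, h, quint, Pi.add_apply, Prod.snd_add, add_mul,
      mul_add, Finset.sum_add_distrib]
    ring
  map_smul' r θ := by
    funext z
    have h : coeffs (r • θ).1 = r • coeffs θ.1 := by
      funext i j; simp only [coeffs, Pi.smul_apply, Prod.smul_fst]; split_ifs <;> simp
    simp only [truncSpline, affine, h, quint, Pi.smul_apply, Prod.smul_snd, smul_eq_mul,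
      RingHom.id_apply, mul_add, Finset.mul_sum]
    congr 1
    · exact Finset.sum_congr rfl fun i _ => Finset.sum_congr rfl fun j _ => by ring
    · exact Finset.sum_congr rfl fun i _ => by ring

lemma contDiff_splitMap (a b c : Plane) (θ : SplitParam) : ContDiff ℝ 3 (splitMap a b c θ) := by
  have hX := contDiff_cX a b c 3
  have hY := contDiff_cY a b c 3
  have : splitMap a b c θ = fun z => truncSpline θ (cX a b c z) (cY a b c z) := rfl
  rw [this]
  unfold truncSpline quint affine
  refine ContDiff.add (by fun_prop) (ContDiff.sum fun k _ => ContDiff.mul ?_ (by fun_prop))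
  refine (contDiff_max_pow 3).comp (g := fun r : ℝ => max r 0 ^ 4) ?_
  unfold line
  fun_prop

lemma exists_truncPiece_poly (a b c : Plane) (θ : SplitParam) (P : Fin 6 → Bool) :
    ∃ p : MvPolynomial (Fin 2) ℝ, p.totalDegree ≤ 5 ∧
      ∀ z, polyFun p z = truncPiece θ P (cX a b c z) (cY a b c z) := by
  have hline : ∀ k, ∃ p : MvPolynomial (Fin 2) ℝ, p.totalDegree ≤ 1 ∧
      ∀ z, polyFun p z = line k (z 0) (z 1) := fun k => exists_affine_poly _ _ _
  choose L hL hL' using hline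
  have haff : ∀ k, ∃ p : MvPolynomial (Fin 2) ℝ, p.totalDegree ≤ 1 ∧
      ∀ z, polyFun p z = affine (θ.2 k) (z 0) (z 1) := fun k => exists_affine_poly _ _ _
  choose A hA hA' using haff
  let q : MvPolynomial (Fin 2) ℝ :=
    (∑ i ∈ Finset.range 6, ∑ j ∈ Finset.range 6, .C (coeffs θ.1 i j) * .X 0 ^ i * .X 1 ^ j) +
      ∑ k, if P k then L k ^ 4 * A k else 0
  obtain ⟨p, hp, h⟩ := exists_comp_coords a b c q
  refine ⟨p, hp.trans ?_, fun z => ?_⟩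
  · refine (MvPolynomial.totalDegree_add _ _).trans (max_le ?_ ?_)
    · refine MvPolynomial.totalDegree_finsetSum_le fun i _ =>
        MvPolynomial.totalDegree_finsetSum_le fun j _ => ?_
      by_cases hij : i + j ≤ 5
      · refine (MvPolynomial.totalDegree_mul _ _).trans ?_
        have h1 := MvPolynomial.totalDegree_mul (.C (coeffs θ.1 i j)) (.X (0 : Fin 2) ^ i)
        simp only [MvPolynomial.totalDegree_C, MvPolynomial.totalDegree_X_pow] at h1 ⊢
        omega
      · rw [deg5_coeffs θ.1 i j (by omega)]; simp
    · refine MvPolynomial.totalDegree_finsetSum_le fun k _ => ?_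
      split_ifs
      · refine (MvPolynomial.totalDegree_mul _ _).trans ?_
        have h1 := MvPolynomial.totalDegree_pow (L k) 4
        have := hL k
        have := hA k
        omega
      · simp
  · rw [h]
    have hL'' : ∀ k x y, MvPolynomial.eval ![x, y] (L k) = line k x y := fun k x y => by
      exact hL' k !₂[x, y]
    have hA'' : ∀ k x y, MvPolynomial.eval ![x, y] (A k) = affine (θ.2 k) x y := fun k x y => by
      exact hA' k !₂[x, y]
    simp only [polyFun, q, truncPiece, quint, map_add, map_sum, map_mul, map_pow,
      MvPolynomial.eval_C, MvPolynomial.eval_X, Matrix.cons_val_zero, Matrix.cons_val_one]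
    congr 1
    refine Finset.sum_congr rfl fun k _ => ?_
    split_ifs
    · rw [map_mul, map_pow, hL'', hA'']
    · simp

/-! ### Signs of the six lines on the twelve cells -/

/-- On the convex hull of `τ` the lines in `P` are nonnegative and the others are nonpositive. -/
def CellSigns (a b c : Plane) (τ : Set Plane) (P : Fin 6 → Bool) : Prop :=
  ∀ z ∈ convexHull ℝ τ, ∀ k, if P k then 0 ≤ line k (cX a b c z) (cY a b c z)
    else line k (cX a b c z) (cY a b c z) ≤ 0

/-- The inequalities of a cell are simple in the frame of its own labels, so the signs are checked
there; `f` and `g` express the coordinates relative to `a`, `b`, `c` in that frame. -/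
lemma cellSigns_corner {a b c : Plane} (h : cr (b - a) (c - a) ≠ 0) {a' b' c' : Plane}
    (f g : ℝ → ℝ → ℝ) (P : Fin 6 → Bool)
    (hfr : ∀ x y, fr a' (b' - a') (c' - a') x y = fr a (b - a) (c - a) (f x y) (g x y))
    (hP : ∀ x y : ℝ, 0 ≤ y → y ≤ x → x + y ≤ 1 / 2 → ∀ k, if P k then 0 ≤ line k (f x y) (g x y)
      else line k (f x y) (g x y) ≤ 0) : CellSigns a b c (corner a' b' c') P := by
  intro z hz
  obtain ⟨x, y, h1, h2, h3, rfl⟩ := mem_convexHull_corner.1 hz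
  rw [hfr, cX_fr h, cY_fr h]
  exact hP x y h1 h2 h3

lemma cellSigns_inner {a b c : Plane} (h : cr (b - a) (c - a) ≠ 0) {a' b' c' : Plane}
    (f g : ℝ → ℝ → ℝ) (P : Fin 6 → Bool)
    (hfr : ∀ x y, fr a' (b' - a') (c' - a') x y = fr a (b - a) (c - a) (f x y) (g x y))
    (hP : ∀ x y : ℝ, y ≤ x → 2 * x + y ≤ 1 → 1 / 2 ≤ x + y → ∀ k,
      if P k then 0 ≤ line k (f x y) (g x y) else line k (f x y) (g x y) ≤ 0) :
    CellSigns a b c (inner a' b' c') P := by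
  intro z hz
  obtain ⟨x, y, h1, h2, h3, rfl⟩ := mem_convexHull_inner.1 hz
  rw [hfr, cX_fr h, cY_fr h]
  exact hP x y h1 h2 h3

lemma cornerSigns_abc {a b c : Plane} (h : cr (b - a) (c - a) ≠ 0) :
    CellSigns a b c (corner a b c) ![true, true, true, true, false, false] :=
  cellSigns_corner h (fun x y => x) (fun x y => y) _
    (fun x y => by unfold fr; module) fun x y _ _ _ k => by
      fin_cases k <;> simp [line] <;> linarith

lemma cornerSigns_acb {a b c : Plane} (h : cr (b - a) (c - a) ≠ 0) :
    CellSigns a b c (corner a c b) ![false, true, true, true, false, false] :=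
  cellSigns_corner h (fun x y => y) (fun x y => x) _
    (fun x y => by unfold fr; module) fun x y _ _ _ k => by
      fin_cases k <;> simp [line] <;> linarith

lemma cornerSigns_bac {a b c : Plane} (h : cr (b - a) (c - a) ≠ 0) :
    CellSigns a b c (corner b a c) ![true, true, false, false, true, false] :=
  cellSigns_corner h (fun x y => 1 - x - y) (fun x y => y) _
    (fun x y => by unfold fr; module) fun x y _ _ _ k => by
      fin_cases k <;> simp [line] <;> linarith

lemma cornerSigns_bca {a b c : Plane} (h : cr (b - a) (c - a) ≠ 0) :
    CellSigns a b c (corner b c a) ![true, false, false, false, true, false] :=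
  cellSigns_corner h (fun x y => 1 - x - y) (fun x y => x) _
    (fun x y => by unfold fr; module) fun x y _ _ _ k => by
      fin_cases k <;> simp [line] <;> linarith

lemma cornerSigns_cab {a b c : Plane} (h : cr (b - a) (c - a) ≠ 0) :
    CellSigns a b c (corner c a b) ![false, false, true, false, false, true] :=
  cellSigns_corner h (fun x y => y) (fun x y => 1 - x - y) _
    (fun x y => by unfold fr; module) fun x y _ _ _ k => by
      fin_cases k <;> simp [line] <;> linarith

lemma cornerSigns_cba {a b c : Plane} (h : cr (b - a) (c - a) ≠ 0) :
    CellSigns a b c (corner c b a) ![false, false, false, false, false, true] :=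
  cellSigns_corner h (fun x y => x) (fun x y => 1 - x - y) _
    (fun x y => by unfold fr; module) fun x y _ _ _ k => by
      fin_cases k <;> simp [line] <;> linarith

lemma innerSigns_abc {a b c : Plane} (h : cr (b - a) (c - a) ≠ 0) :
    CellSigns a b c (inner a b c) ![true, true, true, false, false, false] :=
  cellSigns_inner h (fun x y => x) (fun x y => y) _
    (fun x y => by unfold fr; module) fun x y _ _ _ k => by
      fin_cases k <;> simp [line] <;> linarith

lemma innerSigns_acb {a b c : Plane} (h : cr (b - a) (c - a) ≠ 0) :
    CellSigns a b c (inner a c b) ![false, true, true, false, false, false] :=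
  cellSigns_inner h (fun x y => y) (fun x y => x) _
    (fun x y => by unfold fr; module) fun x y _ _ _ k => by
      fin_cases k <;> simp [line] <;> linarith

lemma innerSigns_bac {a b c : Plane} (h : cr (b - a) (c - a) ≠ 0) :
    CellSigns a b c (inner b a c) ![true, true, false, false, false, false] :=
  cellSigns_inner h (fun x y => 1 - x - y) (fun x y => y) _
    (fun x y => by unfold fr; module) fun x y _ _ _ k => by
      fin_cases k <;> simp [line] <;> linarith

lemma innerSigns_bca {a b c : Plane} (h : cr (b - a) (c - a) ≠ 0) :
    CellSigns a b c (inner b c a) ![true, false, false, false, false, false] :=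
  cellSigns_inner h (fun x y => 1 - x - y) (fun x y => x) _
    (fun x y => by unfold fr; module) fun x y _ _ _ k => by
      fin_cases k <;> simp [line] <;> linarith

lemma innerSigns_cab {a b c : Plane} (h : cr (b - a) (c - a) ≠ 0) :
    CellSigns a b c (inner c a b) ![false, false, true, false, false, false] :=
  cellSigns_inner h (fun x y => y) (fun x y => 1 - x - y) _
    (fun x y => by unfold fr; module) fun x y _ _ _ k => by
      fin_cases k <;> simp [line] <;> linarith

/-- This is the cell on which every truncated power vanishes and the spline reduces to its
polynomial part. -/
lemma innerSigns_cba {a b c : Plane} (h : cr (b - a) (c - a) ≠ 0) :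
    CellSigns a b c (inner c b a) ![false, false, false, false, false, false] :=
  cellSigns_inner h (fun x y => x) (fun x y => 1 - x - y) _
    (fun x y => by unfold fr; module) fun x y _ _ _ k => by
      fin_cases k <;> simp [line] <;> linarith

lemma labels_cases {a b c a' b' c' : Plane}
    (h' : cr (b' - a') (c' - a') ≠ 0) (e : ({a, b, c} : Set Plane) = {a', b', c'}) :
    (a' = a ∧ b' = b ∧ c' = c) ∨ (a' = a ∧ b' = c ∧ c' = b) ∨ (a' = b ∧ b' = a ∧ c' = c) ∨
    (a' = b ∧ b' = c ∧ c' = a) ∨ (a' = c ∧ b' = a ∧ c' = b) ∨ (a' = c ∧ b' = b ∧ c' = a) := by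
  have ha : a' ∈ ({a, b, c} : Set Plane) := e ▸ by simp
  have hb : b' ∈ ({a, b, c} : Set Plane) := e ▸ by simp
  have hc : c' ∈ ({a, b, c} : Set Plane) := e ▸ by simp
  have n1 : a' ≠ b' := by rintro rfl; simp [cr] at h'
  have n2 : a' ≠ c' := by rintro rfl; simp [cr] at h'
  have n3 : b' ≠ c' := by rintro rfl; exact h' (by simp only [cr]; ring)
  clear h' e
  simp only [Set.mem_insert_iff, Set.mem_singleton_iff] at ha hb hc
  rcases ha with rfl | rfl | rfl <;> rcases hb with rfl | rfl | rfl <;>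
    rcases hc with rfl | rfl | rfl <;> simp_all

/-- The truncated power splines are quintics on the triangles of the split. -/
lemma splitMap_piece {a b c : Plane} (h : cr (b - a) (c - a) ≠ 0) (θ : SplitParam) {τ : Set Plane}
    (hcells : ∀ a' b' c', ({a, b, c} : Set Plane) = {a', b', c'} → cr (b' - a') (c' - a') ≠ 0)
    (hτ : τ ∈ split12 {a, b, c}) :
    ∃ p : MvPolynomial (Fin 2) ℝ, p.totalDegree ≤ 5 ∧ IsPiece (splitMap a b c θ) τ p := by
  have hP : ∃ P, CellSigns a b c τ P := by
    obtain ⟨a', b', c', e, rfl | rfl⟩ := mem_split12.1 hτ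
    · rcases labels_cases (hcells _ _ _ e) e with ⟨rfl, rfl, rfl⟩ | ⟨rfl, rfl, rfl⟩ |
        ⟨rfl, rfl, rfl⟩ | ⟨rfl, rfl, rfl⟩ | ⟨rfl, rfl, rfl⟩ | ⟨rfl, rfl, rfl⟩
      exacts [⟨_, cornerSigns_abc h⟩, ⟨_, cornerSigns_acb h⟩, ⟨_, cornerSigns_bac h⟩,
        ⟨_, cornerSigns_bca h⟩, ⟨_, cornerSigns_cab h⟩, ⟨_, cornerSigns_cba h⟩]
    · rcases labels_cases (hcells _ _ _ e) e with ⟨rfl, rfl, rfl⟩ | ⟨rfl, rfl, rfl⟩ |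
        ⟨rfl, rfl, rfl⟩ | ⟨rfl, rfl, rfl⟩ | ⟨rfl, rfl, rfl⟩ | ⟨rfl, rfl, rfl⟩
      exacts [⟨_, innerSigns_abc h⟩, ⟨_, innerSigns_acb h⟩, ⟨_, innerSigns_bac h⟩,
        ⟨_, innerSigns_bca h⟩, ⟨_, innerSigns_cab h⟩, ⟨_, innerSigns_cba h⟩]
  obtain ⟨P, hP⟩ := hP
  obtain ⟨p, hp, hp'⟩ := exists_truncPiece_poly a b c θ P
  refine ⟨p, hp, fun z hz => ?_⟩
  rw [hp']
  exact truncSpline_eq_truncPiece θ (hP z hz)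

/-! ### Linear independence of the truncated powers -/

lemma polyFun_eq_zero_of_eqOn {p : MvPolynomial (Fin 2) ℝ} {T : Set Plane}
    (hT : (interior T).Nonempty) (h : ∀ z ∈ T, polyFun p z = 0) (z : Plane) : polyFun p z = 0 := by
  obtain ⟨w, hw⟩ := hT
  have ha : AnalyticOnNhd ℝ (polyFun p) Set.univ := fun z _ =>
    -- The exponent `⊤` means analyticity, so the identity theorem applies.
    (contDiff_polyFun p ⊤).contDiffAt.analyticAt
  refine ha.eqOn_zero_of_preconnected_of_eventuallyEq_zero isPreconnected_univ (Set.mem_univ w) ?_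
    (Set.mem_univ z)
  filter_upwards [isOpen_interior.mem_nhds hw] with v hv using h v (interior_subset hv)

/-- On a single cell the spline is the polynomial selected by the signs, and a polynomial that
vanishes on a cell vanishes on the whole plane. The identity may therefore be used outside the cell.
-/
lemma truncPiece_eq_zero {a b c : Plane} (h : cr (b - a) (c - a) ≠ 0) {θ : SplitParam}
    {τ : Set Plane} {P : Fin 6 → Bool} (hP : CellSigns a b c τ P)
    (hτ : (interior (convexHull ℝ τ)).Nonempty)
    (hz : ∀ z ∈ convexHull ℝ τ, splitMap a b c θ z = 0) (x y : ℝ) : truncPiece θ P x y = 0 := by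
  obtain ⟨p, hp, hp'⟩ := exists_truncPiece_poly a b c θ P
  have := polyFun_eq_zero_of_eqOn (p := p) hτ (fun z hzτ => by
    rw [hp', ← hz z hzτ]
    exact (truncSpline_eq_truncPiece θ (hP z hzτ)).symm) (fr a (b - a) (c - a) x y)
  rwa [hp', cX_fr h, cY_fr h] at this

lemma affine_eq_zero {l : Fin 3 → ℝ} (k : Fin 6)
    (h : ∀ x y : ℝ, line k x y ^ 4 * affine l x y = 0) : l = 0 := by
  -- The points (2, 3), (3, 2), (2, 4) lie on none of the six lines and are not collinear, so they
  -- determine the affine factor.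
  have h1 := h 2 3
  have h2 := h 3 2
  have h3 := h 2 4
  have e : affine l 2 3 = 0 ∧ affine l 3 2 = 0 ∧ affine l 2 4 = 0 := by
    refine ⟨(mul_eq_zero.1 h1).resolve_left ?_, (mul_eq_zero.1 h2).resolve_left ?_,
      (mul_eq_zero.1 h3).resolve_left ?_⟩ <;> clear h h1 h2 h3 <;> fin_cases k <;>
      norm_num [line]
  obtain ⟨e1, e2, e3⟩ := e
  unfold affine at e1 e2 e3
  funext i
  fin_cases i <;> simp <;> linarith

lemma coeffs_eq_zero {θ : Mono5 → ℝ} (h : ∀ x y, quint (coeffs θ) x y = 0) : θ = 0 := by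
  have h1 : ∀ (d : ℕ → ℝ), (∀ x : ℝ, ∑ i ∈ Finset.range 6, d i * x ^ i = 0) →
      ∀ i, i < 6 → d i = 0 := by
    intro d hd
    obtain ⟨e0, e1, e2, e3, e4, e5⟩ := six_coeffs (c₀ := d 0) (c₁ := d 1) (c₂ := d 2) (c₃ := d 3)
      (c₄ := d 4) (c₅ := d 5) (fun x => by simpa [Finset.sum_range_succ] using hd x)
    intro i hi
    interval_cases i <;> assumption
  funext ⟨⟨i, j⟩, hij⟩
  have h2 : ∀ x : ℝ, ∑ i ∈ Finset.range 6, coeffs θ i j * x ^ i = 0 := fun x => by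
    refine h1 (fun j => ∑ i ∈ Finset.range 6, coeffs θ i j * x ^ i) (fun y => ?_) j j.2
    rw [← h x y, quint, Finset.sum_comm]
    exact Finset.sum_congr rfl fun j _ => by rw [Finset.sum_mul]
  have := h1 _ h2 i i.2
  rwa [coeffs, dif_pos hij] at this

/-- Subtracting the polynomials of two cells separated by one line isolates the truncated power of
that line. Five lines are removed in this way; the polynomial part then vanishes, and the last line
is read off from a corner cell at `c`. -/
lemma splitMap_eq_zero {a b c : Plane} (h : cr (b - a) (c - a) ≠ 0) {θ : SplitParam}
    (hz : ∀ z ∈ convexHull ℝ {a, b, c}, splitMap a b c θ z = 0) : θ = 0 := by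
  have h1 : cr (c - a) (b - a) ≠ 0 := by
    rw [show cr (c - a) (b - a) = - cr (b - a) (c - a) by simp only [cr]; ring]
    exact neg_ne_zero.2 h
  have h2 : cr (a - b) (c - b) ≠ 0 := by
    rw [show cr (a - b) (c - b) = - cr (b - a) (c - a) by simp only [cr, PiLp.sub_apply]; ring]
    exact neg_ne_zero.2 h
  have h3 : cr (c - b) (a - b) ≠ 0 := by
    rwa [show cr (c - b) (a - b) = cr (b - a) (c - a) by simp only [cr, PiLp.sub_apply]; ring]
  have h4 : cr (a - c) (b - c) ≠ 0 := by
    rwa [show cr (a - c) (b - c) = cr (b - a) (c - a) by simp only [cr, PiLp.sub_apply]; ring]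
  have s1 := triple_swap a b c
  have s2 := triple_swap' a b c
  have s3 := triple_rot a b c
  have s4 := s3.trans (triple_rot b c a)
  have e1 := truncPiece_eq_zero h (innerSigns_abc h) (interior_inner_nonempty h)
    fun z hzτ => hz z (convexHull_inner_subset _ _ _ hzτ)
  have e2 := truncPiece_eq_zero h (innerSigns_acb h) (interior_inner_nonempty h1)
    fun z hzτ => hz z (s1 ▸ convexHull_inner_subset _ _ _ hzτ)
  have e3 := truncPiece_eq_zero h (innerSigns_bac h) (interior_inner_nonempty h2)
    fun z hzτ => hz z (s2 ▸ convexHull_inner_subset _ _ _ hzτ)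
  have e4 := truncPiece_eq_zero h (innerSigns_bca h) (interior_inner_nonempty h3)
    fun z hzτ => hz z (s3 ▸ convexHull_inner_subset _ _ _ hzτ)
  have e5 := truncPiece_eq_zero h (cornerSigns_abc h) (interior_corner_nonempty h)
    fun z hzτ => hz z (convexHull_corner_subset _ _ _ hzτ)
  have e6 := truncPiece_eq_zero h (cornerSigns_bac h) (interior_corner_nonempty h2)
    fun z hzτ => hz z (s2 ▸ convexHull_corner_subset _ _ _ hzτ)
  have e7 := truncPiece_eq_zero h (cornerSigns_cab h) (interior_corner_nonempty h4)
    fun z hzτ => hz z (s4 ▸ convexHull_corner_subset _ _ _ hzτ)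
  simp only [truncPiece, Fin.sum_univ_six] at e1 e2 e3 e4 e5 e6 e7
  simp at e1 e2 e3 e4 e5 e6 e7
  have z0 : θ.2 0 = 0 := affine_eq_zero 0 fun x y => by linear_combination e1 x y - e2 x y
  have z2 : θ.2 2 = 0 := affine_eq_zero 2 fun x y => by linear_combination e1 x y - e3 x y
  have z1 : θ.2 1 = 0 := affine_eq_zero 1 fun x y => by linear_combination e3 x y - e4 x y
  have z3 : θ.2 3 = 0 := affine_eq_zero 3 fun x y => by linear_combination e5 x y - e1 x y
  have z4 : θ.2 4 = 0 := affine_eq_zero 4 fun x y => by linear_combination e6 x y - e3 x y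
  have hq : ∀ x y, quint (coeffs θ.1) x y = 0 := fun x y => by
    simpa [z0, z1, z2, affine] using e1 x y
  have z5 : θ.2 5 = 0 := affine_eq_zero 5 fun x y => by
    simpa [z2, affine, hq x y] using e7 x y
  refine Prod.ext (coeffs_eq_zero hq) (funext fun k => ?_)
  fin_cases k <;> assumption

/-! ### Hermite interpolation on one triangle -/

/-- The exponents `(i, j)` with `i + j ≤ 3`. -/
abbrev Exp3 : Type := {p : Fin 4 × Fin 4 // (p.1 : ℕ) + p.2 ≤ 3}

/-- The 39 Hermite functionals of a triangle: three-jets at the vertices, cross derivatives at the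
midpoints and second cross derivatives at the quarterpoints of the edges. -/
abbrev TriIndex : Type := (Fin 3 × Exp3) ⊕ Fin 3 ⊕ (Fin 3 × Bool)

lemma card_exp3 : Fintype.card Exp3 = 10 := by decide

lemma card_mono5 : Fintype.card Mono5 = 21 := by decide

lemma card_triIndex : Fintype.card TriIndex = 39 := by
  simp only [Fintype.card_sum, Fintype.card_prod, Fintype.card_fin, card_exp3, Fintype.card_bool]

lemma finrank_splitParam : Module.finrank ℝ SplitParam = 39 := by
  rw [Module.finrank_prod, Module.finrank_fintype_fun_eq_card, card_mono5, Module.finrank_pi_fintype]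
  simp

/-- A derivative of the truncated power spline, as a linear functional of the parameters. -/
def derivMap (a b c : Plane) (n : ℕ) (hn : n ≤ 3) (z : Plane) (m : Fin n → Plane) :
    SplitParam →ₗ[ℝ] ℝ where
  toFun θ := iteratedFDeriv ℝ n (splitMap a b c θ) z m
  map_add' θ θ' := by
    have h : ∀ θ, ContDiffAt ℝ n (splitMap a b c θ) z := fun θ =>
      ((contDiff_splitMap a b c θ).of_le (by exact_mod_cast hn)).contDiffAt
    rw [map_add, iteratedFDeriv_add_apply (h θ) (h θ')]
    rfl
  map_smul' r θ := by
    have h : ContDiffAt ℝ n (splitMap a b c θ) z :=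
      ((contDiff_splitMap a b c θ).of_le (by exact_mod_cast hn)).contDiffAt
    rw [map_smul, iteratedFDeriv_const_smul_apply h]
    rfl

/-- The Hermite functionals of a triangle on the truncated power splines. -/
def triHermite (a b c : Plane) (x y : Plane → Plane) (u : Finset Plane → Plane) :
    SplitParam →ₗ[ℝ] TriIndex → ℝ :=
  LinearMap.pi fun l => match l with
    | .inl (k, p) => derivMap a b c (p.1.1 + p.1.2) p.2 (![a, b, c] k)
        (Fin.append (fun _ : Fin p.1.1 => x (![a, b, c] k)) fun _ : Fin p.1.2 => y (![a, b, c] k))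
    | .inr (.inl k) => derivMap a b c 1 (by norm_num)
        (edgeMidpoint {![a, b, c] k, ![b, c, a] k}) fun _ => u {![a, b, c] k, ![b, c, a] k}
    | .inr (.inr (k, r)) => derivMap a b c 2 (by norm_num)
        (edgeQuarter {![a, b, c] k, ![b, c, a] k} (if r then ![a, b, c] k else ![b, c, a] k))
          fun _ => u {![a, b, c] k, ![b, c, a] k}

/-- The prescribed values of the Hermite functionals of a triangle. -/
def triData (a b c : Plane) (dv : Plane → ℕ → ℕ → ℝ) (dm : Finset Plane → ℝ)
    (dq : Finset Plane → Plane → ℝ) : TriIndex → ℝ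
  | .inl (k, p) => dv (![a, b, c] k) p.1.1 p.1.2
  | .inr (.inl k) => dm {![a, b, c] k, ![b, c, a] k}
  | .inr (.inr (k, r)) => dq {![a, b, c] k, ![b, c, a] k} (if r then ![a, b, c] k else ![b, c, a] k)

/-- The function `f` has the prescribed Hermite data at the corner `a` and on the half edge from `a`
towards `b`. -/
structure HasCornerData (x y : Plane → Plane) (u : Finset Plane → Plane) (dv : Plane → ℕ → ℕ → ℝ)
    (dm : Finset Plane → ℝ) (dq : Finset Plane → Plane → ℝ) (f : Plane → ℝ) (a b : Plane) : Prop where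
  vertex : ∀ i j, i + j ≤ 3 → iteratedFDeriv ℝ (i + j) f a
    (Fin.append (fun _ : Fin i => x a) (fun _ : Fin j => y a)) = dv a i j
  midpoint : iteratedFDeriv ℝ 1 f (edgeMidpoint {a, b}) (fun _ => u {a, b}) = dm {a, b}
  quarter : iteratedFDeriv ℝ 2 f (edgeQuarter {a, b} a) (fun _ => u {a, b}) = dq {a, b} a

/-- The index set lists each edge once, oriented cyclically, with a Boolean selecting the endpoint
of the quarterpoint. The reversed orientations are recovered because edges are unordered pairs. -/
lemma hasCornerData_of_triHermite {a b c : Plane} {x y : Plane → Plane} {u : Finset Plane → Plane}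
    {dv : Plane → ℕ → ℕ → ℝ} {dm : Finset Plane → ℝ} {dq : Finset Plane → Plane → ℝ}
    {θ : SplitParam} (h : triHermite a b c x y u θ = triData a b c dv dm dq) :
    HasCornerData x y u dv dm dq (splitMap a b c θ) a b ∧
    HasCornerData x y u dv dm dq (splitMap a b c θ) a c ∧
    HasCornerData x y u dv dm dq (splitMap a b c θ) b a ∧
    HasCornerData x y u dv dm dq (splitMap a b c θ) b c ∧
    HasCornerData x y u dv dm dq (splitMap a b c θ) c a ∧
    HasCornerData x y u dv dm dq (splitMap a b c θ) c b := by
  have hv : ∀ k i j, i + j ≤ 3 → iteratedFDeriv ℝ (i + j) (splitMap a b c θ) (![a, b, c] k)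
      (Fin.append (fun _ : Fin i => x (![a, b, c] k)) (fun _ : Fin j => y (![a, b, c] k))) =
        dv (![a, b, c] k) i j := fun k i j hij =>
    congrFun h (.inl (k, ⟨(⟨i, by omega⟩, ⟨j, by omega⟩), hij⟩))
  have hm : ∀ k, iteratedFDeriv ℝ 1 (splitMap a b c θ) (edgeMidpoint {![a, b, c] k, ![b, c, a] k})
      (fun _ => u {![a, b, c] k, ![b, c, a] k}) = dm {![a, b, c] k, ![b, c, a] k} := fun k =>
    congrFun h (.inr (.inl k))
  have hq : ∀ k, iteratedFDeriv ℝ 2 (splitMap a b c θ)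
      (edgeQuarter {![a, b, c] k, ![b, c, a] k} (![a, b, c] k))
      (fun _ => u {![a, b, c] k, ![b, c, a] k}) = dq {![a, b, c] k, ![b, c, a] k} (![a, b, c] k) :=
    fun k => congrFun h (.inr (.inr (k, true)))
  have hq' : ∀ k, iteratedFDeriv ℝ 2 (splitMap a b c θ)
      (edgeQuarter {![a, b, c] k, ![b, c, a] k} (![b, c, a] k))
      (fun _ => u {![a, b, c] k, ![b, c, a] k}) = dq {![a, b, c] k, ![b, c, a] k} (![b, c, a] k) :=
    fun k => congrFun h (.inr (.inr (k, false)))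
  refine ⟨⟨hv 0, hm 0, hq 0⟩, ⟨hv 0, ?_, ?_⟩, ⟨hv 1, ?_, ?_⟩, ⟨hv 1, hm 1, hq 1⟩,
    ⟨hv 2, hm 2, hq 2⟩, ⟨hv 2, ?_, ?_⟩⟩
  · rw [Finset.pair_comm]; exact hm 2
  · rw [Finset.pair_comm]; exact hq' 2
  · rw [Finset.pair_comm]; exact hm 0
  · rw [Finset.pair_comm]; exact hq' 0
  · rw [Finset.pair_comm]; exact hm 1
  · rw [Finset.pair_comm]; exact hq' 1

section
variable {K : Geometry.SimplicialComplex ℝ Plane}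

lemma iteratedFDeriv_eq_of_isPiece {t : Finset Plane} (ht : t ∈ triangles K) {σ : Plane → ℝ}
    (hσ : ContDiff ℝ 3 σ) {τ : Set Plane} (hτ : τ ∈ split12 (t : Set Plane))
    {p : MvPolynomial (Fin 2) ℝ} (hp : IsPiece σ τ p) {z : Plane} (hz : z ∈ convexHull ℝ τ) {k : ℕ}
    (hk : k ≤ 3) : iteratedFDeriv ℝ k σ z = iteratedFDeriv ℝ k (polyFun p) z := by
  rw [← iteratedFDerivWithin_univ]
  exact iteratedFDerivWithin_eq_of_eqOn (n := 3) uniqueDiffOn_univ (Set.subset_univ _)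
    (convex_convexHull ℝ _) (interior_cell_nonempty ht hτ) (by exact_mod_cast hσ.contDiffOn)
    (contDiff_polyFun p _) hp hk hz

/-- The vertex, the midpoint and the nearer quarterpoint all belong to the closed corner triangle,
where the function has the same derivatives up to order three as its polynomial piece. -/
lemma HasCornerData.congr {x y : Plane → Plane} {u : Finset Plane → Plane}
    {dv : Plane → ℕ → ℕ → ℝ} {dm : Finset Plane → ℝ} {dq : Finset Plane → Plane → ℝ}
    {f : Plane → ℝ} {a b c : Plane} (h : HasCornerData x y u dv dm dq f a b)
    {t : Finset Plane} (ht : t ∈ triangles K) (hl : (t : Set Plane) = {a, b, c})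
    (hf : ContDiff ℝ 3 f) {p : MvPolynomial (Fin 2) ℝ} (hp : IsPiece f (corner a b c) p) :
    HasCornerData x y u dv dm dq (polyFun p) a b := by
  have hτ := mem_split12.2 ⟨a, b, c, hl, Or.inl rfl⟩
  have hab := ne_of_labels ht hl
  refine ⟨fun i j hij => ?_, ?_, ?_⟩
  · rw [← iteratedFDeriv_eq_of_isPiece ht hf hτ hp (left_mem_corner a b c) hij, h.vertex i j hij]
  · rw [← iteratedFDeriv_eq_of_isPiece ht hf hτ hp (edgeMidpoint_mem_corner hab c) (by norm_num),
      h.midpoint]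
  · rw [← iteratedFDeriv_eq_of_isPiece ht hf hτ hp (edgeQuarter_mem_corner hab c) (by norm_num),
      h.quarter]

/-- On a triangle there is a `C³` quintic spline on the 12-split with prescribed Hermite data. -/
theorem exists_hermite_interpolant {x y : Plane → Plane} {u : Finset Plane → Plane}
    (hxy : ∀ v ∈ K.vertices, cr (x v) (y v) ≠ 0)
    (hu : ∀ e ∈ edges K, u e ∉ vectorSpan ℝ (e : Set Plane)) {t : Finset Plane}
    (ht : t ∈ triangles K) (dv : Plane → ℕ → ℕ → ℝ) (dm : Finset Plane → ℝ)
    (dq : Finset Plane → Plane → ℝ) :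
    ∃ σ : Plane → ℝ, ContDiff ℝ 3 σ ∧ (∀ τ ∈ split12 (t : Set Plane),
        ∃ p : MvPolynomial (Fin 2) ℝ, p.totalDegree ≤ 5 ∧ IsPiece σ τ p) ∧
      ∀ a b c, (t : Set Plane) = {a, b, c} → HasCornerData x y u dv dm dq σ a b := by
  obtain ⟨a, b, c, hl⟩ := exists_labels ht
  have hcr := cr_ne_zero ht hl
  have hpiece : ∀ θ, ∀ τ ∈ split12 (t : Set Plane),
      ∃ p : MvPolynomial (Fin 2) ℝ, p.totalDegree ≤ 5 ∧ IsPiece (splitMap a b c θ) τ p :=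
    fun θ τ hτ => splitMap_piece hcr θ (fun a' b' c' e => cr_ne_zero ht (hl.trans e)) (hl ▸ hτ)
  have hcorner : ∀ {dv dm dq θ}, triHermite a b c x y u θ = triData a b c dv dm dq →
      ∀ a' b' c', (t : Set Plane) = {a', b', c'} →
        HasCornerData x y u dv dm dq (splitMap a b c θ) a' b' := by
    intro dv dm dq θ h a' b' c' hl'
    obtain ⟨h1, h2, h3, h4, h5, h6⟩ := hasCornerData_of_triHermite h
    rcases labels_cases (cr_ne_zero ht hl') (hl.symm.trans hl') with ⟨rfl, rfl, rfl⟩ |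
      ⟨rfl, rfl, rfl⟩ | ⟨rfl, rfl, rfl⟩ | ⟨rfl, rfl, rfl⟩ | ⟨rfl, rfl, rfl⟩ | ⟨rfl, rfl, rfl⟩ <;>
      assumption
  -- Zero data make the truncated power spline vanish on the triangle, and then its parameters
  -- vanish.
  have hinj : Function.Injective (triHermite a b c x y u) := by
    rw [← LinearMap.ker_eq_bot, LinearMap.ker_eq_bot']
    intro θ hθ
    have h0 : triHermite a b c x y u θ = triData a b c 0 0 0 := by
      rw [hθ]; funext l; rcases l with l | l | l <;> rfl
    apply splitMap_eq_zero hcr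
    rw [← hl]
    refine eq_zero_of_hermite hxy hu ht (contDiff_splitMap a b c θ).contDiffOn (hpiece θ) ?_
    intro a' b' c' hl' p hp
    have := (hcorner h0 a' b' c' hl').congr ht hl' (contDiff_splitMap a b c θ) hp
    have hz : ∀ n z, iteratedFDeriv ℝ n (0 : Plane → ℝ) z = 0 := fun n z => by
      rw [← polyFun_zero, iteratedFDeriv_polyFun_zero]
    exact ⟨fun i j hij => by rw [this.vertex i j hij, hz]; rfl, by rw [this.midpoint, hz]; rfl,
      by rw [this.quarter, hz]; rfl⟩
  -- Parameters and functionals both number 39, so injectivity gives surjectivity.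
  have hsurj : Function.Surjective (triHermite a b c x y u) := by
    rwa [← LinearMap.injective_iff_surjective_of_finrank_eq_finrank]
    rw [finrank_splitParam, Module.finrank_fintype_fun_eq_card, card_triIndex]
  obtain ⟨θ, hθ⟩ := hsurj (triData a b c dv dm dq)
  exact ⟨splitMap a b c θ, contDiff_splitMap a b c θ, hpiece θ, hcorner hθ⟩

end

section
variable {K : Geometry.SimplicialComplex ℝ Plane}

lemma exists_labels_of_mem {t : Finset Plane} (ht : t ∈ triangles K) {a : Plane} (ha : a ∈ t) :
    ∃ b c, (t : Set Plane) = {a, b, c} := by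
  obtain ⟨a', b', c', h⟩ := exists_labels ht
  have : a ∈ ({a', b', c'} : Set Plane) := by rw [← h]; exact ha
  rcases this with rfl | rfl | rfl
  · exact ⟨_, _, h⟩
  · exact ⟨_, _, h.trans (triple_rot _ _ _)⟩
  · exact ⟨_, _, h.trans ((triple_rot _ _ _).trans (triple_rot _ _ _))⟩

lemma exists_labels_of_mem_mem {t : Finset Plane} (ht : t ∈ triangles K) {a b : Plane} (ha : a ∈ t)
    (hb : b ∈ t) (hab : a ≠ b) : ∃ c, (t : Set Plane) = {a, b, c} := by
  obtain ⟨b', c', h⟩ := exists_labels_of_mem ht ha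
  have : b ∈ ({a, b', c'} : Set Plane) := by rw [← h]; exact hb
  rcases this with rfl | rfl | rfl
  · exact absurd rfl hab
  · exact ⟨_, h⟩
  · exact ⟨_, h.trans (triple_swap _ _ _)⟩

lemma corner_mem_refine12 {t : Finset Plane} (ht : t ∈ triangles K) {a b c : Plane}
    (h : (t : Set Plane) = {a, b, c}) : corner a b c ∈ refine12 K := by
  simp only [refine12, Set.mem_iUnion]
  exact ⟨t, ht, mem_split12.2 ⟨a, b, c, h, Or.inl rfl⟩⟩

lemma mem_vertices_of_label {t : Finset Plane} (ht : t ∈ triangles K) {a b c : Plane}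
    (h : (t : Set Plane) = {a, b, c}) : a ∈ K.vertices :=
  mem_vertices_of_mem ht (by rw [← Finset.mem_coe, h]; simp)

/-! ### The Hermite functionals on the spline space -/

lemma hermiteValue_vertex (hK : IsTriangulation K) {x y : Plane → Plane} {u : Finset Plane → Plane}
    {s : Plane → ℝ} (hs : s ∈ superSplineSpace K) {t : Finset Plane} (ht : t ∈ triangles K)
    {a b c : Plane} (h : (t : Set Plane) = {a, b, c}) {p : MvPolynomial (Fin 2) ℝ}
    (hp : IsPiece s (corner a b c) p) (ha : a ∈ K.vertices) {i j : ℕ} (hij : i + j ≤ 3) :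
    hermiteValue K x y u s (.vertex ⟨a, ha⟩ i j hij) = iteratedFDeriv ℝ (i + j) (polyFun p) a
      (Fin.append (fun _ : Fin i => x a) (fun _ : Fin j => y a)) := by
  rw [hermiteValue, iteratedFDerivWithin_vertex hK hs (corner_mem_refine12 ht h) hp ha
    (by simp [corner]) hij]

lemma hermiteValue_midpoint (hK : IsTriangulation K) {x y : Plane → Plane}
    {u : Finset Plane → Plane} {s : Plane → ℝ} (hs : s ∈ superSplineSpace K) {t : Finset Plane}
    (ht : t ∈ triangles K) {a b c : Plane} (h : (t : Set Plane) = {a, b, c})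
    {p : MvPolynomial (Fin 2) ℝ} (hp : IsPiece s (corner a b c) p) (he : {a, b} ∈ edges K) :
    hermiteValue K x y u s (.midpoint ⟨{a, b}, he⟩) =
      iteratedFDeriv ℝ 1 (polyFun p) (edgeMidpoint {a, b}) (fun _ => u {a, b}) := by
  rw [hermiteValue, iteratedFDerivWithin_of_le_two hK hs (corner_mem_refine12 ht h) hp
    (edgeMidpoint_mem_corner (ne_of_labels ht h) c) (by norm_num)]

lemma hermiteValue_quarter (hK : IsTriangulation K) {x y : Plane → Plane}
    {u : Finset Plane → Plane} {s : Plane → ℝ} (hs : s ∈ superSplineSpace K) {t : Finset Plane}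
    (ht : t ∈ triangles K) {a b c : Plane} (h : (t : Set Plane) = {a, b, c})
    {p : MvPolynomial (Fin 2) ℝ} (hp : IsPiece s (corner a b c) p) (he : {a, b} ∈ edges K)
    (ha : a ∈ ({a, b} : Finset Plane)) :
    hermiteValue K x y u s (.quarter ⟨{a, b}, he⟩ a ha) =
      iteratedFDeriv ℝ 2 (polyFun p) (edgeQuarter {a, b} a) (fun _ => u {a, b}) := by
  rw [hermiteValue, iteratedFDerivWithin_of_le_two hK hs (corner_mem_refine12 ht h) hp
    (edgeQuarter_mem_corner (ne_of_labels ht h) c) le_rfl]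

/-- An index of a functional belongs to a corner of a triangle. -/
lemma HermiteIndex.exists_label (hK : IsTriangulation K) (l : HermiteIndex K) :
    ∃ t ∈ triangles K, ∃ a b c, (t : Set Plane) = {a, b, c} ∧
      ((∃ (ha : a ∈ K.vertices) (i j : ℕ) (hij : i + j ≤ 3), l = .vertex ⟨a, ha⟩ i j hij) ∨
      (∃ he : {a, b} ∈ edges K, l = .midpoint ⟨{a, b}, he⟩) ∨
      ∃ (he : {a, b} ∈ edges K) (ha : a ∈ ({a, b} : Finset Plane)),
        l = .quarter ⟨{a, b}, he⟩ a ha) := by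
  have key : ∀ e ∈ edges K, ∀ a ∈ e, ∃ t ∈ triangles K, ∃ b c, (t : Set Plane) = {a, b, c} ∧
      e = {a, b} := by
    intro e he a ha
    obtain ⟨t, ht, a', b, c, h, hab⟩ := exists_triangle_of_edge hK he
    have ha' : a ∈ ({a', b} : Set Plane) := by rw [← hab]; exact ha
    rcases ha' with rfl | rfl
    · exact ⟨t, ht, b, c, h, Finset.coe_injective (by simpa using hab)⟩
    · exact ⟨t, ht, a', c, h.trans (triple_swap' _ _ _),
        Finset.coe_injective (by rw [Finset.pair_comm]; simpa using hab)⟩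
  cases l with
  | vertex v i j hij =>
    obtain ⟨t, ht, b, c, h⟩ := exists_triangle_of_vertex hK v.2
    exact ⟨t, ht, v, b, c, h, Or.inl ⟨v.2, i, j, hij, rfl⟩⟩
  | midpoint e =>
    obtain ⟨e, he⟩ := e
    obtain ⟨a, ha⟩ := Finset.card_pos.1 (by rw [he.2]; norm_num : 0 < e.card)
    obtain ⟨t, ht, b, c, h, rfl⟩ := key e he a ha
    exact ⟨t, ht, a, b, c, h, Or.inr (Or.inl ⟨he, rfl⟩)⟩
  | quarter e a ha =>
    obtain ⟨e, he⟩ := e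
    obtain ⟨t, ht, b, c, h, rfl⟩ := key e he a ha
    exact ⟨t, ht, a, b, c, h, Or.inr (Or.inr ⟨he, ha, rfl⟩)⟩

/-- Each functional is a derivative of the polynomial piece on some triangle of the split. -/
lemma exists_hermiteValue_eq (hK : IsTriangulation K) (x y : Plane → Plane)
    (u : Finset Plane → Plane) (l : HermiteIndex K) :
    ∃ τ ∈ refine12 K, ∃ (n : ℕ) (z : Plane) (m : Fin n → Plane), ∀ s ∈ superSplineSpace K,
      ∀ p, IsPiece s τ p → hermiteValue K x y u s l = iteratedFDeriv ℝ n (polyFun p) z m := by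
  obtain ⟨t, ht, a, b, c, h, ⟨ha, i, j, hij, rfl⟩ | ⟨he, rfl⟩ | ⟨he, ha, rfl⟩⟩ := l.exists_label hK
  · exact ⟨_, corner_mem_refine12 ht h, _, _, _, fun s hs p hp =>
      hermiteValue_vertex hK hs ht h hp ha hij⟩
  · exact ⟨_, corner_mem_refine12 ht h, _, _, _, fun s hs p hp =>
      hermiteValue_midpoint hK hs ht h hp he⟩
  · exact ⟨_, corner_mem_refine12 ht h, _, _, _, fun s hs p hp =>
      hermiteValue_quarter hK hs ht h hp he ha⟩

/-- The Hermite functionals as a linear map. -/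
def hermiteMap (hK : IsTriangulation K) (x y : Plane → Plane) (u : Finset Plane → Plane) :
    superSplineSpace K →ₗ[ℝ] HermiteIndex K → ℝ where
  toFun s l := hermiteValue K x y u s l
  map_add' s s' := by
    funext l
    -- Third derivatives at a vertex are taken within a region on which the spline is only `C²`, so
    -- additivity is deduced from a common cell, where each functional is an ordinary derivative of
    -- a polynomial.
    obtain ⟨τ, hτ, n, z, m, h⟩ := exists_hermiteValue_eq hK x y u l
    obtain ⟨p, -, hp⟩ := exists_piece s.2 hτ
    obtain ⟨q, -, hq⟩ := exists_piece s'.2 hτ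
    have hpq : IsPiece ((s + s' : superSplineSpace K) : Plane → ℝ) τ (p + q) := fun w hw => by
      simp [polyFun_add, hp hw, hq hw]
    rw [h _ (s + s').2 _ hpq, Pi.add_apply, h _ s.2 p hp, h _ s'.2 q hq, polyFun_add,
      iteratedFDeriv_add_apply (contDiff_polyFun p n).contDiffAt (contDiff_polyFun q n).contDiffAt]
    rfl
  map_smul' r s := by
    funext l
    obtain ⟨τ, hτ, n, z, m, h⟩ := exists_hermiteValue_eq hK x y u l
    obtain ⟨p, -, hp⟩ := exists_piece s.2 hτ
    have hrp : IsPiece ((r • s : superSplineSpace K) : Plane → ℝ) τ (r • p) := fun w hw => by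
      simp [polyFun_smul, hp hw]
    rw [h _ (r • s).2 _ hrp, Pi.smul_apply, h _ s.2 p hp, polyFun_smul,
      iteratedFDeriv_const_smul_apply (contDiff_polyFun p n).contDiffAt]
    rfl

/-- A spline with vanishing Hermite data vanishes. -/
theorem hermiteMap_injective (hK : IsTriangulation K) {x y : Plane → Plane}
    {u : Finset Plane → Plane} (hxy : ∀ v ∈ K.vertices, cr (x v) (y v) ≠ 0)
    (hu : ∀ e ∈ edges K, u e ∉ vectorSpan ℝ (e : Set Plane)) :
    Function.Injective (hermiteMap hK x y u) := by
  rw [← LinearMap.ker_eq_bot, LinearMap.ker_eq_bot']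
  intro s hs0
  have hval : ∀ l, hermiteValue K x y u s l = 0 := fun l => congrFun hs0 l
  have hs := s.2
  ext z
  by_cases hz : z ∈ K.space
  · rw [space_eq hK] at hz
    simp only [Set.mem_iUnion] at hz
    obtain ⟨t, ht, hz⟩ := hz
    refine eq_zero_of_hermite hxy hu ht (hs.2.1 t ht) (fun τ hτ => exists_piece hs ?_) ?_ z hz
    · simp only [refine12, Set.mem_iUnion]
      exact ⟨t, ht, hτ⟩
    · intro a b c h p hp
      have hz : ∀ n z, iteratedFDeriv ℝ n (0 : Plane → ℝ) z = 0 := fun n z => by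
        rw [← polyFun_zero, iteratedFDeriv_polyFun_zero]
      have he := mem_edges_of_mem ht h
      refine ⟨fun i j hij => ?_, ?_, ?_⟩
      · rw [hz, ← hermiteValue_vertex (u := u) hK hs ht h hp (mem_vertices_of_label ht h) hij, hval]
        rfl
      · rw [hz, ← hermiteValue_midpoint (x := x) (y := y) hK hs ht h hp he, hval]
        rfl
      · rw [hz, ← hermiteValue_quarter (x := x) (y := y) hK hs ht h hp he (by simp), hval]
        rfl
  · exact hs.1.1 z hz

/-! ### Gluing -/

lemma continuousWithinAt_biUnion {E F : Type*} [TopologicalSpace E] [TopologicalSpace F] {ι : Type*}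
    {I : Set ι} (hI : I.Finite) {f : E → F} {T : ι → Set E} {x : E}
    (h : ∀ i ∈ I, ContinuousWithinAt f (T i) x) : ContinuousWithinAt f (⋃ i ∈ I, T i) x := by
  induction I, hI using Set.Finite.induction_on with
  | empty => simp [continuousWithinAt_of_notMem_closure]
  | insert _ _ ih =>
    rw [Set.biUnion_insert]
    exact (h _ (Set.mem_insert _ _)).union (ih fun i hi => h i (Set.mem_insert_of_mem _ hi))

/-- Functions of class `C²` whose derivatives up to order two agree on the intersections of the
triangles glue to a function of class `C²` on the region. -/
lemma contDiffOn_glue (hK : IsTriangulation K) {σ : Finset Plane → Plane → ℝ} {s : Plane → ℝ}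
    (hσ : ∀ t ∈ triangles K, ContDiff ℝ 3 (σ t))
    (hs : ∀ t ∈ triangles K, Set.EqOn s (σ t) (convexHull ℝ (t : Set Plane)))
    (hagree : ∀ t ∈ triangles K, ∀ t' ∈ triangles K, ∀ z ∈ convexHull ℝ (t : Set Plane),
      z ∈ convexHull ℝ (t' : Set Plane) → ∀ k ≤ 2,
        iteratedFDeriv ℝ k (σ t) z = iteratedFDeriv ℝ k (σ t') z) :
    ContDiffOn ℝ 2 s K.space := by
  have hex : ∀ z, ∃ t, z ∈ K.space → t ∈ triangles K ∧ z ∈ convexHull ℝ (t : Set Plane) := by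
    intro z
    by_cases hz : z ∈ K.space
    · rw [space_eq hK] at hz
      simp only [Set.mem_iUnion] at hz
      obtain ⟨t, ht, hz⟩ := hz
      exact ⟨t, fun _ => ⟨ht, hz⟩⟩
    · exact ⟨∅, fun h => absurd h hz⟩
  choose T hT using hex
  -- The candidate Taylor series at `z` uses an arbitrary triangle `T z` containing `z`. By
  -- agreement on intersections, on each closed triangle it coincides with the smooth series of that
  -- triangle, so differentiability and continuity can be checked on one triangle at a time.
  have hJ : ∀ t ∈ triangles K, ∀ k ≤ 2, Set.EqOn (fun z => iteratedFDeriv ℝ k (σ (T z)) z)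
      (iteratedFDeriv ℝ k (σ t)) (convexHull ℝ (t : Set Plane)) := by
    intro t ht k hk z hz
    obtain ⟨h1, h2⟩ := hT z (convexHull_subset_space ht hz)
    exact hagree _ h1 t ht z h2 hz k hk
  have hfin : (triangles K).Finite := hK.finite.subset fun t ht => ht.1
  have hclosed : ∀ t : Finset Plane, IsClosed (convexHull ℝ (t : Set Plane)) := fun t =>
    (Set.Finite.isCompact_convexHull ℝ t.finite_toSet).isClosed
  have htaylor : HasFTaylorSeriesUpToOn 2 s (fun z k => iteratedFDeriv ℝ k (σ (T z)) z) K.space := by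
    refine ⟨fun z hz => ?_, fun m hm z hz => ?_, fun m hm z hz => ?_⟩
    · obtain ⟨h1, h2⟩ := hT z hz
      rw [hs _ h1 h2]
      rfl
    · have hm' : m < 2 := by exact_mod_cast hm
      rw [space_eq hK]
      refine hasFDerivWithinAt_biUnion hfin fun t ht => ?_
      by_cases hzt : z ∈ convexHull ℝ (t : Set Plane)
      · have hd : Differentiable ℝ (iteratedFDeriv ℝ m (σ t)) :=
          (hσ t ht).differentiable_iteratedFDeriv (by exact_mod_cast (by omega : m < 3))
        have e : (iteratedFDeriv ℝ m.succ (σ (T z)) z).curryLeft =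
            fderiv ℝ (iteratedFDeriv ℝ m (σ t)) z := by
          have := hJ t ht m.succ (by omega) hzt
          simp only at this
          rw [this]
          rfl
        rw [e]
        exact (hd z).hasFDerivAt.hasFDerivWithinAt.congr (hJ t ht m hm'.le) (hJ t ht m hm'.le hzt)
      · exact .of_notMem_closure (by rwa [(hclosed t).closure_eq])
    · have hm' : m ≤ 2 := by exact_mod_cast hm
      rw [space_eq hK]
      refine continuousWithinAt_biUnion hfin fun t ht => ?_
      by_cases hzt : z ∈ convexHull ℝ (t : Set Plane)
      · have hc : Continuous (iteratedFDeriv ℝ m (σ t)) :=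
          (hσ t ht).continuous_iteratedFDeriv (by exact_mod_cast (by omega : m ≤ 3))
        exact hc.continuousWithinAt.congr (hJ t ht m hm') (hJ t ht m hm' hzt)
      · exact continuousWithinAt_of_notMem_closure (by rwa [(hclosed t).closure_eq])
  exact htaylor.contDiffOn

/-! ### Agreement of local interpolants on common faces -/

lemma HasCornerData.cornerData {x y : Plane → Plane} {u : Finset Plane → Plane}
    {dv : Plane → ℕ → ℕ → ℝ} {dm : Finset Plane → ℝ} {dq : Finset Plane → Plane → ℝ}
    {f g : Plane → ℝ} {a b : Plane} (hf : HasCornerData x y u dv dm dq f a b)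
    (hg : HasCornerData x y u dv dm dq g a b) : CornerData x y u f g a b :=
  ⟨fun i j hij => (hf.vertex i j hij).trans (hg.vertex i j hij).symm,
    hf.midpoint.trans hg.midpoint.symm, hf.quarter.trans hg.quarter.symm⟩

/-- The local interpolants of the Hermite data. -/
structure IsLocalInterpolant (K : Geometry.SimplicialComplex ℝ Plane) (x y : Plane → Plane)
    (u : Finset Plane → Plane) (dv : Plane → ℕ → ℕ → ℝ) (dm : Finset Plane → ℝ)
    (dq : Finset Plane → Plane → ℝ) (t : Finset Plane) (σ : Plane → ℝ) : Prop where
  contDiff : ContDiff ℝ 3 σ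
  piece : ∀ τ ∈ split12 (t : Set Plane),
    ∃ p : MvPolynomial (Fin 2) ℝ, p.totalDegree ≤ 5 ∧ IsPiece σ τ p
  data : ∀ a b c, (t : Set Plane) = {a, b, c} → HasCornerData x y u dv dm dq σ a b

section
variable {x y : Plane → Plane} {u : Finset Plane → Plane} {dv : Plane → ℕ → ℕ → ℝ}
  {dm : Finset Plane → ℝ} {dq : Finset Plane → Plane → ℝ} {t t' : Finset Plane} {σ σ' : Plane → ℝ}

lemma IsLocalInterpolant.exists_corner (h : IsLocalInterpolant K x y u dv dm dq t σ)
    (ht : t ∈ triangles K) {a b c : Plane} (hl : (t : Set Plane) = {a, b, c}) :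
    ∃ p : MvPolynomial (Fin 2) ℝ, p.totalDegree ≤ 5 ∧
      HasCornerData x y u dv dm dq (polyFun p) a b ∧
      ∀ z ∈ convexHull ℝ (corner a b c), ∀ k ≤ 3,
        iteratedFDeriv ℝ k σ z = iteratedFDeriv ℝ k (polyFun p) z := by
  have hτ := mem_split12.2 ⟨a, b, c, hl, Or.inl rfl⟩
  obtain ⟨p, hp, hp'⟩ := h.piece _ hτ
  exact ⟨p, hp, (h.data a b c hl).congr ht hl h.contDiff hp',
    fun z hz k hk => iteratedFDeriv_eq_of_isPiece ht h.contDiff hτ hp' hz hk⟩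

/-- Both interpolants have the same mixed derivatives up to order three in the independent
directions `x v` and `y v`, and these determine the whole jet. -/
lemma IsLocalInterpolant.agree_vertex (hxy : ∀ v ∈ K.vertices, cr (x v) (y v) ≠ 0)
    (h : IsLocalInterpolant K x y u dv dm dq t σ) (h' : IsLocalInterpolant K x y u dv dm dq t' σ')
    (ht : t ∈ triangles K) (ht' : t' ∈ triangles K) {v : Plane} (hv : v ∈ t) (hv' : v ∈ t') {k : ℕ}
    (hk : k ≤ 3) : iteratedFDeriv ℝ k σ v = iteratedFDeriv ℝ k σ' v := by
  obtain ⟨b, c, hl⟩ := exists_labels_of_mem ht hv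
  obtain ⟨b', c', hl'⟩ := exists_labels_of_mem ht' hv'
  obtain ⟨p, hp, hd, hj⟩ := h.exists_corner ht hl
  obtain ⟨p', hp', hd', hj'⟩ := h'.exists_corner ht' hl'
  rw [hj v (left_mem_corner _ _ _) k hk, hj' v (left_mem_corner _ _ _) k hk]
  exact jetEq_of_append hp hp' (hxy v (mem_vertices_of_mem ht hv))
    (fun i j hij => (hd.vertex i j hij).trans (hd'.vertex i j hij).symm) k hk

/-- On each half of the edge the two corner pieces have the same Hermite data, and on each side of
the edge the pieces have contact of order three at the midpoint. The differences therefore satisfy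
`EdgeZero`, and their second order jets vanish along the edge. -/
lemma IsLocalInterpolant.agree_edge (hxy : ∀ v ∈ K.vertices, cr (x v) (y v) ≠ 0)
    (hu : ∀ e ∈ edges K, u e ∉ vectorSpan ℝ (e : Set Plane))
    (h : IsLocalInterpolant K x y u dv dm dq t σ) (h' : IsLocalInterpolant K x y u dv dm dq t' σ')
    (ht : t ∈ triangles K) (ht' : t' ∈ triangles K) {a b : Plane} (hab : a ≠ b) (ha : a ∈ t)
    (hb : b ∈ t) (ha' : a ∈ t') (hb' : b ∈ t') {z : Plane} (hz : z ∈ segment ℝ a b) {k : ℕ}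
    (hk : k ≤ 2) : iteratedFDeriv ℝ k σ z = iteratedFDeriv ℝ k σ' z := by
  obtain ⟨c, hl⟩ := exists_labels_of_mem_mem ht ha hb hab
  obtain ⟨c', hl'⟩ := exists_labels_of_mem_mem ht' ha' hb' hab
  obtain ⟨p, hp, hpd, hpj⟩ := h.exists_corner ht hl
  obtain ⟨q, hq, hqd, hqj⟩ := h.exists_corner ht (hl.trans (triple_swap' _ _ _))
  obtain ⟨p', hp', hpd', hpj'⟩ := h'.exists_corner ht' hl'
  obtain ⟨q', hq', hqd', hqj'⟩ := h'.exists_corner ht' (hl'.trans (triple_swap' _ _ _))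
  have hmid : ∀ c, (1 / 2 : ℝ) • (a + b) ∈ convexHull ℝ (corner a b c) := fun c =>
    edgeMidpoint_pair hab ▸ edgeMidpoint_mem_corner hab c
  have hmid' : ∀ c, (1 / 2 : ℝ) • (a + b) ∈ convexHull ℝ (corner b a c) := fun c =>
    add_comm b a ▸ edgeMidpoint_pair hab.symm ▸ edgeMidpoint_mem_corner hab.symm c
  have hE := edgeZero_sub hab hp hq hp' hq' (hxy a (mem_vertices_of_mem ht ha))
    (hxy b (mem_vertices_of_mem ht hb)) (hpd.cornerData hpd') (hqd.cornerData hqd')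
    (fun k hk => by rw [← hpj _ (hmid c) k hk, hqj _ (hmid' c) k hk])
    (fun k hk => by rw [← hpj' _ (hmid c') k hk, hqj' _ (hmid' c') k hk])
  have hcr := cr_ne_zero_of_not_mem hab (hu _ (mem_edges_of_mem ht hl))
  have hdeg : ∀ {p q : MvPolynomial (Fin 2) ℝ}, p.totalDegree ≤ 5 → q.totalDegree ≤ 5 →
      (p - q).totalDegree ≤ 5 := fun hp hq =>
    (MvPolynomial.totalDegree_sub _ _).trans (max_le hp hq)
  have hjet := hE.jetEq (hdeg hp hp') (hdeg hq hq') hcr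
  obtain ⟨r, hr0, hr1, rfl⟩ : ∃ r : ℝ, 0 ≤ r ∧ r ≤ 1 ∧ z = fr a (b - a) (u {a, b}) r 0 := by
    rw [segment_eq_image_lineMap] at hz
    obtain ⟨r, hr, rfl⟩ := hz
    exact ⟨r, hr.1, hr.2, by rw [AffineMap.lineMap_apply, fr]; simp [add_comm]⟩
  have hsub : ∀ {p q : MvPolynomial (Fin 2) ℝ} {z : Plane}, JetEq 2 (p - q) 0 z →
      iteratedFDeriv ℝ k (polyFun p) z = iteratedFDeriv ℝ k (polyFun q) z := by
    intro p q z h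
    have := h k hk
    rwa [iteratedFDeriv_polyFun_sub, iteratedFDeriv_polyFun_zero, sub_eq_zero] at this
  -- The two halves of the edge lie in the corner triangles at `a` and at `b`; for the second, the
  -- parameter is measured from `b`.
  rcases le_total r (1 / 2) with hr | hr
  · have hm : ∀ c, fr a (b - a) (u {a, b}) r 0 ∈ convexHull ℝ (corner a b c) := fun c =>
      mem_convexHull_corner.2 ⟨r, 0, le_rfl, hr0, by linarith, by simp [fr]⟩
    rw [hpj _ (hm c) k (by omega), hpj' _ (hm c') k (by omega), hsub (hjet r).1]
  · have hm : ∀ c, fr a (b - a) (u {a, b}) r 0 ∈ convexHull ℝ (corner b a c) := fun c =>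
      mem_convexHull_corner.2 ⟨1 - r, 0, le_rfl, by linarith, by linarith, by unfold fr; module⟩
    rw [hqj _ (hm c) k (by omega), hqj' _ (hm c') k (by omega), hsub (hjet r).2]

/-- Local interpolants of the same data on two triangles agree to second order on their
intersection. -/
lemma IsLocalInterpolant.agree (hxy : ∀ v ∈ K.vertices, cr (x v) (y v) ≠ 0)
    (hu : ∀ e ∈ edges K, u e ∉ vectorSpan ℝ (e : Set Plane))
    {σ : Finset Plane → Plane → ℝ}
    (h : ∀ t ∈ triangles K, IsLocalInterpolant K x y u dv dm dq t (σ t))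
    (ht : t ∈ triangles K) (ht' : t' ∈ triangles K) {z : Plane}
    (hz : z ∈ convexHull ℝ (t : Set Plane)) (hz' : z ∈ convexHull ℝ (t' : Set Plane)) {k : ℕ}
    (hk : k ≤ 2) : iteratedFDeriv ℝ k (σ t) z = iteratedFDeriv ℝ k (σ t') z := by
  classical
  rcases eq_or_ne t t' with rfl | hne
  · rfl
  -- Two triangles of the complex meet in the hull of their common vertices. Distinct triangles
  -- share at most two of these, which leaves the vertex case and the edge case.
  have hi := K.inter_subset_convexHull ht.1 ht'.1 ⟨hz, hz'⟩
  rw [← Finset.coe_inter] at hi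
  have hcard : (t ∩ t').card < 3 := by
    by_contra hc
    have h1 : t ∩ t' = t := Finset.eq_of_subset_of_card_le Finset.inter_subset_left
      (by rw [ht.2]; omega)
    have h2 : t ∩ t' = t' := Finset.eq_of_subset_of_card_le Finset.inter_subset_right
      (by rw [ht'.2]; omega)
    exact hne (h1.symm.trans h2)
  have hpos : 0 < (t ∩ t').card := by
    rw [Finset.card_pos, ← Finset.coe_nonempty, ← convexHull_nonempty_iff (𝕜 := ℝ)]
    exact ⟨z, hi⟩
  have hc : (t ∩ t').card = 1 ∨ (t ∩ t').card = 2 := by omega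
  rcases hc with hc | hc
  · obtain ⟨a, ha⟩ := Finset.card_eq_one.1 hc
    have hat : a ∈ t ∩ t' := by rw [ha]; simp
    rw [Finset.mem_inter] at hat
    rw [ha, Finset.coe_singleton, convexHull_singleton, Set.mem_singleton_iff] at hi
    subst hi
    exact (h t ht).agree_vertex hxy (h t' ht') ht ht' hat.1 hat.2 (by omega)
  · obtain ⟨a, b, hab, he⟩ := Finset.card_eq_two.1 hc
    have hat : a ∈ t ∩ t' := by rw [he]; simp
    have hbt : b ∈ t ∩ t' := by rw [he]; simp
    rw [Finset.mem_inter] at hat hbt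
    rw [he, Finset.coe_pair, convexHull_pair] at hi
    exact (h t ht).agree_edge hxy hu (h t' ht') ht ht' hab hat.1 hbt.1 hat.2 hbt.2 hi hk

end

/-! ### Interpolation on the whole triangulation -/

/-- There is a spline with prescribed Hermite data. -/
theorem hermiteMap_surjective (hK : IsTriangulation K) {x y : Plane → Plane}
    {u : Finset Plane → Plane} (hxy : ∀ v ∈ K.vertices, cr (x v) (y v) ≠ 0)
    (hu : ∀ e ∈ edges K, u e ∉ vectorSpan ℝ (e : Set Plane)) :
    Function.Surjective (hermiteMap hK x y u) := by
  classical
  intro d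
  -- The data are extended by zero off the index set, so that every triangle receives its data from
  -- the same total functions; neighbours then agree on what is prescribed on shared faces.
  let dv : Plane → ℕ → ℕ → ℝ := fun v i j =>
    if h : v ∈ K.vertices ∧ i + j ≤ 3 then d (.vertex ⟨v, h.1⟩ i j h.2) else 0
  let dm : Finset Plane → ℝ := fun e => if h : e ∈ edges K then d (.midpoint ⟨e, h⟩) else 0
  let dq : Finset Plane → Plane → ℝ := fun e a =>
    if h : ∃ he : e ∈ edges K, a ∈ e then d (.quarter ⟨e, h.1⟩ a h.2) else 0
  have hex : ∀ t, ∃ σ, t ∈ triangles K → IsLocalInterpolant K x y u dv dm dq t σ := by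
    intro t
    by_cases ht : t ∈ triangles K
    · obtain ⟨σ, h1, h2, h3⟩ := exists_hermite_interpolant hxy hu ht dv dm dq
      exact ⟨σ, fun _ => ⟨h1, h2, h3⟩⟩
    · exact ⟨0, fun h => absurd h ht⟩
  choose σ hσ using hex
  -- Any triangle containing `z` may be used, since the interpolants agree on overlaps; the value
  -- outside the region must be zero by the convention of `splineSpace`.
  let s : Plane → ℝ := fun z =>
    if h : ∃ t ∈ triangles K, z ∈ convexHull ℝ (t : Set Plane) then σ h.choose z else 0
  have hsσ : ∀ t ∈ triangles K, Set.EqOn s (σ t) (convexHull ℝ (t : Set Plane)) := by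
    intro t ht z hz
    have h : ∃ t ∈ triangles K, z ∈ convexHull ℝ (t : Set Plane) := ⟨t, ht, hz⟩
    have e := IsLocalInterpolant.agree hxy hu hσ h.choose_spec.1 ht h.choose_spec.2 hz
      (k := 0) (by norm_num)
    have e' := congrArg (fun f => f 0) e
    simp only [iteratedFDeriv_zero_apply] at e'
    simp only [s, dif_pos h, e']
  have hpiece : ∀ t ∈ triangles K, ∀ τ ∈ split12 (t : Set Plane), ∀ p, IsPiece (σ t) τ p →
      IsPiece s τ p := fun t ht τ hτ p hp z hz => by
    rw [hsσ t ht (convexHull_cell_subset hτ hz), hp hz]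
  have hs : s ∈ superSplineSpace K := by
    refine ⟨⟨fun z hz => dif_neg fun ⟨t, ht, h⟩ => hz (convexHull_subset_space ht h), ?_, ?_⟩, ?_, ?_⟩
    · exact contDiffOn_glue hK (fun t ht => (hσ t ht).contDiff) hsσ
        fun t ht t' ht' z hz hz' k hk => IsLocalInterpolant.agree hxy hu hσ ht ht' hz hz' hk
    · intro τ hτ
      simp only [refine12, Set.mem_iUnion] at hτ
      obtain ⟨t, ht, hτ⟩ := hτ
      obtain ⟨p, hp, hp'⟩ := (hσ t ht).piece τ hτ
      exact ⟨p, hp, hpiece t ht τ hτ p hp'⟩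
    · exact fun t ht => (hσ t ht).contDiff.contDiffOn.congr (hsσ t ht)
    · intro v hv τ hτ τ' hτ' hvτ hvτ'
      simp only [refine12, Set.mem_iUnion] at hτ hτ'
      obtain ⟨t, ht, hτ⟩ := hτ
      obtain ⟨t', ht', hτ'⟩ := hτ'
      obtain ⟨p, -, hp⟩ := (hσ t ht).piece τ hτ
      obtain ⟨q, -, hq⟩ := (hσ t' ht').piece τ' hτ'
      have hz := subset_convexHull ℝ _ hvτ
      have hz' := subset_convexHull ℝ _ hvτ'
      refine ⟨p, q, hpiece t ht τ hτ p hp, hpiece t' ht' τ' hτ' q hq, fun m hm => ?_⟩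
      rw [← iteratedFDeriv_eq_of_isPiece ht (hσ t ht).contDiff hτ hp hz hm,
        ← iteratedFDeriv_eq_of_isPiece ht' (hσ t' ht').contDiff hτ' hq hz' hm]
      exact (hσ t ht).agree_vertex hxy (hσ t' ht') ht ht'
        ((K.vertex_mem_convexHull_iff hv ht.1).1 (convexHull_cell_subset hτ hz))
        ((K.vertex_mem_convexHull_iff hv ht'.1).1 (convexHull_cell_subset hτ' hz')) hm
  refine ⟨⟨s, hs⟩, funext fun l => ?_⟩
  change hermiteValue K x y u s l = d l
  obtain ⟨t, ht, a, b, c, h, hcase⟩ := l.exists_label hK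
  have hτ := mem_split12.2 ⟨a, b, c, h, Or.inl rfl⟩
  obtain ⟨p, -, hp⟩ := (hσ t ht).piece _ hτ
  have hsp := hpiece t ht _ hτ p hp
  have hd := ((hσ t ht).data a b c h).congr ht h (hσ t ht).contDiff hp
  rcases hcase with ⟨ha, i, j, hij, rfl⟩ | ⟨he, rfl⟩ | ⟨he, ha, rfl⟩
  · rw [hermiteValue_vertex hK hs ht h hsp ha hij, hd.vertex i j hij]
    exact dif_pos ⟨ha, hij⟩
  · rw [hermiteValue_midpoint hK hs ht h hsp he, hd.midpoint]
    exact dif_pos he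
  · rw [hermiteValue_quarter hK hs ht h hsp he ha, hd.quarter]
    exact dif_pos (⟨he, ha⟩ : ∃ he : {a, b} ∈ edges K, a ∈ ({a, b} : Finset Plane))

/-! ### The number of functionals -/

/-- The functionals, sorted by the vertices and edges they belong to. -/
def hermiteIndexEquiv (K : Geometry.SimplicialComplex ℝ Plane) : HermiteIndex K ≃
    (K.vertices × Exp3) ⊕ edges K ⊕ (Σ e : edges K, {a : Plane // a ∈ e.1}) where
  toFun
    | .vertex v i j hij => .inl (v, ⟨(⟨i, by omega⟩, ⟨j, by omega⟩), hij⟩)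
    | .midpoint e => .inr (.inl e)
    | .quarter e a ha => .inr (.inr ⟨e, a, ha⟩)
  invFun
    | .inl (v, p) => .vertex v p.1.1 p.1.2 p.2
    | .inr (.inl e) => .midpoint e
    | .inr (.inr ⟨e, a, ha⟩) => .quarter e a ha
  left_inv l := by cases l <;> rfl
  right_inv l := by rcases l with ⟨v, p⟩ | e | ⟨e, a, ha⟩ <;> rfl

lemma finite_vertices (hK : IsTriangulation K) : K.vertices.Finite :=
  hK.finite.preimage (Finset.singleton_injective.injOn (s := _))

lemma finite_edges (hK : IsTriangulation K) : (edges K).Finite := hK.finite.subset fun _ he => he.1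

lemma finite_hermiteIndex (hK : IsTriangulation K) : Finite (HermiteIndex K) := by
  have := (finite_vertices hK).to_subtype
  have := (finite_edges hK).to_subtype
  exact Finite.of_equiv _ (hermiteIndexEquiv K).symm

lemma card_hermiteIndex (hK : IsTriangulation K) :
    Nat.card (HermiteIndex K) = 10 * K.vertices.ncard + 3 * (edges K).ncard := by
  have := (finite_vertices hK).to_subtype
  have := (finite_edges hK).to_subtype
  have := Fintype.ofFinite (edges K)
  rw [Nat.card_congr (hermiteIndexEquiv K), Nat.card_sum, Nat.card_sum, Nat.card_prod,
    Nat.card_eq_fintype_card (α := Exp3), card_exp3, Nat.card_coe_set_eq, Nat.card_coe_set_eq,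
    Nat.card_sigma, Finset.sum_congr rfl fun e _ => (by simp [e.2.2] :
      Nat.card {a : Plane // a ∈ e.1} = 2), Finset.sum_const, Finset.card_univ,
    ← Nat.card_eq_fintype_card, Nat.card_coe_set_eq, smul_eq_mul]
  ring

end

end PSSpline

end
-- The main theorem
theorem mainTheorem9 (K : Geometry.SimplicialComplex ℝ PSSpline.Plane)
    (hK : PSSpline.IsTriangulation K)
    (x y : PSSpline.Plane → PSSpline.Plane) (u : Finset PSSpline.Plane → PSSpline.Plane)
    (hxy : ∀ v ∈ K.vertices, LinearIndependent ℝ ![x v, y v])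
    (hu : ∀ e ∈ PSSpline.edges K, u e ∉ vectorSpan ℝ (e : Set PSSpline.Plane)) :
    (∃ b : Module.Basis (PSSpline.HermiteIndex K) ℝ
        (Module.Dual ℝ (PSSpline.superSplineSpace K)),
      ∀ (l : PSSpline.HermiteIndex K) (s : PSSpline.superSplineSpace K),
        b l s = PSSpline.hermiteValue K x y u (s : PSSpline.Plane → ℝ) l) ∧
    Module.Finite ℝ (PSSpline.superSplineSpace K) ∧
    Module.finrank ℝ (PSSpline.superSplineSpace K) =
      10 * K.vertices.ncard + 3 * (PSSpline.edges K).ncard := by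
  classical
  have hxy' : ∀ v ∈ K.vertices, PSSpline.cr (x v) (y v) ≠ 0 := fun v hv =>
    (PSSpline.linearIndependent_iff_cr _ _).1 (hxy v hv)
  have hfin := PSSpline.finite_hermiteIndex hK
  -- The nodal basis: coordinates of a spline in `B` are its Hermite values. The dual basis of `B`
  -- therefore consists of the functionals themselves.
  let B := Module.Basis.ofEquivFun (LinearEquiv.ofBijective (PSSpline.hermiteMap hK x y u)
    ⟨PSSpline.hermiteMap_injective hK hxy' hu, PSSpline.hermiteMap_surjective hK hxy' hu⟩)
  refine ⟨⟨B.dualBasis, fun l s => ?_⟩, Module.Finite.of_basis B, ?_⟩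
  · rw [B.dualBasis_apply]
    rfl
  · rw [Module.finrank_eq_nat_card_basis B, PSSpline.card_hermiteIndex hK]
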